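/- Let $n\ge 4$. For $m\in\{n,n+1\}$ let $G^m=O(2,m-1)$ be the group of real $(m+1)\times(m+1)$ matrices preserving $-t_1^2-t_2^2+x_1^2+\dots+x_{m-1}^2$, with Lie algebra $\mathfrak g_m$, and embed $G^n\subset G^{n+1}$ by $x\mapsto\mathrm{diag}(x,1)$. Let $E_{ab}$ ($1\le a,b\le m+1$) be the elementary matrices, and set $H=E_{14}+E_{41}$, $H_2=E_{23}+E_{32}$, $$Q_1^+=E_{12}-E_{21}+E_{24}+E_{42},\qquad Q_2^+=E_{13}+E_{31}-E_{34}+E_{43},$$ $$Y_j^+=E_{1,4+j}+E_{4,4+j}+E_{4+j,1}-E_{4+j,4},\qquad Z_j^+=E_{2,4+j}+E_{3,4+j}+E_{4+j,2}-E_{4+j,3},$$ $M_{ij}=E_{4+i,4+j}-E_{4+j,4+i}$ for $1\le i,j\le m-3$, and $X^-=(X^+)^t$ for $X=Q_1,Q_2,Y_j,Z_j$. Let $\mathfrak n_m^\pm$ be spanned by $Q_1^\pm,Q_2^\pm$ and the $Y_j^\pm$, let $\mathfrak a=\mathbb RH$, and let $\mathfrak m_m$ be spanned by $H_2$, the $Z_j^\pm$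 and the $M_{ij}$. Let $A$, $(N^+)^m$, $M_0^m$ be the analytic subgroups of $G^m$ with Lie algebras $\mathfrak a,\mathfrak n_m^+,\mathfrak m_m$. Let $w_1$, $w_2$ be the diagonal matrices with entry $-1$ in the second, respectively third, position and $1$ elsewhere, and $J_{(m)}=-1$. Put $\hat M^m=\langle w_1,w_2\rangle M_0^m$ and $M^m=Z_K(\mathfrak a)M_0^m=\{1,J_{(m)}\}\hat M^m$, where $K=O(2)\times O(m-1)$, and $P^m=M^mA(N^+)^m$, $\hat P^m=\hat M^mA(N^+)^m$. Let $\sigma_-$ be the character of $M^m$ that is trivial on $\hat M^m$ with $\sigma_-(J_{(m)})=-1$. For $\mu\in\mathbb C$ let $\xi_\mu(\exp(tH))=e^{\mu t}$. For $m\in\{n,n+1\}$ and a character $\sigma$ of $M^m$, let $\mathrm{Ind}_{P^m}^{G^{n+1}}(\xi_\mu\otimes\sigma)$ be the space of all complex-valued $u\in C^\infty(G^{n+1})$ with $u(g\tilde m\tilde a\tilde n)=\sigma(\tilde m)\xi_\mu(\tilde a)u(g)$ for all $g\in G^{n+1}$ and $\tilde m\tilde a\tilde n\in P^m$, with $G^{n+1}$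 acting by left translations; write $\mathrm{Ind}_{P^m}^{G^{n+1}}(\xi_\mu)$ if $\sigma$ is trivial, and define $\mathrm{Ind}_{\hat P^m}^{G^{n+1}}(\xi_\mu)$ in the same way, with $\hat M^m$ in place of $M^m$ and $\sigma$ trivial. The universal enveloping algebra $\mathcal U(\mathfrak n^-_{n+1})$ (with complex coefficients) acts on $C^\infty(G^{n+1})$ by left-invariant differential operators, through $(Xu)(x)=\frac{d}{dt}\big|_{t=0}u(x\exp(tX))$. An element $\mathcal E$ *induces a left $G^{n+1}$-equivariant map* $V\to W$ between two of these spaces if $u\mapsto\mathcal Eu$ maps $V$ into $W$ and the resulting map commutes with left translations. In $\mathcal U(\mathfrak n_{n+1}^-)$ let $\Delta_{n-1}=-(Q_1^-)^2+(Q_2^-)^2+\sum_{j=1}^{n-3}(Y_j^-)^2$ and $T_n=Y_{n-2}^-$. For $\lambda\in\mathbb C$ and an integer $k\ge 0$ let $$\mathcal D^0_{2k}(\lambda)=\sum_{j=0}^k a_j(\lambda)\,\Delta_{n-1}^j\,T_n^{2k-2j},\qquad \mathcal D^0_{2k+1}(\lambda)=\sum_{j=0}^k b_j(\lambda)\,\Delta_{n-1}^j\,T_n^{2k-2j+1},$$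 where $a_k=b_k=1$ and, for $1\le j\le k$, $$(k-j+1)(2k-2j+1)\,a_{j-1}+j(n-1+2\lambda-4k+2j)\,a_j=0,$$ $$(k-j+1)(2k-2j+3)\,b_{j-1}+j(n-3+2\lambda-4k+2j)\,b_j=0.$$ **Theorem.** Let $\lambda\in\mathbb C$, let $N\ge 0$ be an integer and let $\mathcal E\in\mathcal U(\mathfrak n^-_{n+1})$. 1. $\mathcal E$ induces a left $G^{n+1}$-equivariant map $\mathrm{Ind}_{P^{n+1}}^{G^{n+1}}(\xi_\lambda)\to\mathrm{Ind}_{P^n}^{G^{n+1}}(\xi_{\lambda-N})$ if and only if $\mathcal E=c\,\mathcal D_N^0(\lambda)$ for some $c\in\mathbb C$, and $N$ is even or $\mathcal E=0$. 2. $\mathcal E$ induces a left $G^{n+1}$-equivariant map $\mathrm{Ind}_{P^{n+1}}^{G^{n+1}}(\xi_\lambda)\to\mathrm{Ind}_{P^n}^{G^{n+1}}(\xi_{\lambda-N}\otimes\sigma_-)$ if and only if $\mathcal E=c\,\mathcal D_N^0(\lambda)$ for some $c\in\mathbb C$, and $N$ is odd or $\mathcal E=0$. 3. $\mathcal E$ induces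 a left $G^{n+1}$-equivariant map $\mathrm{Ind}_{\hat P^{n+1}}^{G^{n+1}}(\xi_\lambda)\to\mathrm{Ind}_{\hat P^n}^{G^{n+1}}(\xi_{\lambda-N})$ if and only if $\mathcal E=c\,\mathcal D_N^0(\lambda)$ for some $c\in\mathbb C$. -/

import Mathlib

open scoped Matrix.Norms.Operator Matrix TensorProduct ContDiff

noncomputable section

namespace AdS

attribute [local instance 100] LieRing.ofAssociativeRing

/-! ### The group `O(2, m-1)` and its Lie algebra

Coordinates on `ℝ^{m+1}` are `(t₁, t₂, x₁, …, x_{m-1})`, indexed by `0, 1, …, m`. -/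

/-- Real `(m+1) × (m+1)` matrices. -/
abbrev Mat (m : ℕ) : Type := Matrix (Fin (m + 1)) (Fin (m + 1)) ℝ

/-- The signs of the quadratic form `-t₁² - t₂² + x₁² + ⋯ + x_{m-1}²`. -/
def sgn (i : ℕ) : ℝ := if i < 2 then -1 else 1

/-- The Gram matrix `diag(-1, -1, 1, …, 1)`. -/
def eta (m : ℕ) : Mat m := Matrix.diagonal fun i => sgn i

theorem sgn_mul_self (i : ℕ) : sgn i * sgn i = 1 := by
  unfold sgn; split_ifs <;> norm_num

theorem eta_mul_eta (m : ℕ) : eta m * eta m = 1 := by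
  simp [eta, Matrix.diagonal_mul_diagonal, sgn_mul_self]

theorem isUnit_eta (m : ℕ) : IsUnit (eta m) :=
  ⟨⟨eta m, eta m, eta_mul_eta m, eta_mul_eta m⟩, rfl⟩

/-- `G^m = O(2, m-1)`. -/
def G (m : ℕ) : Subgroup (Mat m)ˣ where
  carrier := {g | (g : Mat m)ᵀ * eta m * (g : Mat m) = eta m}
  one_mem' := by simp
  mul_mem' := by
    intro a b ha hb
    simp only [Set.mem_ofPred_eq] at ha hb ⊢
    calc ((a * b : (Mat m)ˣ) : Mat m)ᵀ * eta m * ((a * b : (Mat m)ˣ) : Mat m)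
        = (b : Mat m)ᵀ * ((a : Mat m)ᵀ * eta m * (a : Mat m)) * (b : Mat m) := by
          simp [Matrix.transpose_mul, mul_assoc]
      _ = eta m := by rw [ha, hb]
  inv_mem' := by
    intro a ha
    simp only [Set.mem_ofPred_eq] at ha ⊢
    have h1 : (a : Mat m) * ((a⁻¹ : (Mat m)ˣ) : Mat m) = 1 := by simp
    have h2 : ((a⁻¹ : (Mat m)ˣ) : Mat m)ᵀ * (a : Mat m)ᵀ = 1 := by
      rw [← Matrix.transpose_mul, h1, Matrix.transpose_one]
    calc ((a⁻¹ : (Mat m)ˣ) : Mat m)ᵀ * eta m * ((a⁻¹ : (Mat m)ˣ) : Mat m)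
        = ((a⁻¹ : (Mat m)ˣ) : Mat m)ᵀ * ((a : Mat m)ᵀ * eta m * (a : Mat m)) *
            ((a⁻¹ : (Mat m)ˣ) : Mat m) := by rw [ha]
      _ = (((a⁻¹ : (Mat m)ˣ) : Mat m)ᵀ * (a : Mat m)ᵀ) * eta m *
            ((a : Mat m) * ((a⁻¹ : (Mat m)ˣ) : Mat m)) := by simp only [mul_assoc]
      _ = eta m := by rw [h1, h2, one_mul, mul_one]

/-- The matrix of a group element. -/
def mat {m : ℕ} (x : G m) : Mat m := ((x : (Mat m)ˣ) : Mat m)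

theorem mat_mul {m : ℕ} (x y : G m) : mat (x * y) = mat x * mat y := rfl

theorem mat_one {m : ℕ} : mat (1 : G m) = 1 := rfl

theorem mat_injective {m : ℕ} : Function.Injective (mat (m := m)) := fun _ _ h =>
  Subtype.ext (Units.ext h)

theorem mat_gram {m : ℕ} (x : G m) : (mat x)ᵀ * eta m * mat x = eta m := x.2

theorem left_inv_of_gram {m : ℕ} {A : Mat m} (h : Aᵀ * eta m * A = eta m) :
    (eta m * Aᵀ * eta m) * A = 1 := by
  rw [show (eta m * Aᵀ * eta m) * A = eta m * (Aᵀ * eta m * A) by simp only [mul_assoc], h,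
    eta_mul_eta]

/-- A matrix that preserves the quadratic form, as an element of `G^m`. -/
def ofMat {m : ℕ} (A : Mat m) (h : Aᵀ * eta m * A = eta m) : G m :=
  ⟨⟨A, eta m * Aᵀ * eta m, mul_eq_one_comm.mp (left_inv_of_gram h),
    left_inv_of_gram h⟩, h⟩

theorem mat_ofMat {m : ℕ} (A : Mat m) (h : Aᵀ * eta m * A = eta m) : mat (ofMat A h) = A := rfl

theorem mat_inv {m : ℕ} (x : G m) : mat x⁻¹ = eta m * (mat x)ᵀ * eta m := by
  have h1 : mat x⁻¹ * mat x = 1 := by rw [← mat_mul, inv_mul_cancel, mat_one]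
  have h2 : mat x * mat x⁻¹ = 1 := by rw [← mat_mul, mul_inv_cancel, mat_one]
  calc mat x⁻¹ = (eta m * (mat x)ᵀ * eta m * mat x) * mat x⁻¹ := by
        rw [left_inv_of_gram (mat_gram x), one_mul]
    _ = eta m * (mat x)ᵀ * eta m := by rw [mul_assoc _ (mat x), h2, mul_one]

/-- The Lie algebra `𝔤_m = 𝔬(2, m-1)` of all `X` with `Xᵀ η = - η X`. -/
abbrev soLie (m : ℕ) : LieSubalgebra ℝ (Mat m) := skewAdjointMatricesLieSubalgebra (eta m)

theorem mem_soLie {m : ℕ} {X : Mat m} : X ∈ soLie m ↔ Xᵀ * eta m = eta m * (-X) := by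
  simp [Matrix.IsSkewAdjoint, Matrix.IsAdjointPair]

/-- The exponential map `𝔤_m → G^m`. -/
def expG {m : ℕ} (X : soLie m) : G m :=
  ofMat (NormedSpace.exp (X : Mat m)) (by
    have hX : (X : Mat m)ᵀ * eta m = eta m * (-(X : Mat m)) := mem_soLie.mp X.2
    have h : SemiconjBy (eta m) (-(X : Mat m)) ((X : Mat m)ᵀ) := hX.symm
    have h' : eta m * NormedSpace.exp (-(X : Mat m)) =
        NormedSpace.exp ((X : Mat m)ᵀ) * eta m := h.exp_right
    rw [← Matrix.exp_transpose, ← h', mul_assoc,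
      ← Matrix.exp_add_of_commute (-(X : Mat m)) (X : Mat m) ((Commute.refl (X : Mat m)).neg_left),
      neg_add_cancel, NormedSpace.exp_zero, mul_one])

theorem mat_expG {m : ℕ} (X : soLie m) : mat (expG X) = NormedSpace.exp (X : Mat m) := rfl

/-- The inclusion `x ↦ diag(x, 1)` of matrices. -/
def embMat {m : ℕ} (A : Mat m) : Mat (m + 1) :=
  Matrix.reindex finSumFinEquiv finSumFinEquiv
    (Matrix.fromBlocks A 0 0 (1 : Matrix (Fin 1) (Fin 1) ℝ))

theorem embMat_mul {m : ℕ} (A B : Mat m) : embMat (A * B) = embMat A * embMat B := by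
  simp only [embMat, Matrix.reindex_apply, Matrix.submatrix_mul_equiv, Matrix.fromBlocks_multiply]
  simp

theorem embMat_one {m : ℕ} : embMat (1 : Mat m) = 1 := by
  simp [embMat]

theorem embMat_transpose {m : ℕ} (A : Mat m) : (embMat A)ᵀ = embMat Aᵀ := by
  simp only [embMat, Matrix.reindex_apply, Matrix.transpose_submatrix,
    Matrix.fromBlocks_transpose, Matrix.transpose_zero, Matrix.transpose_one]

theorem embMat_eta {m : ℕ} (hm : 1 ≤ m) : embMat (eta m) = eta (m + 1) := by
  ext i j
  obtain ⟨i, rfl⟩ := finSumFinEquiv.surjective i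
  obtain ⟨j, rfl⟩ := finSumFinEquiv.surjective j
  rcases i with i | i <;> rcases j with j | j <;>
    simp [embMat, eta, Matrix.diagonal_apply, sgn, Fin.ext_iff, Matrix.one_apply]
  all_goals omega

/-- The inclusion `i : O(2, m-1) → O(2, m)`, `x ↦ diag(x, 1)` (for `m ≥ 1`). -/
def emb {m : ℕ} (hm : 1 ≤ m) : G m →* G (m + 1) where
  toFun x := ofMat (embMat (mat x)) (by
    rw [← embMat_eta hm, embMat_transpose, ← embMat_mul, ← embMat_mul, mat_gram])
  map_one' := mat_injective (by rw [mat_ofMat, mat_one, mat_one, embMat_one])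
  map_mul' x y := mat_injective (by
    rw [mat_ofMat, mat_mul, mat_mul, mat_ofMat, mat_ofMat, embMat_mul])

/-! ### Smooth functions on `G^m` -/

/-- `u : G^m → ℂ` is smooth: `G^m` is an embedded submanifold of the space of matrices, and
locally `u` is the restriction of a smooth function defined on an open set of matrices. -/
def IsSmooth {m : ℕ} (u : G m → ℂ) : Prop :=
  ∀ x : G m, ∃ U : Set (Mat m), IsOpen U ∧ mat x ∈ U ∧
    ∃ F : Mat m → ℂ, ContDiffOn ℝ ∞ F U ∧ ∀ y : G m, mat y ∈ U → u y = F (mat y)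

/-- `C^∞(G^m)`, complex valued. -/
def Smooth (m : ℕ) : Submodule ℂ (G m → ℂ) where
  carrier := {u | IsSmooth u}
  zero_mem' := fun _ => ⟨Set.univ, isOpen_univ, Set.mem_univ _, fun _ => 0, contDiffOn_const,
    fun _ _ => rfl⟩
  add_mem' := by
    intro u v hu hv x
    obtain ⟨U, hU, hxU, F, hF, huF⟩ := hu x
    obtain ⟨V, hV, hxV, F', hF', hvF⟩ := hv x
    exact ⟨U ∩ V, hU.inter hV, ⟨hxU, hxV⟩, fun Z => F Z + F' Z,
      (hF.mono Set.inter_subset_left).add (hF'.mono Set.inter_subset_right),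
      fun y hy => by simp [huF y hy.1, hvF y hy.2]⟩
  smul_mem' := by
    intro c u hu x
    obtain ⟨U, hU, hxU, F, hF, huF⟩ := hu x
    exact ⟨U, hU, hxU, fun Z => c * F Z, contDiffOn_const.mul hF,
      fun y hy => by simp [huF y hy]⟩

/-- Left translation `(π(g) u)(x) = u(g⁻¹ x)` on `C^∞(G^m)`. -/
def leftRep (m : ℕ) : Representation ℂ (G m) (Smooth m) where
  toFun g :=
    { toFun := fun u => ⟨fun x => u.1 (g⁻¹ * x), by
        intro x
        obtain ⟨U, hU, hxU, F, hF, huF⟩ := u.2 (g⁻¹ * x)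
        have hc : ContDiff ℝ ∞ (fun Z : Mat m => mat g⁻¹ * Z) := contDiff_const.mul contDiff_id
        exact ⟨(fun Z : Mat m => mat g⁻¹ * Z) ⁻¹' U, hU.preimage hc.continuous, hxU,
          fun Z => F (mat g⁻¹ * Z), hF.comp hc.contDiffOn (fun _ h => h),
          fun y hy => huF (g⁻¹ * y) hy⟩⟩
      map_add' := fun _ _ => rfl
      map_smul' := fun _ _ => rfl }
  map_one' := by
    ext u x
    simp
  map_mul' g h := by
    ext u x
    simp [mul_assoc]

/-! ### The right regular action -/

theorem hasDerivAt_right {m : ℕ} {u : G m → ℂ} {U : Set (Mat m)} (hU : IsOpen U)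
    {F : Mat m → ℂ} (hF : ContDiffOn ℝ ∞ F U) (huF : ∀ y : G m, mat y ∈ U → u y = F (mat y))
    (X : soLie m) {x : G m} (hx : mat x ∈ U) :
    HasDerivAt (fun t : ℝ => u (x * expG (t • X)))
      (fderiv ℝ F (mat x) (mat x * (X : Mat m))) 0 := by
  have hc : HasDerivAt (fun t : ℝ => mat x * NormedSpace.exp (t • (X : Mat m)))
      (mat x * (X : Mat m)) 0 := by
    have h := (hasDerivAt_exp_smul_const (𝕂 := ℝ) (X : Mat m) 0).const_mul (mat x)
    rw [zero_smul, NormedSpace.exp_zero, one_mul] at h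
    exact h
  have h0 : mat x * NormedSpace.exp ((0 : ℝ) • (X : Mat m)) = mat x := by simp
  have hd : DifferentiableAt ℝ F (mat x) :=
    (hF.differentiableOn (by simp)).differentiableAt (hU.mem_nhds hx)
  have hd' : HasFDerivAt F (fderiv ℝ F (mat x))
      (mat x * NormedSpace.exp ((0 : ℝ) • (X : Mat m))) := by
    rw [h0]; exact hd.hasFDerivAt
  have h1 := hd'.comp_hasDerivAt (0 : ℝ) hc
  refine h1.congr_of_eventuallyEq ?_
  have hev : ∀ᶠ t in nhds (0 : ℝ), mat x * NormedSpace.exp (t • (X : Mat m)) ∈ U := by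
    refine hc.continuousAt.eventually (hU.mem_nhds ?_)
    change mat x * NormedSpace.exp ((0 : ℝ) • (X : Mat m)) ∈ U
    rw [h0]; exact hx
  filter_upwards [hev] with t ht
  exact huF (x * expG (t • X)) ht

theorem contDiffOn_right {m : ℕ} {U : Set (Mat m)} (hU : IsOpen U)
    {F : Mat m → ℂ} (hF : ContDiffOn ℝ ∞ F U) (A : Mat m) :
    ContDiffOn ℝ ∞ (fun Z : Mat m => fderiv ℝ F Z (Z * A)) U :=
  (hF.fderiv_of_isOpen hU (by simp)).clm_apply (contDiff_id.mul contDiff_const).contDiffOn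

/-- The operator `(R(X) u)(x) = d/dt|_{t=0} u(x exp(tX))` on `C^∞(G^m)`. -/
def rightOp {m : ℕ} (X : soLie m) : Module.End ℂ (Smooth m) where
  toFun u := ⟨fun x => deriv (fun t : ℝ => u.1 (x * expG (t • X))) 0, by
    intro x
    obtain ⟨U, hU, hxU, F, hF, huF⟩ := u.2 x
    exact ⟨U, hU, hxU, fun Z => fderiv ℝ F Z (Z * (X : Mat m)), contDiffOn_right hU hF _,
      fun y hy => (hasDerivAt_right hU hF huF X hy).deriv⟩⟩
  map_add' u v := by
    ext x
    obtain ⟨U, hU, hxU, F, hF, huF⟩ := u.2 x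
    obtain ⟨V, hV, hxV, F', hF', hvF⟩ := v.2 x
    exact ((hasDerivAt_right hU hF huF X hxU).differentiableAt.hasDerivAt.add
      (hasDerivAt_right hV hF' hvF X hxV).differentiableAt.hasDerivAt).deriv
  map_smul' c u := by
    ext x
    obtain ⟨U, hU, hxU, F, hF, huF⟩ := u.2 x
    exact ((hasDerivAt_right hU hF huF X hxU).differentiableAt.hasDerivAt.const_mul c).deriv

theorem rightOp_apply {m : ℕ} (X : soLie m) (u : Smooth m) (x : G m) :
    (rightOp X u).1 x = deriv (fun t : ℝ => u.1 (x * expG (t • X))) 0 := rfl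

theorem rightOp_eq {m : ℕ} (X : soLie m) (u : Smooth m) {U : Set (Mat m)} (hU : IsOpen U)
    {F : Mat m → ℂ} (hF : ContDiffOn ℝ ∞ F U) (huF : ∀ y : G m, mat y ∈ U → u.1 y = F (mat y))
    {x : G m} (hx : mat x ∈ U) :
    (rightOp X u).1 x = fderiv ℝ F (mat x) (mat x * (X : Mat m)) :=
  (hasDerivAt_right hU hF huF X hx).deriv

theorem rightOp_rightOp {m : ℕ} (X Y : soLie m) (u : Smooth m) {U : Set (Mat m)} (hU : IsOpen U)
    {F : Mat m → ℂ} (hF : ContDiffOn ℝ ∞ F U) (huF : ∀ y : G m, mat y ∈ U → u.1 y = F (mat y))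
    {x : G m} (hx : mat x ∈ U) :
    (rightOp X (rightOp Y u)).1 x =
      fderiv ℝ (fderiv ℝ F) (mat x) (mat x * (X : Mat m)) (mat x * (Y : Mat m)) +
        fderiv ℝ F (mat x) (mat x * (X : Mat m) * (Y : Mat m)) := by
  rw [rightOp_eq X (rightOp Y u) hU (contDiffOn_right hU hF (Y : Mat m))
    (fun y hy => rightOp_eq Y u hU hF huF hy) hx]
  have h1 : DifferentiableAt ℝ (fderiv ℝ F) (mat x) :=
    ((hF.fderiv_of_isOpen (m := ∞) hU (by simp)).differentiableOn (by simp)).differentiableAt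
      (hU.mem_nhds hx)
  have h2 : HasFDerivAt (fun Z : Mat m => Z * (Y : Mat m))
      ((ContinuousLinearMap.mul ℝ (Mat m)).flip (Y : Mat m)) (mat x) :=
    ((ContinuousLinearMap.mul ℝ (Mat m)).flip (Y : Mat m)).hasFDerivAt
  have h3 := congrArg (fun L : Mat m →L[ℝ] ℂ => L (mat x * (X : Mat m)))
    (h1.hasFDerivAt.clm_apply h2).fderiv
  refine h3.trans ?_
  change fderiv ℝ F (mat x) (mat x * (X : Mat m) * (Y : Mat m)) +
    fderiv ℝ (fderiv ℝ F) (mat x) (mat x * (X : Mat m)) (mat x * (Y : Mat m)) = _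
  exact add_comm _ _

/-- The right regular action `R` of the Lie algebra `𝔤_m` on `C^∞(G^m)`. -/
def rightLie (m : ℕ) : soLie m →ₗ⁅ℝ⁆ Module.End ℂ (Smooth m) where
  toFun := rightOp
  map_add' X Y := by
    ext u x
    obtain ⟨U, hU, hxU, F, hF, huF⟩ := u.2 x
    change (rightOp (X + Y) u).1 x = (rightOp X u).1 x + (rightOp Y u).1 x
    simp only [rightOp_eq _ u hU hF huF hxU]
    simp [mul_add]
  map_smul' c X := by
    ext u x
    obtain ⟨U, hU, hxU, F, hF, huF⟩ := u.2 x
    change (rightOp (c • X) u).1 x = c • (rightOp X u).1 x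
    simp only [rightOp_eq _ u hU hF huF hxU]
    simp
  map_lie' := by
    intro X Y
    ext u x
    obtain ⟨U, hU, hxU, F, hF, huF⟩ := u.2 x
    change (rightOp ⁅X, Y⁆ u).1 x =
      (rightOp X (rightOp Y u)).1 x - (rightOp Y (rightOp X u)).1 x
    rw [rightOp_eq _ u hU hF huF hxU, rightOp_rightOp X Y u hU hF huF hxU,
      rightOp_rightOp Y X u hU hF huF hxU]
    have hs : IsSymmSndFDerivAt ℝ F (mat x) :=
      (hF.contDiffAt (hU.mem_nhds hxU)).isSymmSndFDerivAt (by
        rw [minSmoothness_of_isRCLikeNormedField]; exact WithTop.coe_le_coe.mpr (le_top : (2 : ℕ∞) ≤ ⊤))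
    have he : fderiv ℝ (fderiv ℝ F) (mat x) (mat x * (X : Mat m)) (mat x * (Y : Mat m)) =
        fderiv ℝ (fderiv ℝ F) (mat x) (mat x * (Y : Mat m)) (mat x * (X : Mat m)) :=
      hs.eq (mat x * (X : Mat m)) (mat x * (Y : Mat m))
    rw [he]
    have hb : ((⁅X, Y⁆ : soLie m) : Mat m) = (X : Mat m) * Y - (Y : Mat m) * X := rfl
    rw [hb, mul_sub, map_sub, mul_assoc, mul_assoc]
    ring

/-! ### The basis of `𝔤_m` adapted to the restricted roots

Matrix positions are counted from `0`; the index `j` of `Y_j`, `Z_j`, `M_{ij}` is counted from `0`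
too (so `Yp m j` is `Y_{j+1}^+`, with `0 ≤ j ≤ m - 4`), and the matrix is zero if `j` is too
large. -/

/-- The elementary matrix with entry `1` at position `(i, j)`. -/
def E (m i j : ℕ) : Mat m := Matrix.of fun a b => if a.val = i ∧ b.val = j then 1 else 0

def H (m : ℕ) : Mat m := E m 0 3 + E m 3 0

def H₂ (m : ℕ) : Mat m := E m 1 2 + E m 2 1

/-- `M_{i+1, j+1}`. -/
def Mrot (m i j : ℕ) : Mat m := E m (4 + i) (4 + j) - E m (4 + j) (4 + i)

/-- `Y_{j+1}^+`. -/
def Yp (m j : ℕ) : Mat m := E m 0 (4 + j) + E m 3 (4 + j) + E m (4 + j) 0 - E m (4 + j) 3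

/-- `Z_{j+1}^+`. -/
def Zp (m j : ℕ) : Mat m := E m 1 (4 + j) + E m 2 (4 + j) + E m (4 + j) 1 - E m (4 + j) 2

def Q₁p (m : ℕ) : Mat m := E m 0 1 - E m 1 0 + E m 1 3 + E m 3 1

def Q₂p (m : ℕ) : Mat m := E m 0 2 + E m 2 0 - E m 2 3 + E m 3 2

theorem E_transpose (m i j : ℕ) : (E m i j)ᵀ = E m j i := by
  ext a b; simp [E, and_comm]

theorem eta_mul_E (m i j : ℕ) : eta m * E m i j = sgn i • E m i j := by
  ext a b
  by_cases h : a.val = i <;> simp [eta, E, h]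

theorem E_mul_eta (m i j : ℕ) : E m i j * eta m = sgn j • E m i j := by
  ext a b
  by_cases h : b.val = j <;> simp [eta, E, h]

theorem sgn_four_add (j : ℕ) : sgn (4 + j) = 1 := by
  unfold sgn; rw [if_neg (by omega)]

theorem H_mem (m : ℕ) : H m ∈ soLie m := by
  rw [mem_soLie]
  simp only [H, Matrix.transpose_add, E_transpose, add_mul, mul_add, mul_neg, E_mul_eta, eta_mul_E]
  norm_num [sgn]

theorem Q₁p_transpose_mem (m : ℕ) : (Q₁p m)ᵀ ∈ soLie m := by
  rw [mem_soLie]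
  simp only [Q₁p, Matrix.transpose_add, Matrix.transpose_sub, E_transpose, add_mul, mul_add,
    sub_mul, mul_sub, mul_neg, E_mul_eta, eta_mul_E]
  norm_num [sgn]
  abel

theorem Q₂p_transpose_mem (m : ℕ) : (Q₂p m)ᵀ ∈ soLie m := by
  rw [mem_soLie]
  simp only [Q₂p, Matrix.transpose_add, Matrix.transpose_sub, E_transpose, add_mul, mul_add,
    sub_mul, mul_sub, mul_neg, E_mul_eta, eta_mul_E]
  norm_num [sgn]
  abel

theorem Yp_transpose_mem (m j : ℕ) : (Yp m j)ᵀ ∈ soLie m := by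
  rw [mem_soLie]
  simp only [Yp, Matrix.transpose_add, Matrix.transpose_sub, E_transpose, add_mul, mul_add,
    sub_mul, mul_sub, mul_neg, E_mul_eta, eta_mul_E, sgn_four_add]
  norm_num [sgn]
  abel

/-- `H` as an element of `𝔤_m`. -/
def HLie (m : ℕ) : soLie m := ⟨H m, H_mem m⟩

/-- `𝔫_m^+`, spanned by the `Y_j^+` and `Q_1^+`, `Q_2^+`. -/
def nPlus (m : ℕ) : LieSubalgebra ℝ (soLie m) :=
  LieSubalgebra.lieSpan ℝ (soLie m)
    {X | (X : Mat m) = Q₁p m ∨ (X : Mat m) = Q₂p m ∨ ∃ j : ℕ, (X : Mat m) = Yp m j}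

/-- `𝔫_m^-`, spanned by the `Y_j^-` and `Q_1^-`, `Q_2^-`. -/
def nMinus (m : ℕ) : LieSubalgebra ℝ (soLie m) :=
  LieSubalgebra.lieSpan ℝ (soLie m)
    {X | (X : Mat m) = (Q₁p m)ᵀ ∨ (X : Mat m) = (Q₂p m)ᵀ ∨ ∃ j : ℕ, (X : Mat m) = (Yp m j)ᵀ}

/-- `𝔪_m`, spanned by the `M_{ij}`, the `Z_j^±` and `H_2`. -/
def mLie (m : ℕ) : LieSubalgebra ℝ (soLie m) :=
  LieSubalgebra.lieSpan ℝ (soLie m)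
    {X | (X : Mat m) = H₂ m ∨ (∃ i j : ℕ, (X : Mat m) = Mrot m i j) ∨
      ∃ j : ℕ, (X : Mat m) = Zp m j ∨ (X : Mat m) = (Zp m j)ᵀ}

/-! ### The groups `M_0`, `N^+`, `M`, `M̂` and the character `σ_-` -/

/-- The analytic (connected) subgroup of `G^m` with Lie algebra `𝔥`, generated by `exp 𝔥`. -/
def analyticSubgroup {m : ℕ} (h : LieSubalgebra ℝ (soLie m)) : Subgroup (G m) :=
  Subgroup.closure (expG '' (h : Set (soLie m)))

def M₀ (m : ℕ) : Subgroup (G m) := analyticSubgroup (mLie m)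

def Nplus (m : ℕ) : Subgroup (G m) := analyticSubgroup (nPlus m)

/-- `Z_K(𝔞)`: the elements of `K = O(2) × O(m-1) = G^m ∩ O(m+1)` that commute with `H`. -/
def ZKa (m : ℕ) : Subgroup (G m) where
  carrier := {k | (mat k)ᵀ * mat k = 1 ∧ mat k * H m = H m * mat k}
  one_mem' := by simp [mat_one]
  mul_mem' := by
    rintro a b ⟨ha, ha'⟩ ⟨hb, hb'⟩
    refine ⟨?_, ?_⟩
    · rw [mat_mul, Matrix.transpose_mul, mul_assoc, ← mul_assoc _ (mat a), ha, one_mul, hb]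
    · rw [mat_mul, mul_assoc, hb', ← mul_assoc, ha', mul_assoc]
  inv_mem' := by
    rintro a ⟨ha, ha'⟩
    have h1 : mat a⁻¹ * mat a = 1 := by rw [← mat_mul, inv_mul_cancel, mat_one]
    have h2 : mat a * mat a⁻¹ = 1 := by rw [← mat_mul, mul_inv_cancel, mat_one]
    have h3 : mat a⁻¹ = (mat a)ᵀ := by
      rw [← mul_one (mat a)ᵀ, ← h2, ← mul_assoc, ha, one_mul]
    refine ⟨?_, ?_⟩
    · rw [h3, Matrix.transpose_transpose, ← h3, h2]
    · calc mat a⁻¹ * H m = mat a⁻¹ * (H m * mat a) * mat a⁻¹ := by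
            rw [mul_assoc, mul_assoc, h2, mul_one]
        _ = H m * mat a⁻¹ := by rw [← ha', ← mul_assoc, h1, one_mul]

/-- `M = Z_K(𝔞) M_0`. -/
def M (m : ℕ) : Subgroup (G m) := ZKa m ⊔ M₀ m

/-- The diagonal element with `-1` exactly at the positions in `s`. -/
def signElt (m : ℕ) (s : Set ℕ) [DecidablePred (· ∈ s)] : G m :=
  ofMat (Matrix.diagonal fun i => if i.val ∈ s then -1 else 1) (by
    rw [Matrix.diagonal_transpose, eta, Matrix.diagonal_mul_diagonal,
      Matrix.diagonal_mul_diagonal]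
    congr 1
    ext i
    split_ifs <;> ring)

def w₁ (m : ℕ) : G m := signElt m {1}

def w₂ (m : ℕ) : G m := signElt m {2}

/-- `J_{(m)} = -1`. -/
def J (m : ℕ) : G m := signElt m Set.univ

/-- `M̂ = ⟨w₁, w₂⟩ M_0`. -/
def Mhat (m : ℕ) : Subgroup (G m) := Subgroup.closure {w₁ m, w₂ m} ⊔ M₀ m

/-- The elements whose matrix is zero off the diagonal in its first row and column. -/
def axisSubgroup (m : ℕ) : Subgroup (G m) where
  carrier := {g | ∀ i, i ≠ 0 → mat g i 0 = 0 ∧ mat g 0 i = 0}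
  one_mem' := by
    intro i hi
    simp [mat_one, hi, hi.symm]
  mul_mem' := by
    intro a b ha hb i hi
    rw [mat_mul, Matrix.mul_apply, Matrix.mul_apply]
    constructor <;> refine Finset.sum_eq_zero fun j _ => ?_ <;> by_cases hj : j = 0
    · rw [hj, (ha i hi).1, zero_mul]
    · rw [(hb j hj).1, mul_zero]
    · rw [hj, (hb i hi).2, mul_zero]
    · rw [(ha j hj).2, zero_mul]
  inv_mem' := by
    intro a ha i hi
    rw [mat_inv]
    simp [eta, (ha i hi).1, (ha i hi).2]

theorem mat_mul_zero_zero {m : ℕ} (x : G m) {y : G m} (hy : y ∈ axisSubgroup m) :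
    mat (x * y) 0 0 = mat x 0 0 * mat y 0 0 := by
  rw [mat_mul, Matrix.mul_apply]
  refine Finset.sum_eq_single 0 (fun j _ hj => ?_) (by simp)
  rw [(hy j hj).1, mul_zero]

theorem mLie_axis {m : ℕ} {X : soLie m} (hX : X ∈ mLie m) (i : Fin (m + 1)) :
    (X : Mat m) i 0 = 0 ∧ (X : Mat m) 0 i = 0 := by
  induction hX using LieSubalgebra.lieSpan_induction generalizing i with
  | mem X h =>
    rcases h with h | ⟨j, k, h⟩ | ⟨j, h | h⟩ <;> rw [h] <;>
      constructor <;>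
      simp only [H₂, Mrot, Zp, E, Matrix.add_apply, Matrix.sub_apply, Matrix.of_apply,
        Matrix.transpose_apply, Fin.val_zero] <;>
      norm_num [show ∀ k : ℕ, 0 ≠ 4 + k from fun k => by omega]
  | zero => simp
  | add X Y _ _ hX hY => simp [hX i, hY i]
  | smul c X _ hX => simp [hX i]
  | lie X Y _ _ hX hY =>
    have hb : ((⁅X, Y⁆ : soLie m) : Mat m) = (X : Mat m) * Y - (Y : Mat m) * X := rfl
    rw [hb]
    simp [Matrix.mul_apply, fun j => (hX j).1, fun j => (hX j).2, fun j => (hY j).1,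
      fun j => (hY j).2]

theorem M₀_axis {m : ℕ} {x : G m} (hx : x ∈ M₀ m) : x ∈ axisSubgroup m ∧ mat x 0 0 = 1 := by
  induction hx using Subgroup.closure_induction with
  | mem x h =>
    obtain ⟨X, hX, rfl⟩ := h
    have h1 : E m 0 0 * (X : Mat m) = 0 := by
      ext a b
      rw [Matrix.mul_apply]
      refine Finset.sum_eq_zero fun j _ => ?_
      by_cases hj : j = 0
      · rw [hj, (mLie_axis hX b).2, mul_zero]
      · simp [E, hj]
    have h2 : (X : Mat m) * E m 0 0 = 0 := by
      ext a b
      rw [Matrix.mul_apply]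
      refine Finset.sum_eq_zero fun j _ => ?_
      by_cases hj : j = 0
      · rw [hj, (mLie_axis hX a).1, zero_mul]
      · simp [E, hj]
    have h3 : E m 0 0 * NormedSpace.exp (X : Mat m) = E m 0 0 := by
      have : SemiconjBy (E m 0 0) (X : Mat m) 0 := by
        rw [SemiconjBy, h1, zero_mul]
      have h := this.exp_right.eq
      rw [NormedSpace.exp_zero, one_mul] at h
      exact h
    have h4 : NormedSpace.exp (X : Mat m) * E m 0 0 = E m 0 0 := by
      have : SemiconjBy (E m 0 0) 0 (X : Mat m) := by
        rw [SemiconjBy, h2, mul_zero]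
      have h := this.exp_right.eq
      rw [NormedSpace.exp_zero, mul_one] at h
      exact h.symm
    have h5 : ∀ i, NormedSpace.exp (X : Mat m) 0 i = E m 0 0 0 i := by
      intro i
      conv_rhs => rw [← h3, Matrix.mul_apply]
      rw [Finset.sum_eq_single 0 (fun j _ hj => ?_) (by simp)]
      · simp [E]
      · simp [E, hj]
    have h6 : ∀ i, NormedSpace.exp (X : Mat m) i 0 = E m 0 0 i 0 := by
      intro i
      conv_rhs => rw [← h4, Matrix.mul_apply]
      rw [Finset.sum_eq_single 0 (fun j _ hj => ?_) (by simp)]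
      · simp [E]
      · simp [E, hj]
    refine ⟨fun i hi => ?_, ?_⟩
    · rw [mat_expG, h5, h6]
      simp [E, hi]
    · rw [mat_expG, h5]
      simp [E]
  | one => exact ⟨one_mem _, by simp [mat_one]⟩
  | mul x y _ _ hx hy => exact ⟨mul_mem hx.1 hy.1, by rw [mat_mul_zero_zero x hy.1, hx.2, hy.2,
      one_mul]⟩
  | inv x _ hx => exact ⟨inv_mem hx.1, by rw [mat_inv]; simp [eta, hx.2, sgn]⟩

theorem ZKa_le_axis {m : ℕ} (hm : 4 ≤ m) : ZKa m ≤ axisSubgroup m := by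
  rintro k ⟨hk, hH⟩
  have hblock : eta m * mat k = mat k * eta m := by
    have h1 : mat k * (mat k)ᵀ = 1 := mul_eq_one_comm.mp hk
    calc eta m * mat k = (mat k * (mat k)ᵀ) * eta m * mat k := by rw [h1, one_mul]
      _ = mat k * ((mat k)ᵀ * eta m * mat k) := by simp only [mul_assoc]
      _ = mat k * eta m := by rw [mat_gram]
  obtain ⟨p, hp⟩ : ∃ p : Fin (m + 1), p.val = 3 := ⟨⟨3, by omega⟩, rfl⟩
  have hE : H m = Matrix.single 0 p 1 + Matrix.single p 0 1 := by
    ext a b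
    simp only [H, E, Matrix.add_apply, Matrix.of_apply, Matrix.single_apply, Fin.ext_iff, hp,
      Fin.val_zero, @eq_comm ℕ 0, @eq_comm ℕ 3]
  have hp0 : p ≠ 0 := fun h => by rw [h] at hp; simp at hp
  have hs3 : sgn 3 = 1 := by norm_num [sgn]
  have hs0 : sgn 0 = -1 := by norm_num [sgn]
  have e1 := congrFun (congrFun hblock p) 0
  have e2 := congrFun (congrFun hblock 0) p
  simp only [eta, Matrix.diagonal_mul, Matrix.mul_diagonal, hp, Fin.val_zero, hs3, hs0] at e1 e2
  have f1 : mat k p 0 = 0 := by linarith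
  have f2 : mat k 0 p = 0 := by linarith
  intro i hi
  by_cases hip : i = p
  · rw [hip]; exact ⟨f1, f2⟩
  · have g1 := congrFun (congrFun hH i) p
    have g2 := congrFun (congrFun hH p) i
    rw [hE] at g1 g2
    simp [Matrix.mul_apply, Matrix.single_apply, hp0.symm, Ne.symm hi, Ne.symm hip] at g1 g2
    exact ⟨by linarith, by linarith⟩

theorem M_le_axis {m : ℕ} (hm : 4 ≤ m) : M m ≤ axisSubgroup m :=
  sup_le (ZKa_le_axis hm) fun _ hx => (M₀_axis hx).1

/-- The character `σ_-` of `M`: the sign `± 1` by which an element of `M` acts on the first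
basis vector. It is trivial on `⟨w₁, w₂⟩ M_0`, and `σ_-(J) = -1`. -/
def sigmaMinus {m : ℕ} (hm : 4 ≤ m) : M m →* ℂ where
  toFun k := ((mat (k : G m) 0 0 : ℝ) : ℂ)
  map_one' := by simp [mat_one]
  map_mul' x y := by
    rw [Subgroup.coe_mul, mat_mul_zero_zero (x : G m) (M_le_axis hm y.2), Complex.ofReal_mul]

theorem sigmaMinus_apply {m : ℕ} (hm : 4 ≤ m) (k : M m) :
    sigmaMinus hm k = ((mat (k : G m) 0 0 : ℝ) : ℂ) := rfl

theorem sigmaMinus_Mhat {m : ℕ} (hm : 4 ≤ m) (k : M m) (hk : (k : G m) ∈ Mhat m) :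
    sigmaMinus hm k = 1 := by
  have hs : ∀ s : Set ℕ, ∀ _ : DecidablePred (· ∈ s), 0 ∉ s →
      signElt m s ∈ axisSubgroup m ∧ mat (signElt m s) 0 0 = 1 := by
    intro s _ h0
    refine ⟨fun i hi => ?_, ?_⟩
    · rw [signElt, mat_ofMat, Matrix.diagonal_apply_ne _ hi, Matrix.diagonal_apply_ne _ hi.symm]
      exact ⟨rfl, rfl⟩
    · rw [signElt, mat_ofMat, Matrix.diagonal_apply_eq, if_neg]
      simpa using h0
  let A : Subgroup (G m) :=
    { carrier := {x | x ∈ axisSubgroup m ∧ mat x 0 0 = 1}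
      one_mem' := ⟨one_mem _, by simp [mat_one]⟩
      mul_mem' := fun {x y} hx hy =>
        ⟨mul_mem hx.1 hy.1, by rw [mat_mul_zero_zero x hy.1, hx.2, hy.2, one_mul]⟩
      inv_mem' := fun {x} hx => ⟨inv_mem hx.1, by rw [mat_inv]; simp [eta, hx.2, sgn]⟩ }
  have hA : Mhat m ≤ A := by
    refine sup_le ((Subgroup.closure_le A).mpr ?_) fun x hx => M₀_axis hx
    rintro x (rfl | rfl)
    · exact hs {1} _ (by simp)
    · exact hs {2} _ (by simp)
  rw [sigmaMinus_apply, (hA hk).2, Complex.ofReal_one]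

theorem sigmaMinus_J {m : ℕ} (hm : 4 ≤ m) (k : M m) (hk : (k : G m) = J m) :
    sigmaMinus hm k = -1 := by
  rw [sigmaMinus_apply, hk, J, signElt, mat_ofMat, Matrix.diagonal_apply_eq, if_pos (Set.mem_univ _)]
  simp

/-! ### Induced representations -/

/-- For a subgroup `S` (one of `M^m`, `M̂^m`) of `G^m`, the parabolic subgroup `P = S A (N^+)^m`,
a homomorphism `ι : G^m → G^l` and a character `σ` of `S`: the representation
`Ind_P^{G^l}(ξ_λ ⊗ σ)` of `G^l` by left translations on the space of all `u ∈ C^∞(G^l)` with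
`u(x ι(k a ν)) = σ(k) ξ_λ(a) u(x)` for `k ∈ S`, `a = exp(tH) ∈ A`, `ν ∈ N^+`, where
`ξ_λ(exp(tH)) = e^{λt}`. -/
def Ind {m l : ℕ} (ι : G m →* G l) (S : Subgroup (G m)) (σ : S →* ℂ) (lam : ℂ) :
    Subrepresentation (leftRep l) where
  toSubmodule :=
    { carrier := {u | ∀ (x : G l) (k : S) (t : ℝ) (ν : Nplus m),
        u.1 (x * ι ((k : G m) * expG (t • HLie m) * (ν : G m))) =
          σ k * Complex.exp (lam * t) * u.1 x}
      zero_mem' := fun x k t ν => by simp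
      add_mem' := fun {u v} hu hv x k t ν => by
        have h1 := hu x k t ν
        have h2 := hv x k t ν
        simp only [Submodule.coe_add, Pi.add_apply, h1, h2]
        ring
      smul_mem' := fun c u hu x k t ν => by
        have h1 := hu x k t ν
        simp only [Submodule.coe_smul, Pi.smul_apply, h1, smul_eq_mul]
        ring }
  apply_mem_toSubmodule g u hu := fun x k t ν => by
    change u.1 (g⁻¹ * (x * _)) = _ * u.1 (g⁻¹ * x)
    rw [← mul_assoc]
    exact hu (g⁻¹ * x) k t ν

/-! ### The enveloping algebra `𝒰(𝔫_m^-)` and its action -/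

/-- The universal enveloping algebra `𝒰(𝔫_m^-)` with complex coefficients. -/
abbrev UnMinus (m : ℕ) : Type := ℂ ⊗[ℝ] UniversalEnvelopingAlgebra ℝ (nMinus m)

/-- The canonical map `𝔫_m^- → 𝒰(𝔫_m^-)`. -/
def toU {m : ℕ} (X : nMinus m) : UnMinus m := 1 ⊗ₜ[ℝ] UniversalEnvelopingAlgebra.ι ℝ X

/-- The left-invariant differential operator on `C^∞(G^m)` given by an element of `𝒰(𝔫_m^-)`:
the algebra homomorphism that extends `R`. -/
def diffOp (m : ℕ) : UnMinus m →ₐ[ℂ] Module.End ℂ (Smooth m) :=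
  Algebra.TensorProduct.lift (Algebra.ofId ℂ (Module.End ℂ (Smooth m)))
    (UniversalEnvelopingAlgebra.lift ℝ ((rightLie m).comp (nMinus m).incl))
    (by
      intro c x
      rw [Algebra.ofId_apply]
      exact Algebra.commutes c _)

theorem diffOp_toU {m : ℕ} (X : nMinus m) : diffOp m (toU X) = rightOp (X : soLie m) := by
  rw [diffOp, toU, Algebra.TensorProduct.lift_tmul, map_one, one_mul,
    UniversalEnvelopingAlgebra.lift_ι_apply]
  rfl

/-- `D ∈ 𝒰(𝔫_m^-)` induces an equivariant map `V → W` between two spaces of smooth functions on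
`G^m` that are invariant under left translations. -/
def Induces {m : ℕ} (D : UnMinus m) (V W : Subrepresentation (leftRep m)) : Prop :=
  ∃ T : Representation.IntertwiningMap V.toRepresentation W.toRepresentation,
    ∀ u : V.toSubmodule, (T u : Smooth m) = diffOp m D (u : Smooth m)

/-! ### The families `𝒟_N^0(λ) ∈ 𝒰(𝔫_{n+1}^-)` -/

/-- `Q_1^- ∈ 𝒰(𝔫_m^-)`. -/
def Q₁m (m : ℕ) : UnMinus m :=
  toU ⟨⟨(Q₁p m)ᵀ, Q₁p_transpose_mem m⟩, LieSubalgebra.subset_lieSpan (Or.inl rfl)⟩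

/-- `Q_2^- ∈ 𝒰(𝔫_m^-)`. -/
def Q₂m (m : ℕ) : UnMinus m :=
  toU ⟨⟨(Q₂p m)ᵀ, Q₂p_transpose_mem m⟩, LieSubalgebra.subset_lieSpan (Or.inr (Or.inl rfl))⟩

/-- `Y_{j+1}^- ∈ 𝒰(𝔫_m^-)`. -/
def Ym (m j : ℕ) : UnMinus m :=
  toU ⟨⟨(Yp m j)ᵀ, Yp_transpose_mem m j⟩, LieSubalgebra.subset_lieSpan (Or.inr (Or.inr ⟨j, rfl⟩))⟩

/-- `Δ_{n-1} = -(Q_1^-)² + (Q_2^-)² + ∑_{j=1}^{n-3} (Y_j^-)²` in `𝒰(𝔫_{n+1}^-)`. -/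
def Lap (n : ℕ) : UnMinus (n + 1) :=
  -Q₁m (n + 1) ^ 2 + Q₂m (n + 1) ^ 2 + ∑ j ∈ Finset.range (n - 3), Ym (n + 1) j ^ 2

/-- `T_n = Y_{n-2}^-`. -/
def Tn (n : ℕ) : UnMinus (n + 1) := Ym (n + 1) (n - 3)

/-- `evenCoeff n λ N k = a_{N-k}(λ)`, see `evenCoeff_recursion`. -/
def evenCoeff (n : ℕ) (lam : ℂ) (N : ℕ) : ℕ → ℂ
  | 0 => 1
  | k + 1 => -(((N : ℂ) - k) * (n - 1 + 2 * lam - 4 * N + 2 * ((N : ℂ) - k)) /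
      (((k : ℂ) + 1) * (2 * k + 1))) * evenCoeff n lam N k

/-- `oddCoeff n λ N k = b_{N-k}(λ)`, see `oddCoeff_recursion`. -/
def oddCoeff (n : ℕ) (lam : ℂ) (N : ℕ) : ℕ → ℂ
  | 0 => 1
  | k + 1 => -(((N : ℂ) - k) * (n - 3 + 2 * lam - 4 * N + 2 * ((N : ℂ) - k)) /
      (((k : ℂ) + 1) * (2 * k + 3))) * oddCoeff n lam N k

/-- With `a j = evenCoeff n λ N (N - j)`: `a_N = 1` and, for `1 ≤ j ≤ N`,
`(N-j+1)(2N-2j+1) a_{j-1} + j(n-1+2λ-4N+2j) a_j = 0`. -/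
theorem evenCoeff_recursion (n : ℕ) (lam : ℂ) (N j : ℕ) (h1 : 1 ≤ j) (h2 : j ≤ N) :
    ((N : ℂ) - j + 1) * (2 * N - 2 * j + 1) * evenCoeff n lam N (N - (j - 1)) +
      j * (n - 1 + 2 * lam - 4 * N + 2 * j) * evenCoeff n lam N (N - j) = 0 := by
  obtain ⟨k, rfl⟩ := Nat.exists_eq_add_of_le h2
  have e1 : j + k - (j - 1) = k + 1 := by omega
  have e2 : j + k - j = k := by omega
  have h3 : (k : ℂ) + 1 ≠ 0 := by exact_mod_cast k.succ_ne_zero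
  have h4 : 2 * (k : ℂ) + 1 ≠ 0 := by exact_mod_cast (2 * k).succ_ne_zero
  rw [e1, e2, evenCoeff]
  push_cast
  have e3 : (j : ℂ) + k - j = k := by ring
  have e4 : 2 * ((j : ℂ) + k) - 2 * j = 2 * k := by ring
  have e5 : (j : ℂ) + k - k = j := by ring
  rw [e3, e4, e5]
  have key : ∀ d y a : ℂ, d ≠ 0 → d * (-(y / d) * a) + y * a = 0 := by
    intro d y a hd
    field_simp
    ring
  have := key (((k : ℂ) + 1) * (2 * k + 1)) (j * (n - 1 + 2 * lam - 4 * (j + k) + 2 * j))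
    (evenCoeff n lam (j + k) k) (mul_ne_zero h3 h4)
  linear_combination this

/-- With `b j = oddCoeff n λ N (N - j)`: `b_N = 1` and, for `1 ≤ j ≤ N`,
`(N-j+1)(2N-2j+3) b_{j-1} + j(n-3+2λ-4N+2j) b_j = 0`. -/
theorem oddCoeff_recursion (n : ℕ) (lam : ℂ) (N j : ℕ) (h1 : 1 ≤ j) (h2 : j ≤ N) :
    ((N : ℂ) - j + 1) * (2 * N - 2 * j + 3) * oddCoeff n lam N (N - (j - 1)) +
      j * (n - 3 + 2 * lam - 4 * N + 2 * j) * oddCoeff n lam N (N - j) = 0 := by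
  obtain ⟨k, rfl⟩ := Nat.exists_eq_add_of_le h2
  have e1 : j + k - (j - 1) = k + 1 := by omega
  have e2 : j + k - j = k := by omega
  have h3 : (k : ℂ) + 1 ≠ 0 := by exact_mod_cast k.succ_ne_zero
  have h4 : 2 * (k : ℂ) + 3 ≠ 0 := by exact_mod_cast (2 * k + 2).succ_ne_zero
  rw [e1, e2, oddCoeff]
  push_cast
  have e3 : (j : ℂ) + k - j = k := by ring
  have e4 : 2 * ((j : ℂ) + k) - 2 * j = 2 * k := by ring
  have e5 : (j : ℂ) + k - k = j := by ring
  rw [e3, e4, e5]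
  have key : ∀ d y a : ℂ, d ≠ 0 → d * (-(y / d) * a) + y * a = 0 := by
    intro d y a hd
    field_simp
    ring
  have := key (((k : ℂ) + 1) * (2 * k + 3)) (j * (n - 3 + 2 * lam - 4 * (j + k) + 2 * j))
    (oddCoeff n lam (j + k) k) (mul_ne_zero h3 h4)
  linear_combination this

/-- `𝒟_{2N}^0(λ) = ∑_{j=0}^N a_j(λ) Δ_{n-1}^j T_n^{2N-2j}`, normalized by `a_N(λ) = 1`. -/
def Deven (n : ℕ) (lam : ℂ) (N : ℕ) : UnMinus (n + 1) :=
  ∑ j ∈ Finset.range (N + 1), evenCoeff n lam N (N - j) • (Lap n ^ j * Tn n ^ (2 * N - 2 * j))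

/-- `𝒟_{2N+1}^0(λ) = ∑_{j=0}^N b_j(λ) Δ_{n-1}^j T_n^{2N-2j+1}`, normalized by `b_N(λ) = 1`. -/
def Dodd (n : ℕ) (lam : ℂ) (N : ℕ) : UnMinus (n + 1) :=
  ∑ j ∈ Finset.range (N + 1), oddCoeff n lam N (N - j) • (Lap n ^ j * Tn n ^ (2 * N - 2 * j + 1))

/-- The family `𝒟_N^0(λ)`. -/
def D0 (n : ℕ) (lam : ℂ) (N : ℕ) : UnMinus (n + 1) :=
  if Even N then Deven n lam (N / 2) else Dodd n lam (N / 2)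

/-- `Ind_{P^{n+1}}^{G^{n+1}}(ξ_λ)`. -/
def IndTop (n : ℕ) (lam : ℂ) : Subrepresentation (leftRep (n + 1)) :=
  Ind (MonoidHom.id (G (n + 1))) (M (n + 1)) 1 lam

/-- `Ind_{P^n}^{G^{n+1}}(ξ_μ ⊗ σ)`, where `P^n ⊂ G^n ⊂ G^{n+1}`. -/
def IndSub {n : ℕ} (hn : 4 ≤ n) (σ : M n →* ℂ) (mu : ℂ) : Subrepresentation (leftRep (n + 1)) :=
  Ind (emb (by omega)) (M n) σ mu

/-- `Ind_{P̂^{n+1}}^{G^{n+1}}(ξ_λ)`. -/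
def IndHatTop (n : ℕ) (lam : ℂ) : Subrepresentation (leftRep (n + 1)) :=
  Ind (MonoidHom.id (G (n + 1))) (Mhat (n + 1)) 1 lam

/-- `Ind_{P̂^n}^{G^{n+1}}(ξ_μ)`, where `P̂^n ⊂ G^n ⊂ G^{n+1}`. -/
def IndHatSub {n : ℕ} (hn : 4 ≤ n) (mu : ℂ) : Subrepresentation (leftRep (n + 1)) :=
  Ind (emb (by omega)) (Mhat n) 1 mu

end AdS

end

/-! Since `𝔫^-_{n+1}` is abelian, every element of its enveloping algebra comes from a polynomial
`p`, its symbol, in `n` commuting variables; the variable `none` stands for `T_n`. A function `u` in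
the source is annihilated by `R(𝔪)` and `R(𝔫^+)`, and `R(H) u = λ u`. Hence applying an element of
the parabolic subalgebra to the image of `u` gives again an operator with a symbol applied to `u`:
`H` turns `p` into `λp - Ep` with the Euler derivation `E`, the elements of `𝔪` rotate the
variables, and `X_c^+` acts by the second order operator `2λ∂_c - 2E∂_c + s_c X_c □`
(`IsInfInd.rightOp_H`, `IsInfInd.rightOp_rot`, `IsInfInd.rightOp_upper`).

Infinitesimal covariance under `P^n` therefore amounts to the three equations of `IsSymbol`: `Ep =
Np`, invariance under rotations of the variables other than `T_n`, and the conformal equation for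
each of these variables. The equations are necessary because an operator that kills the whole
induced space has symbol zero (`eq_zero_of_opSymbol_eq_zero`). This is seen by applying it at the
identity to homogeneous functions on the light cone. The same fact replaces the
Poincaré-Birkhoff-Witt theorem: only the surjectivity of the map from symbols to the enveloping
algebra is used.

To solve the equations, expand `p` in powers of `T_n`. Each coefficient is a homogeneous invariant
polynomial, so it is a multiple of a power of the quadratic form, and it vanishes in odd degree
(`exists_eq_quad_pow`). By the conformal equation, the coefficient of `T_n^{i+2}` vanishes if that
of `T_n^i` does, so the solutions form a space of dimension at most one (`IsSymbol.exists_eq`). On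
sums of `Q^j T_n^{N-2j}` the conformal equation becomes the recursion for `a_j` and `b_j`. It can be
solved downwards from `a_k = 1` for every `λ`, since the factor of `a_{j-1}` never vanishes
(`isSymbol_symbolD0`).

It remains to treat the components of `M`. An element `g` of `Z_K(𝔞)` in `G^n` preserves the
quadratic form and multiplies `T_n` by the sign `g_{00}`, hence `𝒟_N^0` by `g_{00}^N`. For `J` this
sign is `(-1)^N`, which yields the parity conditions; on `⟨w₁, w₂⟩` it is `1`, so `P̂` imposes none.
-/

open scoped Matrix.Norms.Operator Matrix TensorProduct ContDiff

noncomputable section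

namespace AdS

attribute [local instance 100] LieRing.ofAssociativeRing

/-! ### Differential operators on polynomials -/

section Poly

open MvPolynomial

variable {ι : Type*} [Fintype ι]

/-- The Euler derivation `∑ X_i ∂_i`. -/
def euler (ι : Type*) [Fintype ι] : Derivation ℂ (MvPolynomial ι ℂ) (MvPolynomial ι ℂ) :=
  ∑ i, (X i : MvPolynomial ι ℂ) • pderiv i

theorem euler_apply (p : MvPolynomial ι ℂ) : euler ι p = ∑ i, X i * pderiv i p := by
  have h := congrFun (map_sum (Derivation.coeFnAddMonoidHom (R := ℂ) (A := MvPolynomial ι ℂ)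
    (M := MvPolynomial ι ℂ)) (fun i => (X i : MvPolynomial ι ℂ) • pderiv i) Finset.univ) p
  rw [Finset.sum_apply] at h
  exact h

/-- The rotation `s_a X_a ∂_b - s_b X_b ∂_a`. -/
def rot (s : ι → ℂ) (a b : ι) : Derivation ℂ (MvPolynomial ι ℂ) (MvPolynomial ι ℂ) :=
  (C (s a) * X a : MvPolynomial ι ℂ) • pderiv b - (C (s b) * X b : MvPolynomial ι ℂ) • pderiv a

theorem rot_apply (s : ι → ℂ) (a b : ι) (p : MvPolynomial ι ℂ) :
    rot s a b p = C (s a) * X a * pderiv b p - C (s b) * X b * pderiv a p := by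
  simp [rot]

/-- The wave operator `∑ s_i ∂_i²`. -/
def box (s : ι → ℂ) : MvPolynomial ι ℂ →ₗ[ℂ] MvPolynomial ι ℂ :=
  ∑ i, s i • ((pderiv i).toLinearMap ∘ₗ (pderiv i).toLinearMap)

theorem box_apply (s : ι → ℂ) (p : MvPolynomial ι ℂ) :
    box s p = ∑ i, C (s i) * pderiv i (pderiv i p) := by
  simp [box, LinearMap.sum_apply, MvPolynomial.smul_eq_C_mul]

/-- The operator `2 λ ∂_c - 2 E ∂_c + s_c X_c □` by which special conformal transformations act on
symbols. -/
def conf (s : ι → ℂ) (lam : ℂ) (c : ι) : MvPolynomial ι ℂ →ₗ[ℂ] MvPolynomial ι ℂ :=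
  (2 * lam) • (pderiv c).toLinearMap - (2 : ℂ) • ((euler ι).toLinearMap ∘ₗ (pderiv c).toLinearMap) +
    s c • (LinearMap.mulLeft ℂ (X c : MvPolynomial ι ℂ) ∘ₗ box s)

theorem conf_apply (s : ι → ℂ) (lam : ℂ) (c : ι) (p : MvPolynomial ι ℂ) :
    conf s lam c p = C (2 * lam) * pderiv c p - 2 * euler ι (pderiv c p) +
      C (s c) * X c * box s p := by
  have h2 : (C (2 : ℂ) : MvPolynomial ι ℂ) = 2 := map_ofNat C 2
  simp [conf, MvPolynomial.smul_eq_C_mul, mul_assoc, h2]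

variable [DecidableEq ι]

theorem euler_X (i : ι) : euler ι (X i) = X i := by
  rw [euler_apply, Finset.sum_eq_single i]
  · simp
  · intro b _ hb; simp [pderiv_X, hb.symm]
  · simp

theorem euler_mul (p q : MvPolynomial ι ℂ) : euler ι (p * q) = p * euler ι q + q * euler ι p := by
  simp

/-- The commutator of `□` with multiplication by `X_d` is `2 s_d ∂_d`. -/
theorem box_mul_X (s : ι → ℂ) (d : ι) (p : MvPolynomial ι ℂ) :
    box s (p * X d) = X d * box s p + 2 * C (s d) * pderiv d p := by
  have h : ∀ i, C (s i) * pderiv i (pderiv i (p * X d)) =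
      X d * (C (s i) * pderiv i (pderiv i p)) + if i = d then 2 * C (s d) * pderiv d p else 0 := by
    intro i
    by_cases hi : i = d
    · subst hi
      simp only [pderiv_mul, pderiv_X_self, map_add, if_pos, mul_one]
      ring
    · simp only [pderiv_mul, pderiv_X_of_ne (Ne.symm hi), if_neg hi, mul_zero, add_zero]
      ring
  rw [box_apply, box_apply, Finset.sum_congr rfl fun i _ => h i, Finset.sum_add_distrib,
    Finset.mul_sum]
  simp

/-- This mirrors the bracket `[X_c^+, X_d^-] = 2δ_{cd} H + 2 s_d · rotation`, with `H` acting as `λ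
- E`. It is the recursion that identifies `conf` with the action of `X_c^+` in `apply_conf`. -/
theorem conf_mul_X (s : ι → ℂ) (hs : ∀ i, s i * s i = 1) (lam : ℂ) (c d : ι)
    (p : MvPolynomial ι ℂ) :
    conf s lam c (p * X d) = X d * conf s lam c p +
      (if c = d then 2 * (C lam * p - euler ι p) else 0) + 2 * C (s d) * rot s c d p := by
  have hsd : (C (s d) * C (s d) : MvPolynomial ι ℂ) = 1 := by rw [← C_mul, hs, C_1]
  have h2 : (C (2 * lam) : MvPolynomial ι ℂ) = 2 * C lam := by
    rw [C_mul, map_ofNat]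
  simp only [conf_apply, rot_apply, box_mul_X, h2]
  by_cases h : c = d
  · subst h
    simp only [pderiv_mul, pderiv_X_self, map_add, euler_mul, euler_X, if_pos, mul_one]
    linear_combination (2 * X c * pderiv c p) * hsd
  · simp only [pderiv_mul, pderiv_X_of_ne (Ne.symm h), euler_mul, euler_X, if_neg h, mul_zero,
      add_zero]
    linear_combination (2 * X d * pderiv c p) * hsd

theorem coeff_euler (p : MvPolynomial ι ℂ) (α : ι →₀ ℕ) :
    coeff α (euler ι p) = (α.degree : ℂ) * coeff α p := by
  induction p using MvPolynomial.induction_on' with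
  | monomial β a =>
    have h : euler ι (monomial β a) = (β.degree : ℂ) • monomial β a := by
      rw [euler_apply]
      have : ∀ i, X i * pderiv i (monomial β a) = (β i : ℂ) • monomial β a := by
        intro i
        rw [X_mul_pderiv_monomial, ← Nat.cast_smul_eq_nsmul ℂ]
      rw [Finset.sum_congr rfl fun i _ => this i, ← Finset.sum_smul, Finsupp.degree_eq_sum]
      push_cast
      rfl
    rw [h, coeff_smul, coeff_monomial, smul_eq_mul]
    split_ifs with h
    · rw [h]
    · simp
  | add p q hp hq => rw [map_add, coeff_add, coeff_add, hp, hq, mul_add]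

/-- A function all of whose rotations vanish has a radial gradient. -/
theorem exists_pderiv_eq [Nontrivial ι] (s : ι → ℂ) (hs : ∀ i, s i * s i = 1)
    {r : MvPolynomial ι ℂ} (hr : ∀ a b, rot s a b r = 0) :
    ∃ g, ∀ a, pderiv a r = C (s a) * X a * g := by
  have hC : ∀ i, (C (s i) * C (s i) : MvPolynomial ι ℂ) = 1 := fun i => by
    rw [← C_mul, hs, C_1]
  have h1 : ∀ a, ∃ h, pderiv a r = X a * h := by
    intro a
    obtain ⟨b, hb⟩ := exists_ne a
    have h := hr a b
    rw [rot_apply, sub_eq_zero] at h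
    -- Up to signs `X_b ∂_a r = X_a ∂_b r`. As `X_a` is prime and does not divide `X_b`, it divides
    -- `∂_a r`.
    have h2 : (X a : MvPolynomial ι ℂ) ∣ X b * pderiv a r :=
      ⟨C (s b) * (C (s a) * pderiv b r), by
        linear_combination (-C (s b)) * h - (X b * pderiv a r) * hC b⟩
    rcases X_prime.dvd_or_dvd h2 with h3 | h3
    · rw [X_dvd_X] at h3
      exact absurd h3.symm hb
    · exact h3
  choose h hh using h1
  obtain ⟨o⟩ : Nonempty ι := inferInstance
  refine ⟨C (s o) * h o, fun a => ?_⟩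
  have h2 := hr a o
  rw [rot_apply, sub_eq_zero, hh, hh] at h2
  -- Invariance under the rotation in `a` and `o`, after cancelling `X_a X_o`, shows that the
  -- quotients `∂_a r / X_a` agree up to signs; `s_o h_o` serves as the common factor.
  have h3 : C (s a) * h o = C (s o) * h a := by
    refine mul_left_cancel₀ (mul_ne_zero (X_ne_zero (R := ℂ) a) (X_ne_zero (R := ℂ) o)) ?_
    linear_combination h2
  rw [hh]
  linear_combination (-C (s o) * X a) * h3 - X a * h a * hC o

/-- The quadratic form `∑ s_i X_i²`. -/
def quad (s : ι → ℂ) : MvPolynomial ι ℂ := ∑ i, C (s i) * X i ^ 2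

theorem pderiv_quad (s : ι → ℂ) (c : ι) : pderiv c (quad s) = 2 * (C (s c) * X c) := by
  rw [quad, map_sum, Finset.sum_eq_single c]
  · simp [pderiv_pow]
    ring
  · intro b _ hb
    simp [pderiv_pow, pderiv_X_of_ne hb]
  · simp

theorem euler_quad (s : ι → ℂ) : euler ι (quad s) = 2 * quad s := by
  rw [euler_apply, quad, Finset.mul_sum]
  refine Finset.sum_congr rfl fun i _ => ?_
  rw [← quad, pderiv_quad]
  ring

theorem quad_ne_zero [Nonempty ι] (s : ι → ℂ) (hs : ∀ i, s i * s i = 1) : quad s ≠ 0 := by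
  intro h
  obtain ⟨o⟩ : Nonempty ι := inferInstance
  have h1 := congrArg (pderiv o) h
  rw [pderiv_quad, map_zero] at h1
  have h2 : (2 : MvPolynomial ι ℂ) ≠ 0 := two_ne_zero
  have h3 : (C (s o) : MvPolynomial ι ℂ) ≠ 0 := by
    rw [Ne, C_eq_zero]
    intro h0
    simpa [h0] using hs o
  exact mul_ne_zero h2 (mul_ne_zero h3 (X_ne_zero o)) h1

theorem rot_quad (s : ι → ℂ) (a b : ι) : rot s a b (quad s) = 0 := by
  rw [rot_apply, pderiv_quad, pderiv_quad]
  ring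

/-- Monomials are eigenvectors of the Euler derivation, with their degrees as eigenvalues. -/
theorem eq_zero_of_euler_eq {r : MvPolynomial ι ℂ} {μ : ℂ} (h : euler ι r = C μ * r)
    (hμ : ∀ n : ℕ, (n : ℂ) ≠ μ) : r = 0 := by
  ext α
  have h1 := congrArg (coeff α) h
  rw [coeff_euler, coeff_C_mul] at h1
  have h2 : ((α.degree : ℂ) - μ) * coeff α r = 0 := by linear_combination h1
  rcases mul_eq_zero.mp h2 with h3 | h3
  · exact absurd (sub_eq_zero.mp h3) (hμ _)
  · simpa using h3

/-- An invariant polynomial that is homogeneous of degree `N` is a multiple of a power of the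
quadratic form. -/
theorem exists_eq_quad_pow [Nontrivial ι] (s : ι → ℂ) (hs : ∀ i, s i * s i = 1) (N : ℕ) :
    ∀ r : MvPolynomial ι ℂ, (∀ a b, rot s a b r = 0) → euler ι r = C (N : ℂ) * r →
      ∃ c : ℂ, r = C c * quad s ^ (N / 2) ∧ (Odd N → c = 0) := by
  induction N using Nat.strong_induction_on with
  | _ N ih =>
    intro r hr hE
    rcases Nat.eq_zero_or_pos N with rfl | hN
    · refine ⟨coeff 0 r, ?_, by simp⟩
      ext α
      have h1 := congrArg (coeff α) hE
      rw [coeff_euler, coeff_C_mul] at h1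
      by_cases hα : α = 0
      · simp [hα]
      · have : (α.degree : ℂ) ≠ 0 := by
          rw [Nat.cast_ne_zero]
          simpa [Finsupp.degree_eq_zero_iff] using hα
        have h2 : coeff α r = 0 := by simpa [this] using h1
        simp [h2, coeff_C, Ne.symm hα]
    obtain ⟨g, hg⟩ := exists_pderiv_eq s hs hr
    -- Euler's identity with the radial gradient inserted. The cofactor `g` is again invariant and
    -- homogeneous, of degree `N - 2`, so the induction descends by two.
    have hrg : C (N : ℂ) * r = quad s * g := by
      rw [← hE, euler_apply, quad, Finset.sum_mul]
      refine Finset.sum_congr rfl fun i _ => ?_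
      rw [hg]
      ring
    have hN0 : (C (N : ℂ) : MvPolynomial ι ℂ) ≠ 0 := by
      rw [Ne, C_eq_zero, Nat.cast_eq_zero]
      omega
    have hQ := quad_ne_zero s hs
    have hEg : euler ι g = C ((N : ℂ) - 2) * g := by
      have h1 := congrArg (euler ι) hrg
      rw [euler_mul, euler_mul, hE, euler_quad, derivation_C] at h1
      refine mul_left_cancel₀ hQ ?_
      rw [C_sub, show (C (2 : ℂ) : MvPolynomial ι ℂ) = 2 from map_ofNat C 2]
      linear_combination -h1 + C (N : ℂ) * hrg
    have hgr : ∀ a b, rot s a b g = 0 := by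
      intro a b
      have h1 := congrArg (rot s a b) hrg
      simp only [Derivation.leibniz, hr, rot_quad, smul_eq_mul, mul_zero, add_zero,
        derivation_C] at h1
      exact (mul_eq_zero.mp h1.symm).resolve_left hQ
    rcases Nat.lt_or_ge N 2 with h2 | h2
    -- For `N = 1` the cofactor would have degree `-1`; this is where odd degrees die.
    · have hN1 : N = 1 := by omega
      have hg0 : g = 0 := by
        refine eq_zero_of_euler_eq hEg fun n hn => ?_
        rw [hN1] at hn
        have : (n : ℂ) + 1 = 0 := by push_cast at hn; linear_combination hn
        exact n.cast_add_one_ne_zero this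
      refine ⟨0, ?_, fun _ => rfl⟩
      rw [hg0, mul_zero] at hrg
      simpa using (mul_eq_zero.mp hrg).resolve_left hN0
    · obtain ⟨M, rfl⟩ := Nat.exists_eq_add_of_le' h2
      obtain ⟨c, hc, hodd⟩ := ih M (by omega) g hgr (by rw [hEg]; push_cast; congr 2; ring)
      refine ⟨c / ((M + 2 : ℕ) : ℂ), ?_, fun ho => ?_⟩
      · refine mul_left_cancel₀ hN0 ?_
        have h3 : ((M + 2 : ℕ) : ℂ) ≠ 0 := by exact_mod_cast (Nat.succ_ne_zero (M + 1))
        rw [hrg, hc, ← mul_assoc (C ((M + 2 : ℕ) : ℂ)), ← C_mul, mul_div_cancel₀ _ h3,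
          show (M + 2) / 2 = M / 2 + 1 by omega, pow_succ]
        ring
      · rw [hodd, zero_div]
        rw [Nat.odd_iff] at ho ⊢
        omega

end Poly

/-! ### Expansion in powers of the variable `none`, and uniqueness of symbols -/

section Slices

open MvPolynomial

variable {κ : Type*} [Fintype κ] [DecidableEq κ]

/-- The coefficient of the `i`-th power of the variable `none`. -/
def slice (i : ℕ) (p : MvPolynomial (Option κ) ℂ) : MvPolynomial κ ℂ :=
  (optionEquivLeft ℂ κ p).coeff i

theorem slice_add (i : ℕ) (p q : MvPolynomial (Option κ) ℂ) :
    slice i (p + q) = slice i p + slice i q := by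
  simp [slice]

theorem slice_sub (i : ℕ) (p q : MvPolynomial (Option κ) ℂ) :
    slice i (p - q) = slice i p - slice i q := by
  simp [slice]

theorem slice_zero (i : ℕ) : slice i (0 : MvPolynomial (Option κ) ℂ) = 0 := by
  simp [slice]

theorem slice_sum {α : Type*} (t : Finset α) (i : ℕ) (f : α → MvPolynomial (Option κ) ℂ) :
    slice i (∑ j ∈ t, f j) = ∑ j ∈ t, slice i (f j) := by
  simp [slice, Polynomial.finset_sum_coeff]

theorem slice_C_mul (i : ℕ) (a : ℂ) (p : MvPolynomial (Option κ) ℂ) :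
    slice i (C a * p) = C a * slice i p := by
  simp [slice, optionEquivLeft_C]

theorem slice_X_some_mul (i : ℕ) (c : κ) (p : MvPolynomial (Option κ) ℂ) :
    slice i (X (some c) * p) = X c * slice i p := by
  simp [slice, optionEquivLeft_X_some]

theorem slice_X_none_mul_zero (p : MvPolynomial (Option κ) ℂ) :
    slice 0 (X none * p) = 0 := by
  simp [slice, optionEquivLeft_X_none]

theorem slice_X_none_mul_succ (i : ℕ) (p : MvPolynomial (Option κ) ℂ) :
    slice (i + 1) (X none * p) = slice i p := by
  simp [slice, optionEquivLeft_X_none, Polynomial.coeff_X_mul]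

theorem eq_zero_of_slice {p : MvPolynomial (Option κ) ℂ} (h : ∀ i, slice i p = 0) : p = 0 := by
  refine (optionEquivLeft ℂ κ).injective ?_
  rw [map_zero]
  exact Polynomial.ext fun i => by simpa [slice] using h i

theorem slice_pderiv_some (c : κ) (p : MvPolynomial (Option κ) ℂ) :
    ∀ i, slice i (pderiv (some c) p) = pderiv c (slice i p) := by
  induction p using MvPolynomial.induction_on with
  | C a =>
    intro i
    rw [pderiv_C, slice_zero, slice, optionEquivLeft_C, Polynomial.coeff_C]
    split_ifs <;> simp
  | add p q hp hq => intro i; rw [map_add, slice_add, slice_add, hp, hq, map_add]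
  | mul_X p o hp =>
    intro i
    rw [mul_comm p, pderiv_mul, slice_add]
    rcases o with _ | d
    · rw [pderiv_X_of_ne (by simp), zero_mul, slice_zero, zero_add]
      rcases i with _ | i
      · rw [slice_X_none_mul_zero, slice_X_none_mul_zero, map_zero]
      · rw [slice_X_none_mul_succ, slice_X_none_mul_succ, hp]
    · rw [slice_X_some_mul, slice_X_some_mul, pderiv_mul, hp]
      by_cases h : d = c
      · subst h; simp
      · rw [pderiv_X_of_ne h, pderiv_X_of_ne (by simpa using h), zero_mul, zero_mul, slice_zero]

theorem slice_pderiv_none (p : MvPolynomial (Option κ) ℂ) :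
    ∀ i, slice i (pderiv none p) = ((i : MvPolynomial κ ℂ) + 1) * slice (i + 1) p := by
  induction p using MvPolynomial.induction_on with
  | C a =>
    intro i
    rw [pderiv_C, slice_zero, slice, optionEquivLeft_C, Polynomial.coeff_C]
    simp
  | add p q hp hq => intro i; rw [map_add, slice_add, slice_add, hp, hq, mul_add]
  | mul_X p o hp =>
    intro i
    rw [mul_comm p, pderiv_mul, slice_add]
    rcases o with _ | d
    · rw [pderiv_X_self, one_mul, slice_X_none_mul_succ]
      rcases i with _ | i
      · rw [slice_X_none_mul_zero]; simp
      · rw [slice_X_none_mul_succ, hp]; push_cast; ring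
    · rw [slice_X_some_mul, slice_X_some_mul, hp, pderiv_X_of_ne (by simp), zero_mul, slice_zero]
      ring

theorem slice_euler (p : MvPolynomial (Option κ) ℂ) (i : ℕ) :
    slice i (euler (Option κ) p) = euler κ (slice i p) + (i : MvPolynomial κ ℂ) * slice i p := by
  rw [euler_apply, Fintype.sum_option, slice_add, slice_sum, euler_apply]
  simp only [slice_X_some_mul, slice_pderiv_some]
  rw [add_comm]
  congr 1
  rcases i with _ | i
  · rw [slice_X_none_mul_zero]; simp
  · rw [slice_X_none_mul_succ, slice_pderiv_none]; push_cast; ring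

/-- The signs `s`, with the sign `1` for the variable `none`. -/
def extSign (s : κ → ℂ) (o : Option κ) : ℂ := o.elim 1 s

theorem slice_rot (s : κ → ℂ) (a b : κ) (p : MvPolynomial (Option κ) ℂ) (i : ℕ) :
    slice i (rot (extSign s) (some a) (some b) p) = rot s a b (slice i p) := by
  simp only [rot_apply, slice_sub, mul_assoc, slice_C_mul, slice_X_some_mul, slice_pderiv_some]
  rfl

/-- The second derivative in `none` is the only part that mixes slices; it couples slice `i` to
slice `i + 2`. -/
theorem slice_box (s : κ → ℂ) (p : MvPolynomial (Option κ) ℂ) (i : ℕ) :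
    slice i (box (extSign s) p) = box s (slice i p) +
      ((i : MvPolynomial κ ℂ) + 1) * ((i : MvPolynomial κ ℂ) + 2) * slice (i + 2) p := by
  rw [box_apply, Fintype.sum_option, slice_add, slice_sum, box_apply, add_comm]
  simp only [slice_C_mul, slice_pderiv_some, slice_pderiv_none]
  congr 1
  simp only [extSign, Option.elim, C_1]
  push_cast
  ring

theorem euler_pderiv {ι : Type*} [Fintype ι] [DecidableEq ι] (c : ι) (p : MvPolynomial ι ℂ) :
    euler ι (pderiv c p) = pderiv c (euler ι p) - pderiv c p := by
  ext α
  rw [coeff_sub, coeff_euler, coeff_pderiv, coeff_pderiv, coeff_euler, map_add]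
  simp
  ring

/-- On a homogeneous polynomial the term `E ∂_c` is the scalar `N - 1` times `∂_c`. -/
theorem conf_of_euler {ι : Type*} [Fintype ι] [DecidableEq ι] (s : ι → ℂ) (lam : ℂ) (c : ι) {N : ℂ}
    {p : MvPolynomial ι ℂ} (hp : euler ι p = C N * p) :
    conf s lam c p = C (2 * (lam - N + 1)) * pderiv c p + C (s c) * X c * box s p := by
  have h2 : (C (2 : ℂ) : MvPolynomial ι ℂ) = 2 := map_ofNat C 2
  rw [conf_apply, euler_pderiv, hp, pderiv_C_mul]
  simp only [C_mul, C_add, C_sub, C_1, h2]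
  ring

/-- The equations that characterize the symbols of conformally covariant operators. -/
structure IsSymbol (s : κ → ℂ) (lam : ℂ) (N : ℕ) (p : MvPolynomial (Option κ) ℂ) : Prop where
  euler_eq : euler (Option κ) p = C (N : ℂ) * p
  rot_eq : ∀ a b, rot (extSign s) (some a) (some b) p = 0
  conf_eq : ∀ c, conf (extSign s) lam (some c) p = 0

variable {s : κ → ℂ} {lam : ℂ} {N : ℕ} {p q : MvPolynomial (Option κ) ℂ}

theorem IsSymbol.C_mul (hp : IsSymbol s lam N p) (c : ℂ) : IsSymbol s lam N (C c * p) where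
  euler_eq := by rw [← smul_eq_C_mul, Derivation.map_smul, hp.euler_eq, smul_eq_C_mul, smul_eq_C_mul]; ring
  rot_eq a b := by rw [← smul_eq_C_mul, Derivation.map_smul, hp.rot_eq, smul_zero]
  conf_eq a := by rw [← smul_eq_C_mul, map_smul, hp.conf_eq, smul_zero]

theorem IsSymbol.sub (hp : IsSymbol s lam N p) (hq : IsSymbol s lam N q) :
    IsSymbol s lam N (p - q) where
  euler_eq := by rw [map_sub, hp.euler_eq, hq.euler_eq]; ring
  rot_eq a b := by rw [map_sub, hp.rot_eq, hq.rot_eq, sub_zero]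
  conf_eq a := by rw [map_sub, hp.conf_eq, hq.conf_eq, sub_zero]

/-- In slice `i` of the conformal equation every term contains slice `i`, except `(i+1)(i+2) s_c
X_c` times slice `i + 2`. These factors are nonzero in a domain of characteristic zero, whatever `λ`
is. -/
theorem IsSymbol.slice_add_two [Nonempty κ] (hs : ∀ i, s i * s i = 1) (hp : IsSymbol s lam N p)
    {i : ℕ} (h : slice i p = 0) : slice (i + 2) p = 0 := by
  obtain ⟨o⟩ : Nonempty κ := inferInstance
  have h1 := hp.conf_eq o
  rw [conf_of_euler _ _ _ hp.euler_eq] at h1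
  have h2 := congrArg (slice i) h1
  simp only [slice_add, slice_C_mul, mul_assoc, slice_X_some_mul, slice_pderiv_some, slice_box, h,
    map_zero, mul_zero, zero_add, slice_zero] at h2
  have h3 : (C (extSign s (some o)) : MvPolynomial κ ℂ) ≠ 0 := by
    rw [Ne, C_eq_zero]
    intro h0
    have := hs o
    rw [show s o = 0 from h0] at this
    simp at this
  have h4 : ((i : MvPolynomial κ ℂ) + 1) ≠ 0 := Nat.cast_add_one_ne_zero i
  have h5 : ((i : MvPolynomial κ ℂ) + 2) ≠ 0 := by exact_mod_cast Nat.succ_ne_zero (i + 1)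
  simpa [h3, h4, h5] using h2

theorem IsSymbol.eq_zero [Nonempty κ] (hs : ∀ i, s i * s i = 1) (hp : IsSymbol s lam N p)
    (h0 : slice 0 p = 0) (h1 : slice 1 p = 0) : p = 0 := by
  refine eq_zero_of_slice fun i => ?_
  induction i using Nat.strong_induction_on with
  | _ i ih =>
    match i, ih with
    | 0, _ => exact h0
    | 1, _ => exact h1
    | i + 2, ih => exact hp.slice_add_two hs (ih i (by omega))

/-- Slice `i` inherits the rotation invariance and is homogeneous of degree `N - i`. -/
theorem IsSymbol.exists_slice [Nontrivial κ] (hs : ∀ i, s i * s i = 1) (hp : IsSymbol s lam N p)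
    {i M : ℕ} (hM : M + i = N) :
    ∃ c : ℂ, slice i p = C c * quad s ^ (M / 2) ∧ (Odd M → c = 0) := by
  refine exists_eq_quad_pow s hs M (slice i p) (fun a b => ?_) ?_
  · rw [← slice_rot, hp.rot_eq, slice_zero]
  · have h := congrArg (slice i) hp.euler_eq
    rw [slice_euler, slice_C_mul, ← hM] at h
    have e : (C ((M + i : ℕ) : ℂ) : MvPolynomial κ ℂ) = C (M : ℂ) + (i : MvPolynomial κ ℂ) := by
      simp
    rw [e] at h
    linear_combination h

/-- Slice `1` would have degree `-1`, a case that `IsSymbol.exists_slice` does not cover because its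
degree is a natural number. -/
theorem IsSymbol.slice_zero_of_zero (hp : IsSymbol s lam 0 p) :
    slice 1 p = 0 := by
  refine eq_zero_of_euler_eq (μ := -1) ?_ fun n hn => ?_
  · have h := congrArg (slice 1) hp.euler_eq
    rw [slice_euler, slice_C_mul] at h
    simp at h ⊢
    linear_combination h
  · exact n.cast_add_one_ne_zero (R := ℂ) (by linear_combination hn)

/-- The space of solutions is one-dimensional: `d` is a solution whose lowest slice is a power of
the quadratic form. -/
theorem IsSymbol.exists_eq [Nontrivial κ] (hs : ∀ i, s i * s i = 1) {k r : ℕ} (hr : r < 2)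
    (hN : N = 2 * k + r) {d : MvPolynomial (Option κ) ℂ} (hd : IsSymbol s lam N d)
    (hd0 : slice r d = quad s ^ k) (hp : IsSymbol s lam N p) : ∃ c : ℂ, p = C c * d := by
  -- Of the two initial slices, the one with index `1 - r` has degree of odd parity (or `-1` if `N =
  -- 0`), so it vanishes. A solution is thus fixed by slice `r`, a multiple of `quad s ^ k`.
  have hz : ∀ {q}, IsSymbol s lam N q → slice (1 - r) q = 0 := by
    intro q hq
    rcases Nat.eq_zero_or_pos N with h0 | h0
    · have hr0 : r = 0 := by omega
      subst h0 hr0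
      exact hq.slice_zero_of_zero
    · obtain ⟨c, hc, hodd⟩ := hq.exists_slice hs (i := 1 - r) (M := N - (1 - r)) (by omega)
      rw [hc, hodd (by rw [Nat.odd_iff]; omega), C_0, zero_mul]
  obtain ⟨c, hc, -⟩ := hp.exists_slice hs (i := r) (M := 2 * k) hN.symm
  rw [Nat.mul_div_cancel_left k two_pos] at hc
  refine ⟨c, sub_eq_zero.mp ((hp.sub (hd.C_mul c)).eq_zero hs ?_ ?_)⟩
  · rcases (by omega : r = 0 ∨ r = 1) with rfl | rfl
    · rw [slice_sub, slice_C_mul, hc, hd0, sub_self]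
    · rw [slice_sub, slice_C_mul]
      simpa using by rw [hz hp, hz hd, mul_zero, sub_zero]
  · rcases (by omega : r = 0 ∨ r = 1) with rfl | rfl
    · rw [slice_sub, slice_C_mul]
      simpa using by rw [hz hp, hz hd, mul_zero, sub_zero]
    · rw [slice_sub, slice_C_mul, hc, hd0, sub_self]

end Slices

/-! ### Explicit solutions of the symbol equations -/

section Explicit

open MvPolynomial

variable {κ : Type*} [Fintype κ]

/-- The quadratic form in the variables other than `none`. -/
def quadSome (s : κ → ℂ) : MvPolynomial (Option κ) ℂ := ∑ c, C (s c) * X (some c) ^ 2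

/-- The polynomial `∑_{j ≤ k} a_j Q^j T^{2(k-j)+r}`. -/
def symbolSum (s : κ → ℂ) (a : ℕ → ℂ) (k r : ℕ) : MvPolynomial (Option κ) ℂ :=
  ∑ j ∈ Finset.range (k + 1), C (a j) * (quadSome s ^ j * X none ^ (2 * (k - j) + r))

variable [DecidableEq κ]

theorem pderiv_some_quadSome (s : κ → ℂ) (c : κ) :
    pderiv (some c) (quadSome s) = 2 * (C (s c) * X (some c)) := by
  rw [quadSome, map_sum, Finset.sum_eq_single c]
  · simp
    ring
  · intro b _ hb
    have : (some b : Option κ) ≠ some c := by simpa using hb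
    simp [pderiv_X_of_ne this]
  · simp

theorem pderiv_none_quadSome (s : κ → ℂ) : pderiv none (quadSome s) = 0 := by
  rw [quadSome, map_sum]
  refine Finset.sum_eq_zero fun b _ => ?_
  rw [pderiv_C_mul, pderiv_pow, pderiv_X_of_ne (by simp)]
  simp

theorem pderiv_some_monomial (s : κ → ℂ) (c : κ) (j i : ℕ) :
    pderiv (some c) (quadSome s ^ j * X none ^ i) =
      C (s c) * X (some c) * (2 * (j : MvPolynomial (Option κ) ℂ) *
        (quadSome s ^ (j - 1) * X none ^ i)) := by
  rw [pderiv_mul, pderiv_pow, pderiv_pow, pderiv_some_quadSome, pderiv_X_of_ne (by simp)]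
  ring

theorem pderiv_none_monomial (s : κ → ℂ) (j i : ℕ) :
    pderiv none (quadSome s ^ j * X none ^ i) =
      (i : MvPolynomial (Option κ) ℂ) * (quadSome s ^ j * X none ^ (i - 1)) := by
  rw [pderiv_mul, pderiv_pow, pderiv_pow, pderiv_none_quadSome, pderiv_X_self]
  ring

theorem sum_quadSome_mul (s : κ → ℂ) (p : MvPolynomial (Option κ) ℂ) :
    ∑ c, C (s c) * X (some c) ^ 2 * p = quadSome s * p :=
  (Finset.sum_mul _ _ _).symm

theorem euler_monomial (s : κ → ℂ) (j i : ℕ) :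
    euler (Option κ) (quadSome s ^ j * X none ^ i) =
      ((2 * j + i : ℕ) : MvPolynomial (Option κ) ℂ) * (quadSome s ^ j * X none ^ i) := by
  have h : ∑ c, X (some c) * (C (s c) * X (some c) * (2 * (j : MvPolynomial (Option κ) ℂ) *
        (quadSome s ^ (j - 1) * X none ^ i))) = 2 * (j : MvPolynomial (Option κ) ℂ) *
        (quadSome s ^ j * X none ^ i) := by
    rcases j with _ | j
    · simp
    · rw [pow_succ (quadSome s) j]
      rw [show 2 * ((j + 1 : ℕ) : MvPolynomial (Option κ) ℂ) * (quadSome s ^ j * quadSome s *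
        X none ^ i) = quadSome s * (2 * ((j + 1 : ℕ) : MvPolynomial (Option κ) ℂ) *
          (quadSome s ^ j * X none ^ i)) by ring, ← sum_quadSome_mul]
      refine Finset.sum_congr rfl fun c _ => ?_
      rw [Nat.add_sub_cancel]
      ring
  rw [euler_apply, Fintype.sum_option, pderiv_none_monomial]
  simp only [pderiv_some_monomial, h]
  rcases i with _ | i
  · simp
  · push_cast
    ring

/-- This is the radial formula `□ Q^j = 2j(d + 2j - 2) Q^{j-1}` in `d` variables, together with the
second derivative of `T^i`. The truncated exponents are harmless, as their coefficients vanish when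
truncation occurs. -/
theorem box_monomial (s : κ → ℂ) (hs : ∀ i, s i * s i = 1) (j i : ℕ) :
    box (extSign s) (quadSome s ^ j * X none ^ i) =
      2 * (j : MvPolynomial (Option κ) ℂ) * ((Fintype.card κ : MvPolynomial (Option κ) ℂ) +
        2 * (j : MvPolynomial (Option κ) ℂ) - 2) *
        (quadSome s ^ (j - 1) * X none ^ i) +
      (i : MvPolynomial (Option κ) ℂ) * ((i : MvPolynomial (Option κ) ℂ) - 1) *
        (quadSome s ^ j * X none ^ (i - 2)) := by
  have hC : ∀ c, (C (s c) * C (s c) : MvPolynomial (Option κ) ℂ) = 1 := fun c => by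
    rw [← C_mul, hs, C_1]
  have h1 : ∀ c, C (extSign s (some c)) * pderiv (some c) (pderiv (some c)
      (quadSome s ^ j * X none ^ i)) =
      2 * (j : MvPolynomial (Option κ) ℂ) * (quadSome s ^ (j - 1) * X none ^ i) +
      C (s c) * X (some c) ^ 2 * (2 * (j : MvPolynomial (Option κ) ℂ) *
        (2 * ((j - 1 : ℕ) : MvPolynomial (Option κ) ℂ) *
          (quadSome s ^ (j - 1 - 1) * X none ^ i))) := by
    intro c
    have h2 : pderiv (some c) (2 * (j : MvPolynomial (Option κ) ℂ)) = 0 := by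
      have : (2 * (j : MvPolynomial (Option κ) ℂ)) = C (2 * (j : ℂ)) := by
        rw [MvPolynomial.C_mul, map_ofNat, map_natCast]
      rw [this, pderiv_C]
    rw [pderiv_some_monomial, pderiv_mul, pderiv_C_mul, pderiv_X_self, pderiv_mul, h2,
      pderiv_some_monomial]
    simp only [extSign, Option.elim]
    linear_combination (2 * (j : MvPolynomial (Option κ) ℂ) * (quadSome s ^ (j - 1) * X none ^ i) +
      C (s c) * X (some c) ^ 2 * (2 * (j : MvPolynomial (Option κ) ℂ) *
        (2 * ((j - 1 : ℕ) : MvPolynomial (Option κ) ℂ) *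
          (quadSome s ^ (j - 1 - 1) * X none ^ i)))) * hC c
  have h3 : pderiv none (pderiv none (quadSome s ^ j * X none ^ i)) =
      (i : MvPolynomial (Option κ) ℂ) * ((i : MvPolynomial (Option κ) ℂ) - 1) *
        (quadSome s ^ j * X none ^ (i - 2)) := by
    have h2 : pderiv none ((i : MvPolynomial (Option κ) ℂ)) = 0 := by
      have : ((i : MvPolynomial (Option κ) ℂ)) = C (i : ℂ) := by simp
      rw [this, pderiv_C]
    rw [pderiv_none_monomial, pderiv_mul, h2, pderiv_none_monomial]
    rcases i with _ | i
    · simp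
    · push_cast
      ring
  rw [box_apply, Fintype.sum_option, h3, Finset.sum_congr rfl fun c _ => h1 c,
    Finset.sum_add_distrib, sum_quadSome_mul]
  simp only [extSign, Option.elim, C_1, Finset.sum_const, Finset.card_univ, nsmul_eq_mul]
  rcases j with _ | _ | j
  · simp
  · simp; ring
  · simp only [Nat.add_sub_cancel]
    push_cast
    ring

theorem rot_monomial (s : κ → ℂ) (a b : κ) (j i : ℕ) :
    rot (extSign s) (some a) (some b) (quadSome s ^ j * X none ^ i) = 0 := by
  rw [rot_apply, pderiv_some_monomial, pderiv_some_monomial]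
  simp only [extSign, Option.elim]
  ring

/-- Homogeneity and invariance hold term by term. Each term of the conformal equation is divisible
by `s_c X_c`, and `ha` states that the coefficient of `Q^j T^{2(k-j)+r-2}` in the quotient vanishes.
-/
theorem isSymbol_symbolSum (s : κ → ℂ) (hs : ∀ i, s i * s i = 1) (lam : ℂ) (a : ℕ → ℂ) {k r N : ℕ}
    (hr : r < 2) (hN : N = 2 * k + r)
    (ha : ∀ j < k, ((2 * (k - j) + r : ℕ) : ℂ) * (((2 * (k - j) + r : ℕ) : ℂ) - 1) * a j +
      2 * ((j : ℂ) + 1) * (Fintype.card κ + 2 * lam - 2 * N + 2 * ((j : ℂ) + 1)) * a (j + 1) = 0) :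
    IsSymbol s lam N (symbolSum s a k r) := by
  have hE : euler (Option κ) (symbolSum s a k r) = C (N : ℂ) * symbolSum s a k r := by
    rw [symbolSum, map_sum, Finset.mul_sum]
    refine Finset.sum_congr rfl fun j hj => ?_
    rw [Finset.mem_range] at hj
    rw [euler_mul, derivation_C, euler_monomial, hN,
      show 2 * j + (2 * (k - j) + r) = 2 * k + r by omega, ← map_natCast C (2 * k + r)]
    ring
  refine ⟨hE, fun a b => ?_, fun c => ?_⟩
  · rw [symbolSum, map_sum]
    refine Finset.sum_eq_zero fun j _ => ?_
    rw [← smul_eq_C_mul, Derivation.map_smul, rot_monomial, smul_zero]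
  · rw [conf_of_euler _ _ _ hE, symbolSum, map_sum, map_sum]
    -- The conformal equation without its factor `s_c X_c`. The first sum collects the first order
    -- term and the part of `□` in the other variables, the second sum is `∂_T²`.
    have key : ∑ j ∈ Finset.range (k + 1), (C (a j) * (C (2 * (j : ℂ) *
          (Fintype.card κ + 2 * lam - 2 * N + 2 * j)) *
          (quadSome s ^ (j - 1) * X none ^ (2 * (k - j) + r)))) +
        ∑ j ∈ Finset.range (k + 1), (C (a j) * (C (((2 * (k - j) + r : ℕ) : ℂ) *
          (((2 * (k - j) + r : ℕ) : ℂ) - 1)) *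
          (quadSome s ^ j * X none ^ (2 * (k - j) + r - 2)))) = 0 := by
      -- The term `j = 0` of the first sum has the factor `j`, and the term `j = k` of the second
      -- has the factor `r(r-1) = 0`. The other terms cancel in pairs `j + 1`, `j`.
      rw [Finset.sum_range_succ', Finset.sum_range_succ]
      have e1 : ((2 * (k - k) + r : ℕ) : ℂ) * (((2 * (k - k) + r : ℕ) : ℂ) - 1) = 0 := by
        rcases (by omega : r = 0 ∨ r = 1) with rfl | rfl <;> simp
      rw [e1]
      simp only [Nat.cast_zero, mul_zero, zero_mul, C_0, add_zero]
      rw [← Finset.sum_add_distrib]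
      refine Finset.sum_eq_zero fun j hj => ?_
      rw [Finset.mem_range] at hj
      have h := congrArg (C (σ := Option κ)) (ha j hj)
      rw [Nat.add_sub_cancel, show 2 * (k - (j + 1)) + r = 2 * (k - j) + r - 2 by omega]
      simp only [C_add, C_mul, C_0] at h ⊢
      push_cast at h ⊢
      simp only [C_add, C_mul, C_1] at h ⊢
      linear_combination (quadSome s ^ j * X none ^ (2 * (k - j) + r - 2)) * h
    refine Eq.trans ?_ ((congrArg (C (s c) * X (some c) * ·) key).trans (mul_zero _))
    rw [mul_add (C (s c) * X (some c)), Finset.mul_sum, Finset.mul_sum,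
      Finset.mul_sum, Finset.mul_sum, ← Finset.sum_add_distrib, ← Finset.sum_add_distrib]
    refine Finset.sum_congr rfl fun j _ => ?_
    rw [pderiv_C_mul, pderiv_some_monomial, ← smul_eq_C_mul (_ * X none ^ _) (a j), map_smul,
      box_monomial s hs, smul_eq_C_mul]
    have hn : ∀ x : ℕ, (C (x : ℂ) : MvPolynomial (Option κ) ℂ) = x := fun x => map_natCast C x
    have h2 : (C (2 : ℂ) : MvPolynomial (Option κ) ℂ) = 2 := map_ofNat C 2
    simp only [C_add, C_mul, C_sub, C_1, hn, h2, extSign, Option.elim]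
    ring

theorem slice_quadSome_mul (s : κ → ℂ) (i : ℕ) (p : MvPolynomial (Option κ) ℂ) :
    slice i (quadSome s * p) = quad s * slice i p := by
  rw [quadSome, quad, Finset.sum_mul, slice_sum, Finset.sum_mul]
  refine Finset.sum_congr rfl fun c _ => ?_
  rw [mul_assoc, slice_C_mul, pow_two, mul_assoc, slice_X_some_mul, slice_X_some_mul]
  ring

theorem slice_X_none_pow (i j : ℕ) :
    slice i (X none ^ j : MvPolynomial (Option κ) ℂ) = if i = j then 1 else 0 := by
  simp [slice, optionEquivLeft_X_none, Polynomial.coeff_X_pow]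

/-- The lowest power `T^r` occurs only for `j = k`, so the normalization `a_k = 1` is exactly what
fixes this slice. -/
theorem slice_symbolSum (s : κ → ℂ) (a : ℕ → ℂ) (k r : ℕ) (ha : a k = 1) :
    slice r (symbolSum s a k r) = quad s ^ k := by
  have h : ∀ j, slice r (quadSome s ^ j * X none ^ (2 * (k - j) + r)) =
      quad s ^ j * if 2 * (k - j) = 0 then 1 else 0 := by
    intro j
    have : ∀ (p : MvPolynomial (Option κ) ℂ) (l : ℕ),
        slice r (quadSome s ^ l * p) = quad s ^ l * slice r p := by
      intro p l
      induction l with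
      | zero => simp
      | succ l ih => rw [pow_succ', mul_assoc, slice_quadSome_mul, ih, pow_succ', mul_assoc]
    rw [this, slice_X_none_pow]
    simp
  rw [symbolSum, slice_sum, Finset.sum_range_succ, Finset.sum_eq_zero, zero_add, slice_C_mul, h, ha]
  · simp
  · intro j hj
    rw [Finset.mem_range] at hj
    rw [slice_C_mul, h, if_neg (by omega), mul_zero, mul_zero]

end Explicit

/-! ### One-parameter subgroups and the right regular action -/

section Analysis

variable {m l : ℕ}

theorem expG_add_smul (X : soLie m) (s t : ℝ) :
    expG ((s + t) • X) = expG (s • X) * expG (t • X) := by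
  refine mat_injective ?_
  rw [mat_mul, mat_expG, mat_expG, mat_expG, ← Matrix.exp_add_of_commute]
  · congr 1
    simp [add_smul]
  · exact ((Commute.refl (X : Mat m)).smul_left s).smul_right t

theorem expG_zero_smul (X : soLie m) : expG ((0 : ℝ) • X) = 1 := by
  refine mat_injective ?_
  rw [mat_expG, mat_one]
  simp

theorem hasDerivAt_rightOp (X : soLie m) (u : Smooth m) (x : G m) (t : ℝ) :
    HasDerivAt (fun t : ℝ => u.1 (x * expG (t • X))) ((rightOp X u).1 (x * expG (t • X))) t := by
  obtain ⟨U, hU, hxU, F, hF, huF⟩ := u.2 (x * expG (t • X))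
  have h := hasDerivAt_right hU hF huF X hxU
  rw [← rightOp_eq X u hU hF huF hxU, ← sub_self t] at h
  refine (h.comp_sub_const t t).congr_of_eventuallyEq (Filter.Eventually.of_forall fun r => ?_)
  simp only [mul_assoc]
  rw [← expG_add_smul, add_sub_cancel]

/-- An eigenfunction of `R(X)` is multiplied by an exponential along `exp(tX)`. -/
theorem apply_mul_expG {X : soLie m} {u : Smooth m} {μ : ℂ} (h : rightOp X u = μ • u) (x : G m)
    (t : ℝ) : u.1 (x * expG (t • X)) = Complex.exp (μ * t) * u.1 x := by
  -- The function `e^{-μt} u(x exp(tX))` has derivative zero, hence it is constant.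
  have hd : ∀ t : ℝ, HasDerivAt
      (fun t : ℝ => Complex.exp (-(μ * t)) * u.1 (x * expG (t • X))) 0 t := by
    intro t
    have h1 : HasDerivAt (fun t : ℝ => Complex.exp (-(μ * t))) (Complex.exp (-(μ * t)) * -(μ * 1)) t :=
      ((Complex.ofRealCLM.hasDerivAt (x := t)).const_mul μ).neg.cexp
    have h2 := h1.mul (hasDerivAt_rightOp X u x t)
    rw [h] at h2
    have e : Complex.exp (-(μ * t)) * -(μ * 1) * u.1 (x * expG (t • X)) +
        Complex.exp (-(μ * t)) * (μ • u).1 (x * expG (t • X)) = 0 := by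
      simp only [Submodule.coe_smul, Pi.smul_apply, smul_eq_mul]
      ring
    exact e ▸ h2
  have hc := is_const_of_deriv_eq_zero (fun t => (hd t).differentiableAt)
    (fun t => (hd t).deriv) t 0
  simp only [expG_zero_smul, Complex.ofReal_zero, mul_zero, neg_zero, Complex.exp_zero, one_mul,
    mul_one] at hc
  rw [← hc, ← mul_assoc, ← Complex.exp_add]
  simp

theorem rightOp_eq_smul {X : soLie m} {u : Smooth m} {μ : ℂ}
    (h : ∀ (x : G m) (t : ℝ), u.1 (x * expG (t • X)) = Complex.exp (μ * t) * u.1 x) :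
    rightOp X u = μ • u := by
  ext x
  rw [rightOp_apply]
  simp only [h]
  have h1 : HasDerivAt (fun t : ℝ => Complex.exp (μ * t))
      (Complex.exp (μ * (0 : ℝ)) * (μ * 1)) 0 :=
    ((Complex.ofRealCLM.hasDerivAt (x := (0 : ℝ))).const_mul μ).cexp
  rw [(h1.mul_const (u.1 x)).deriv]
  simp

/-- The Lie algebra of all `X` with `R(X) u = 0`. -/
def annih (u : Smooth m) : LieSubalgebra ℝ (soLie m) where
  carrier := {X | rightLie m X u = 0}
  zero_mem' := by simp
  add_mem' := by
    intro X Y hX hY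
    simp only [Set.mem_ofPred_eq] at hX hY ⊢
    rw [map_add, LinearMap.add_apply, hX, hY, add_zero]
  smul_mem' := by
    intro c X hX
    simp only [Set.mem_ofPred_eq] at hX ⊢
    rw [map_smul, LinearMap.smul_apply, hX, smul_zero]
  lie_mem' := by
    intro X Y hX hY
    simp only [Set.mem_ofPred_eq] at hX hY ⊢
    rw [LieHom.map_lie, Ring.lie_def, LinearMap.sub_apply, Module.End.mul_apply,
      Module.End.mul_apply, hX, hY, map_zero, map_zero, sub_zero]

theorem mem_annih {u : Smooth m} {X : soLie m} : X ∈ annih u ↔ rightOp X u = 0 := Iff.rfl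

/-- Annihilation is the eigenvalue `0`, so it integrates to invariance under each `exp X` and then
under the subgroup that these generate. -/
theorem apply_mul_of_mem_analyticSubgroup {ι : G m →* G l} {f : soLie m →ₗ⁅ℝ⁆ soLie l}
    (hf : ∀ X, ι (expG X) = expG (f X)) {h : LieSubalgebra ℝ (soLie m)} {u : Smooth l}
    (hu : ∀ X ∈ h, f X ∈ annih u) {g : G m} (hg : g ∈ analyticSubgroup h) :
    ∀ x, u.1 (x * ι g) = u.1 x := by
  induction hg using Subgroup.closure_induction with
  | mem g hg =>
    obtain ⟨X, hX, rfl⟩ := hg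
    intro x
    have h1 : rightOp (f X) u = (0 : ℂ) • u := by rw [zero_smul]; exact hu X hX
    have := apply_mul_expG h1 x 1
    rw [one_smul] at this
    simpa [hf] using this
  | one => simp
  | mul a b _ _ ha hb => intro x; rw [map_mul, ← mul_assoc, hb, ha]
  | inv a _ ha => intro x; rw [← ha (x * ι a⁻¹), map_inv, inv_mul_cancel_right]

theorem mem_annih_of_invariant {ι : G m →* G l} {f : soLie m →ₗ⁅ℝ⁆ soLie l}
    (hf : ∀ X, ι (expG X) = expG (f X)) {h : LieSubalgebra ℝ (soLie m)} {u : Smooth l}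
    (hu : ∀ g ∈ analyticSubgroup h, ∀ x, u.1 (x * ι g) = u.1 x) {X : soLie m} (hX : X ∈ h) :
    f X ∈ annih u := by
  rw [mem_annih, ← zero_smul ℂ u]
  refine rightOp_eq_smul fun x t => ?_
  rw [← map_smul, ← hf, hu _ (Subgroup.subset_closure ⟨_, h.smul_mem t hX, rfl⟩)]
  simp

theorem expG_conj {g : G m} {X Y : soLie m} (h : mat g * (X : Mat m) = (Y : Mat m) * mat g) (t : ℝ) :
    g * expG (t • X) = expG (t • Y) * g := by
  refine mat_injective ?_
  have h1 : SemiconjBy (mat g) (((t • X : soLie m)) : Mat m) ((t • Y : soLie m) : Mat m) := by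
    change mat g * (t • (X : Mat m)) = (t • (Y : Mat m)) * mat g
    rw [mul_smul_comm, h, smul_mul_assoc]
  exact h1.exp_right

/-- Right translation of smooth functions. -/
def rightTrans (g : G m) : Module.End ℂ (Smooth m) where
  toFun u := ⟨fun x => u.1 (x * g), by
    intro x
    obtain ⟨U, hU, hxU, F, hF, huF⟩ := u.2 (x * g)
    have hc : ContDiff ℝ ∞ (fun Z : Mat m => Z * mat g) := contDiff_id.mul contDiff_const
    exact ⟨(fun Z : Mat m => Z * mat g) ⁻¹' U, hU.preimage hc.continuous, hxU,
      fun Z => F (Z * mat g), hF.comp hc.contDiffOn (fun _ h => h),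
      fun y hy => huF (y * g) hy⟩⟩
  map_add' := fun _ _ => rfl
  map_smul' := fun _ _ => rfl

theorem rightTrans_apply (g : G m) (u : Smooth m) (x : G m) :
    (rightTrans g u).1 x = u.1 (x * g) := rfl

/-- The hypothesis says `Y = Ad(g) X`, in a form that avoids the inverse of `g`. -/
theorem rightTrans_mul_rightOp {g : G m} {X Y : soLie m}
    (h : mat g * (X : Mat m) = (Y : Mat m) * mat g) :
    rightTrans g * rightOp X = rightOp Y * rightTrans g := by
  ext u x
  change (rightOp X u).1 (x * g) = (rightOp Y (rightTrans g u)).1 x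
  simp only [rightOp_apply, rightTrans_apply, mul_assoc, expG_conj h]

theorem leftRep_mul_rightOp (g : G m) (X : soLie m) :
    leftRep m g * rightOp X = rightOp X * leftRep m g := by
  ext u x
  change (rightOp X u).1 (g⁻¹ * x) = (rightOp X (leftRep m g u)).1 x
  rw [rightOp_apply, rightOp_apply]
  simp only [mul_assoc]
  rfl

/-- The smooth function `f^d u`. -/
def powMul (f : Smooth m) (d : ℕ) (u : Smooth m) : Smooth m :=
  ⟨fun x => f.1 x ^ d * u.1 x, by
    intro x
    obtain ⟨U, hU, hxU, F, hF, huF⟩ := f.2 x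
    obtain ⟨V, hV, hxV, F', hF', hvF⟩ := u.2 x
    exact ⟨U ∩ V, hU.inter hV, ⟨hxU, hxV⟩, fun Z => F Z ^ d * F' Z,
      ((hF.mono Set.inter_subset_left).pow d).mul (hF'.mono Set.inter_subset_right),
      fun y hy => by simp [huF y hy.1, hvF y hy.2]⟩⟩

theorem powMul_apply (f : Smooth m) (d : ℕ) (u : Smooth m) (x : G m) :
    (powMul f d u).1 x = f.1 x ^ d * u.1 x := rfl

/-- Both summands have the shape "power of `f` times a smooth function", so that the rule can be
iterated in `opSymbol_monomial_powMul`. -/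
theorem rightOp_powMul (X : soLie m) (f : Smooth m) (d : ℕ) (u : Smooth m) :
    rightOp X (powMul f (d + 1) u) = powMul f (d + 1) (rightOp X u) +
      ((d : ℂ) + 1) • powMul f d (powMul (rightOp X f) 1 u) := by
  ext x
  have h1 := hasDerivAt_rightOp X f x 0
  have h2 := hasDerivAt_rightOp X u x 0
  have h3 := ((h1.pow (d + 1)).mul h2).deriv
  simp only [expG_zero_smul, mul_one] at h3
  refine Eq.trans h3 ?_
  simp only [Submodule.coe_add, Submodule.coe_smul, Pi.add_apply, Pi.smul_apply, powMul_apply,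
    smul_eq_mul, Nat.add_sub_cancel, Pi.pow_apply, expG_zero_smul, mul_one]
  push_cast
  ring

end Analysis

/-! ### Uniform description of the root vectors -/

section RootVectors

variable {m : ℕ}

theorem E_mul_of_ne {i j k l : ℕ} (h : j ≠ k) : E m i j * E m k l = 0 := by
  ext a b
  rw [Matrix.mul_apply]
  refine Finset.sum_eq_zero fun x _ => ?_
  by_cases hx : x.val = j
  · simp [E, hx, h]
  · simp [E, hx]

theorem E_mul_same {i j l : ℕ} (h : j ≤ m) : E m i j * E m j l = E m i l := by
  ext a b
  rw [Matrix.mul_apply, Finset.sum_eq_single (⟨j, by omega⟩ : Fin (m + 1))]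
  · by_cases ha : a.val = i <;> simp [E, ha]
  · intro x _ hx
    have : x.val ≠ j := fun h => hx (Fin.ext h)
    simp [E, this]
  · simp

theorem E_eq_zero {i j : ℕ} (h : m < i ∨ m < j) : E m i j = 0 := by
  ext a b
  have ha := a.2
  have hb := b.2
  have : ¬(a.val = i ∧ b.val = j) := by omega
  simp [E, this]

/-- The root vector `X_a^-`, for the coordinate `a`. -/
def lowerMat (m a : ℕ) : Mat m := E m a 0 + E m a 3 + sgn a • (E m 0 a - E m 3 a)

/-- The root vector `X_a^+`, for the coordinate `a`. -/
def upperMat (m a : ℕ) : Mat m := E m 0 a + E m 3 a + sgn a • (E m a 0 - E m a 3)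

/-- The infinitesimal rotation in the coordinates `a` and `b`. -/
def rotMat (m a b : ℕ) : Mat m := sgn a • E m a b - sgn b • E m b a

theorem sgn_eq (a : ℕ) : sgn a = 1 ∨ sgn a = -1 := by
  unfold sgn; split_ifs <;> simp

theorem sgn_zero : sgn 0 = -1 := by norm_num [sgn]

theorem sgn_three : sgn 3 = 1 := by norm_num [sgn]

theorem lowerMat_mem (m a : ℕ) : lowerMat m a ∈ soLie m := by
  rw [mem_soLie]
  simp only [lowerMat, Matrix.transpose_add, Matrix.transpose_sub, Matrix.transpose_smul,
    E_transpose, add_mul, mul_add, sub_mul, mul_sub, mul_neg, smul_mul_assoc, mul_smul_comm,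
    E_mul_eta, eta_mul_E, sgn_zero, sgn_three, smul_sub, mul_neg, neg_smul, one_smul]
  module

theorem upperMat_mem (m a : ℕ) : upperMat m a ∈ soLie m := by
  rw [mem_soLie]
  simp only [upperMat, Matrix.transpose_add, Matrix.transpose_sub, Matrix.transpose_smul,
    E_transpose, add_mul, mul_add, sub_mul, mul_sub, mul_neg, smul_mul_assoc, mul_smul_comm,
    E_mul_eta, eta_mul_E, sgn_zero, sgn_three, smul_sub, smul_smul, mul_neg, neg_smul,
    sgn_mul_self, one_smul]
  abel

theorem rotMat_mem (m a b : ℕ) : rotMat m a b ∈ soLie m := by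
  rw [mem_soLie]
  simp only [rotMat, Matrix.transpose_sub, Matrix.transpose_smul,
    E_transpose, sub_mul, mul_sub, mul_neg, smul_mul_assoc, mul_smul_comm,
    E_mul_eta, eta_mul_E, smul_smul, sgn_mul_self, one_smul]
  abel

def lower (m a : ℕ) : soLie m := ⟨lowerMat m a, lowerMat_mem m a⟩

def upper (m a : ℕ) : soLie m := ⟨upperMat m a, upperMat_mem m a⟩

def rotLie (m a b : ℕ) : soLie m := ⟨rotMat m a b, rotMat_mem m a b⟩

theorem coe_lie (X Y : soLie m) : ((⁅X, Y⁆ : soLie m) : Mat m) = (X : Mat m) * Y - (Y : Mat m) * X :=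
  rfl

/-- Commutativity of `𝔫^-` is what permits symbols to be ordinary polynomials. -/
theorem lie_lower_lower {a b : ℕ} (hm : 3 ≤ m) (ha : a ≠ 0) (ha' : a ≠ 3) (hb : b ≠ 0)
    (hb' : b ≠ 3) : ⁅lower m a, lower m b⁆ = 0 := by
  refine Subtype.ext ?_
  rw [coe_lie]
  simp only [lower, lowerMat, add_mul, mul_add, sub_mul, mul_sub, smul_mul_assoc, mul_smul_comm]
  by_cases h : a = b
  · rw [h, sub_self]; rfl
  · simp [E_mul_of_ne, E_mul_same, ha, ha', hb, hb', ha.symm, ha'.symm, hb.symm, hb'.symm, h,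
      Ne.symm h, hm]

theorem lie_H_lower {a : ℕ} (hm : 3 ≤ m) (ha : a ≠ 0) (ha' : a ≠ 3) :
    ⁅HLie m, lower m a⁆ = -lower m a := by
  refine Subtype.ext ?_
  rw [coe_lie]
  simp only [lower, lowerMat, HLie, H, add_mul, mul_add, sub_mul, mul_sub, smul_mul_assoc,
    mul_smul_comm]
  simp [E_mul_of_ne, E_mul_same, ha, ha', ha.symm, ha'.symm, hm]
  module

theorem lie_rot_lower {a b c : ℕ} (ha : a ≠ 0) (ha' : a ≠ 3) (hb : b ≠ 0) (hb' : b ≠ 3)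
    (hc : c ≠ 0) (hc' : c ≠ 3) (ham : a ≤ m) (hbm : b ≤ m) :
    ⁅rotLie m a b, lower m c⁆ = (if b = c then sgn a • lower m a else 0) -
      (if a = c then sgn b • lower m b else 0) := by
  refine Subtype.ext ?_
  have h1 : (((if b = c then sgn a • lower m a else 0) -
      (if a = c then sgn b • lower m b else 0) : soLie m) : Mat m) =
      (if b = c then sgn a • lowerMat m a else 0) - (if a = c then sgn b • lowerMat m b else 0) := by
    split_ifs <;> simp [lower]
  rw [coe_lie, h1]
  simp only [lower, rotLie, lowerMat, rotMat, add_mul, mul_add, sub_mul, mul_sub, smul_mul_assoc,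
    mul_smul_comm]
  by_cases h : b = c <;> by_cases h' : a = c
  · subst h h'; simp
  · subst h
    simp [E_mul_of_ne, E_mul_same, ha, ha', hb, hb', ha.symm, ha'.symm, hb.symm, hb'.symm, h',
      Ne.symm h', ham, hbm, smul_smul, sgn_mul_self]
    module
  · subst h'
    simp [E_mul_of_ne, E_mul_same, ha, ha', hb, hb', ha.symm, ha'.symm, hb.symm, hb'.symm, h,
      Ne.symm h, ham, hbm, smul_smul, sgn_mul_self]
    module
  · simp [E_mul_of_ne, ha, ha', hb, hb', ha.symm, ha'.symm, hb.symm, hb'.symm, h,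
      Ne.symm h, h', Ne.symm h']

/-- The bracket falls into `𝔞 ⊕ 𝔪`, which acts on symbols by first order operators; this is why
`X_c^+` acts by a second order one. -/
theorem lie_upper_lower {a b : ℕ} (hm : 3 ≤ m) (ha : a ≠ 0) (ha' : a ≠ 3) (hb : b ≠ 0) (hb' : b ≠ 3)
    (ham : a ≤ m) :
    ⁅upper m a, lower m b⁆ = (if a = b then (2 : ℝ) • HLie m else 0) +
      (2 * sgn b) • rotLie m a b := by
  refine Subtype.ext ?_
  have h1 : (((if a = b then (2 : ℝ) • HLie m else 0) + (2 * sgn b) • rotLie m a b : soLie m) : Mat m) =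
      (if a = b then (2 : ℝ) • H m else 0) + (2 * sgn b) • rotMat m a b := by
    split_ifs <;> simp [HLie, rotLie]
  rw [coe_lie, h1]
  simp only [lower, upper, lowerMat, upperMat, rotMat, H, add_mul, mul_add, sub_mul, mul_sub,
    smul_mul_assoc, mul_smul_comm]
  by_cases h : a = b
  · subst h
    simp [E_mul_of_ne, E_mul_same, ha, ha', ha.symm, ha'.symm, ham, hm, smul_smul, sgn_mul_self]
    rcases sgn_eq a with h | h <;> rw [h] <;> module
  · have e : (2 * sgn b) • (sgn a • E m a b - sgn b • E m b a) =
        (2 * sgn b * sgn a) • E m a b - (2 : ℝ) • E m b a := by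
      rw [smul_sub, smul_smul, smul_smul, mul_assoc 2 (sgn b) (sgn b), sgn_mul_self, mul_one]
    rw [e]
    simp [E_mul_of_ne, E_mul_same, ha, ha', hb, hb', ha.symm, ha'.symm, hb.symm, hb'.symm, h,
      Ne.symm h, hm, smul_smul]
    module

/-- The coordinates other than `0` and `3`, in increasing order. -/
def coord : ℕ → ℕ
  | 0 => 1
  | 1 => 2
  | j + 2 => 4 + j

theorem coord_ne_zero (i : ℕ) : coord i ≠ 0 := by
  rcases i with _ | _ | i <;> simp [coord]

theorem coord_ne_three (i : ℕ) : coord i ≠ 3 := by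
  rcases i with _ | _ | i <;> simp [coord]; omega

theorem coord_injective : Function.Injective coord := by
  intro i j h
  rcases i with _ | _ | i <;> rcases j with _ | _ | j <;> simp [coord] at h ⊢ <;> omega

theorem coord_le {i m : ℕ} (h : i + 2 ≤ m) (hm : 3 ≤ m): coord i ≤ m := by
  rcases i with _ | _ | i <;> simp [coord] <;> omega

theorem lowerMat_coord_zero (m : ℕ) : lowerMat m (coord 0) = (Q₁p m)ᵀ := by
  simp only [lowerMat, coord, Q₁p, Matrix.transpose_add, Matrix.transpose_sub, E_transpose]
  norm_num [sgn]
  abel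

theorem lowerMat_coord_one (m : ℕ) : lowerMat m (coord 1) = (Q₂p m)ᵀ := by
  simp only [lowerMat, coord, Q₂p, Matrix.transpose_add, Matrix.transpose_sub, E_transpose]
  norm_num [sgn]
  abel

theorem lowerMat_coord_add_two (m j : ℕ) : lowerMat m (coord (j + 2)) = (Yp m j)ᵀ := by
  simp only [lowerMat, coord, Yp, Matrix.transpose_add, Matrix.transpose_sub, E_transpose,
    sgn_four_add]
  rw [one_smul]
  abel

theorem upperMat_coord_zero (m : ℕ) : upperMat m (coord 0) = Q₁p m := by
  simp only [upperMat, coord, Q₁p]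
  norm_num [sgn]
  abel

theorem upperMat_coord_one (m : ℕ) : upperMat m (coord 1) = Q₂p m := by
  simp only [upperMat, coord, Q₂p]
  norm_num [sgn]
  abel

theorem upperMat_coord_add_two (m j : ℕ) : upperMat m (coord (j + 2)) = Yp m j := by
  simp only [upperMat, coord, Yp, sgn_four_add]
  rw [one_smul]
  abel

theorem lower_coord_mem (m i : ℕ) : lower m (coord i) ∈ nMinus m := by
  refine LieSubalgebra.subset_lieSpan ?_
  rcases i with _ | _ | i
  · exact Or.inl (lowerMat_coord_zero m)
  · exact Or.inr (Or.inl (lowerMat_coord_one m))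
  · exact Or.inr (Or.inr ⟨i, lowerMat_coord_add_two m i⟩)

theorem upper_coord_mem (m i : ℕ) : upper m (coord i) ∈ nPlus m := by
  refine LieSubalgebra.subset_lieSpan ?_
  rcases i with _ | _ | i
  · exact Or.inl (upperMat_coord_zero m)
  · exact Or.inr (Or.inl (upperMat_coord_one m))
  · exact Or.inr (Or.inr ⟨i, upperMat_coord_add_two m i⟩)

/-- A Lie subalgebra that contains all `X_a^+` contains `𝔫^+`. -/
theorem nPlus_le {h : LieSubalgebra ℝ (soLie m)} (hm : 3 ≤ m)
    (hh : ∀ i, i + 2 ≤ m → upper m (coord i) ∈ h) : nPlus m ≤ h := by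
  refine LieSubalgebra.lieSpan_le.mpr ?_
  rintro X (hX | hX | ⟨j, hX⟩)
  · rw [← upperMat_coord_zero] at hX
    rw [show X = upper m (coord 0) from Subtype.ext hX]
    exact hh 0 (by omega)
  · rw [← upperMat_coord_one] at hX
    rw [show X = upper m (coord 1) from Subtype.ext hX]
    exact hh 1 (by omega)
  · by_cases hj : 4 + j ≤ m
    · rw [← upperMat_coord_add_two] at hX
      rw [show X = upper m (coord (j + 2)) from Subtype.ext hX]
      exact hh (j + 2) (by omega)
    -- For `j` out of range the generator `Y_j^+` is the zero matrix.
    · have h0 : X = 0 := Subtype.ext (by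
        rw [hX, Yp]
        simp [E_eq_zero, show m < 4 + j by omega])
      rw [h0]
      exact h.zero_mem

theorem rotMat_swap (m a b : ℕ) : rotMat m b a = -rotMat m a b := by
  simp [rotMat]

theorem H₂_eq (m : ℕ) : H₂ m = -rotMat m (coord 0) (coord 1) := by
  simp only [rotMat, coord, H₂]
  norm_num [sgn]
  abel

theorem Mrot_eq (m i j : ℕ) : Mrot m i j = rotMat m (coord (i + 2)) (coord (j + 2)) := by
  simp only [rotMat, coord, Mrot, sgn_four_add, one_smul]

theorem Zp_eq (m j : ℕ) :
    Zp m j = -rotMat m (coord 0) (coord (j + 2)) + rotMat m (coord 1) (coord (j + 2)) := by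
  simp only [rotMat, coord, Zp, sgn_four_add, one_smul]
  norm_num [sgn]
  abel

theorem Zp_transpose_eq (m j : ℕ) :
    (Zp m j)ᵀ = -rotMat m (coord 0) (coord (j + 2)) - rotMat m (coord 1) (coord (j + 2)) := by
  simp only [rotMat, coord, Zp, sgn_four_add, one_smul, Matrix.transpose_add,
    Matrix.transpose_sub, E_transpose]
  norm_num [sgn]
  abel

theorem rotLie_swap (m a b : ℕ) : rotLie m b a = -rotLie m a b := Subtype.ext (rotMat_swap m a b)

theorem Zp_mem (m j : ℕ) : Zp m j ∈ soLie m := by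
  rw [Zp_eq]
  exact add_mem (neg_mem (rotMat_mem _ _ _)) (rotMat_mem _ _ _)

theorem Zp_transpose_mem (m j : ℕ) : (Zp m j)ᵀ ∈ soLie m := by
  rw [Zp_transpose_eq]
  exact sub_mem (neg_mem (rotMat_mem _ _ _)) (rotMat_mem _ _ _)

/-- Half the sum and half the difference of `Z_j^+` and `Z_j^-` are, up to sign, the rotations of
the coordinate of `Y_j` against `t_2` and `x_1`. -/
theorem rotLie_coord_mem (m i j : ℕ) : rotLie m (coord i) (coord j) ∈ mLie m := by
  have hZ : ∀ j, (⟨Zp m j, Zp_mem m j⟩ : soLie m) ∈ mLie m := fun j =>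
    LieSubalgebra.subset_lieSpan (Or.inr (Or.inr ⟨j, Or.inl rfl⟩))
  have hZt : ∀ j, (⟨(Zp m j)ᵀ, Zp_transpose_mem m j⟩ : soLie m) ∈ mLie m := fun j =>
    LieSubalgebra.subset_lieSpan (Or.inr (Or.inr ⟨j, Or.inr rfl⟩))
  have h01 : rotLie m (coord 0) (coord 1) ∈ mLie m := by
    rw [← neg_mem_iff]
    exact LieSubalgebra.subset_lieSpan (Or.inl (H₂_eq m).symm)
  have h0 : ∀ j, rotLie m (coord 0) (coord (j + 2)) ∈ mLie m := by
    intro j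
    have e : rotLie m (coord 0) (coord (j + 2)) = (-(1 / 2) : ℝ) •
        ((⟨Zp m j, Zp_mem m j⟩ : soLie m) + ⟨(Zp m j)ᵀ, Zp_transpose_mem m j⟩) := by
      refine Subtype.ext ?_
      change rotMat m _ _ = (-(1 / 2) : ℝ) • (Zp m j + (Zp m j)ᵀ)
      rw [Zp_transpose_eq, Zp_eq]
      module
    rw [e]
    exact (mLie m).smul_mem _ (add_mem (hZ j) (hZt j))
  have h1 : ∀ j, rotLie m (coord 1) (coord (j + 2)) ∈ mLie m := by
    intro j
    have e : rotLie m (coord 1) (coord (j + 2)) = ((1 / 2) : ℝ) •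
        ((⟨Zp m j, Zp_mem m j⟩ : soLie m) - ⟨(Zp m j)ᵀ, Zp_transpose_mem m j⟩) := by
      refine Subtype.ext ?_
      change rotMat m _ _ = ((1 / 2) : ℝ) • (Zp m j - (Zp m j)ᵀ)
      rw [Zp_transpose_eq, Zp_eq]
      module
    rw [e]
    exact (mLie m).smul_mem _ (sub_mem (hZ j) (hZt j))
  have hself : ∀ a, rotLie m a a ∈ mLie m := by
    intro a
    have : rotLie m a a = 0 := Subtype.ext (sub_self _)
    rw [this]
    exact (mLie m).zero_mem
  rcases i with _ | _ | i <;> rcases j with _ | _ | j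
  · exact hself _
  · exact h01
  · exact h0 j
  · rw [rotLie_swap]; exact neg_mem h01
  · exact hself _
  · exact h1 j
  · rw [rotLie_swap]; exact neg_mem (h0 i)
  · rw [rotLie_swap]; exact neg_mem (h1 i)
  · exact LieSubalgebra.subset_lieSpan (Or.inr (Or.inl ⟨i, j, (Mrot_eq m i j).symm⟩))

/-- A Lie subalgebra that contains all rotations contains `𝔪`. -/
theorem mLie_le {h : LieSubalgebra ℝ (soLie m)} (hm : 3 ≤ m)
    (hh : ∀ i j, i + 2 ≤ m → j + 2 ≤ m → rotLie m (coord i) (coord j) ∈ h) : mLie m ≤ h := by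
  have hh' : ∀ i j, i < 2 ∨ i + 2 ≤ m → rotLie m (coord i) (coord j) ∈ h := by
    intro i j hi
    by_cases hj : j + 2 ≤ m
    · exact hh i j (by omega) hj
    · obtain ⟨j, rfl⟩ := Nat.exists_eq_add_of_le' (show 2 ≤ j by omega)
      have h0 : rotLie m (coord i) (coord (j + 2)) = 0 := Subtype.ext (by
        simp [rotLie, rotMat, coord, E_eq_zero, show m < 4 + j by omega])
      rw [h0]
      exact h.zero_mem
  refine LieSubalgebra.lieSpan_le.mpr ?_
  rintro X (hX | ⟨i, j, hX⟩ | ⟨j, hX | hX⟩)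
  · rw [show X = -rotLie m (coord 0) (coord 1) from Subtype.ext (hX.trans (H₂_eq m))]
    exact neg_mem (hh' _ _ (by omega))
  · rw [show X = rotLie m (coord (i + 2)) (coord (j + 2)) from Subtype.ext (hX.trans (Mrot_eq m i j))]
    by_cases hi : i + 2 + 2 ≤ m
    · exact hh' _ _ (Or.inr hi)
    · have h0 : rotLie m (coord (i + 2)) (coord (j + 2)) = 0 := Subtype.ext (by
        simp [rotLie, rotMat, coord, E_eq_zero, show m < 4 + i by omega])
      rw [h0]
      exact h.zero_mem
  · rw [show X = -rotLie m (coord 0) (coord (j + 2)) + rotLie m (coord 1) (coord (j + 2)) from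
      Subtype.ext (hX.trans (Zp_eq m j))]
    exact add_mem (neg_mem (hh' _ _ (by omega))) (hh' _ _ (by omega))
  · rw [show X = -rotLie m (coord 0) (coord (j + 2)) - rotLie m (coord 1) (coord (j + 2)) from
      Subtype.ext (hX.trans (Zp_transpose_eq m j))]
    exact sub_mem (neg_mem (hh' _ _ (by omega))) (hh' _ _ (by omega))

end RootVectors

/-! ### Symbols of invariant differential operators -/

section Symbols

open MvPolynomial

/-- Evaluation of polynomials at commuting elements of a noncommutative algebra. -/
def commAeval {A ι : Type*} [Ring A] [Algebra ℂ A] (x : ι → A) (h : ∀ i j, x i * x j = x j * x i) :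
    MvPolynomial ι ℂ →ₐ[ℂ] A :=
  letI : CommRing (Algebra.adjoin ℂ (Set.range x)) := Algebra.adjoinCommRingOfComm ℂ (by
    rintro _ ⟨i, rfl⟩ _ ⟨j, rfl⟩
    exact h i j)
  (Algebra.adjoin ℂ (Set.range x)).val.comp
    (aeval fun i => (⟨x i, Algebra.subset_adjoin ⟨i, rfl⟩⟩ : Algebra.adjoin ℂ (Set.range x)))

theorem commAeval_X {A ι : Type*} [Ring A] [Algebra ℂ A] (x : ι → A)
    (h : ∀ i j, x i * x j = x j * x i) (i : ι) : commAeval x h (X i) = x i := by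
  letI : CommRing (Algebra.adjoin ℂ (Set.range x)) := Algebra.adjoinCommRingOfComm ℂ (by
    rintro _ ⟨i, rfl⟩ _ ⟨j, rfl⟩
    exact h i j)
  unfold commAeval
  rw [AlgHom.comp_apply, aeval_X]
  rfl

theorem map_C_mul {A ι : Type*} [Semiring A] [Algebra ℂ A] (Φ : MvPolynomial ι ℂ →ₐ[ℂ] A) (c : ℂ)
    (p : MvPolynomial ι ℂ) : Φ (C c * p) = c • Φ p := by
  rw [← smul_eq_C_mul, map_smul]

/-! ### Moving operators past a polynomial in commuting operators -/

section Calculus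

variable {ι V : Type*} [AddCommGroup V] [Module ℂ V] (Φ : MvPolynomial ι ℂ →ₐ[ℂ] Module.End ℂ V)

theorem apply_C_mul (c : ℂ) (p : MvPolynomial ι ℂ) (u : V) : Φ (C c * p) u = c • Φ p u := by
  rw [map_C_mul, LinearMap.smul_apply]

theorem apply_X_mul (i : ι) (p : MvPolynomial ι ℂ) (u : V) : Φ (X i * p) u = Φ (X i) (Φ p u) := by
  rw [map_mul, Module.End.mul_apply]

/-- Commutation with the generators by a derivation extends to all polynomials by the Leibniz rule;
what finally reaches `u` contributes the eigenvalue `μ`. -/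
theorem apply_derivation (B : Module.End ℂ V)
    (D : Derivation ℂ (MvPolynomial ι ℂ) (MvPolynomial ι ℂ)) {μ : ℂ} {u : V}
    (hB : ∀ i, B * Φ (X i) = Φ (X i) * B + Φ (D (X i))) (hu : B u = μ • u)
    (p : MvPolynomial ι ℂ) : B (Φ p u) = Φ (C μ * p + D p) u := by
  induction p using MvPolynomial.induction_on with
  | C a =>
    have h : Φ (C a) = a • 1 := by rw [← mul_one (C a), ← smul_eq_C_mul, map_smul, map_one]
    rw [derivation_C, add_zero, apply_C_mul, h, LinearMap.smul_apply, Module.End.one_apply,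
      map_smul, hu, smul_comm]
  | add p q hp hq =>
    rw [map_add, LinearMap.add_apply, map_add, hp, hq, map_add D, ← LinearMap.add_apply, ← map_add]
    congr 2
    ring
  | mul_X p i hp =>
    have h := congrArg (fun T : Module.End ℂ V => T (Φ p u)) (hB i)
    simp only [Module.End.mul_apply, LinearMap.add_apply] at h
    rw [mul_comm p, apply_X_mul, h, hp, ← apply_X_mul, ← Module.End.mul_apply, ← map_mul,
      ← LinearMap.add_apply, ← map_add]
    congr 2
    rw [D.leibniz]
    simp only [smul_eq_mul]
    ring

/-- Here the commutators with the generators are not polynomials in the generators: they involve `h`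
and `l`, whose effect on `Φ(p)u` is already known. Peeling off one variable at a time reproduces the
recursion `conf_mul_X`. -/
theorem apply_conf [Fintype ι] [DecidableEq ι] {s : ι → ℂ} (hs : ∀ i, s i * s i = 1) {lam : ℂ}
    {h : Module.End ℂ V} {l : ι → ι → Module.End ℂ V} {y : ι → Module.End ℂ V} {u : V}
    (hh : ∀ p, h (Φ p u) = Φ (C lam * p - euler ι p) u)
    (hl : ∀ a b p, l a b (Φ p u) = Φ (rot s a b p) u)
    (hy : ∀ c d, y c * Φ (X d) = Φ (X d) * y c + (if c = d then (2 : ℂ) • h else 0) +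
      (2 * s d) • l c d) (hu : ∀ c, y c u = 0) (c : ι) (p : MvPolynomial ι ℂ) :
    y c (Φ p u) = Φ (conf s lam c p) u := by
  induction p using MvPolynomial.induction_on with
  | C a =>
    have h : Φ (C a) = a • 1 := by rw [← mul_one (C a), ← smul_eq_C_mul, map_smul, map_one]
    rw [h, LinearMap.smul_apply, Module.End.one_apply, map_smul, hu, conf_apply]
    simp [box_apply]
  | add p q hp hq => rw [map_add, LinearMap.add_apply, map_add, hp, hq, map_add (conf s lam c),
      map_add, LinearMap.add_apply]
  | mul_X p d hp =>
    have h1 := congrArg (fun T : Module.End ℂ V => T (Φ p u)) (hy c d)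
    simp only [Module.End.mul_apply, LinearMap.add_apply, LinearMap.smul_apply, hl, hp] at h1
    have h2 : (C (2 * s d) : MvPolynomial ι ℂ) = 2 * C (s d) := by
      rw [MvPolynomial.C_mul, map_ofNat]
    have h3 : (C 2 : MvPolynomial ι ℂ) = 2 := map_ofNat C 2
    rw [mul_comm p, apply_X_mul, h1, mul_comm _ p, conf_mul_X s hs, map_add, map_add,
      LinearMap.add_apply, LinearMap.add_apply, apply_X_mul, ← h2, apply_C_mul]
    congr 2
    split_ifs with hcd
    · rw [LinearMap.smul_apply, hh, ← h3, apply_C_mul]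
    · simp

end Calculus

/-! ### Polynomials as elements of the enveloping algebra -/

variable (k : ℕ)

/-- The position of a variable; `none` is the variable of `T`. -/
def pos (o : Option (Fin (k + 2))) : ℕ := o.elim (k + 2) Fin.val

/-- The signs of the variables other than the last one. -/
def signs (i : Fin (k + 2)) : ℂ := (sgn (coord i) : ℂ)

theorem signs_mul_self (i : Fin (k + 2)) : signs k i * signs k i = 1 := by
  rw [signs, ← Complex.ofReal_mul, sgn_mul_self, Complex.ofReal_one]

theorem extSign_signs (o : Option (Fin (k + 2))) :
    extSign (signs k) o = (sgn (coord (pos k o)) : ℂ) := by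
  rcases o with _ | i
  · change (1 : ℂ) = (sgn (4 + k) : ℂ)
    rw [sgn_four_add, Complex.ofReal_one]
  · rfl

theorem extSign_mul_self (o : Option (Fin (k + 2))) :
    extSign (signs k) o * extSign (signs k) o = 1 := by
  rw [extSign_signs, ← Complex.ofReal_mul, sgn_mul_self, Complex.ofReal_one]

theorem pos_lt (o : Option (Fin (k + 2))) : pos k o < k + 3 := by
  rcases o with _ | i
  · exact Nat.lt_succ_self _
  · exact i.2.trans (Nat.lt_succ_self _)

theorem pos_injective : Function.Injective (pos k) := by
  intro a b h
  rcases a with _ | a <;> rcases b with _ | b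
  · rfl
  · exact absurd h (ne_of_gt b.2)
  · exact absurd h (ne_of_lt a.2)
  · exact congrArg some (Fin.ext h)

theorem coord_pos_le {m : ℕ} (hm : k + 4 ≤ m) (o : Option (Fin (k + 2))) : coord (pos k o) ≤ m :=
  coord_le (by have := pos_lt k o; omega) (by omega)

theorem coord_pos_eq_iff {a b : Option (Fin (k + 2))} :
    coord (pos k a) = coord (pos k b) ↔ a = b :=
  ⟨fun h => pos_injective k (coord_injective h), fun h => by rw [h]⟩

/-- The generators of `𝒰(𝔫^-)`. -/
def genU (m i : ℕ) : UnMinus m := toU ⟨lower m (coord i), lower_coord_mem m i⟩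

theorem toU_add {m : ℕ} (X Y : nMinus m) : toU (X + Y) = toU X + toU Y := by
  rw [toU, map_add, TensorProduct.tmul_add]; rfl

theorem toU_smul {m : ℕ} (c : ℝ) (X : nMinus m) : toU (c • X) = (c : ℂ) • toU X := by
  rw [toU, map_smul, ← TensorProduct.smul_tmul, toU, TensorProduct.smul_tmul']
  congr 1

theorem toU_lie {m : ℕ} (X Y : nMinus m) : toU ⁅X, Y⁆ = toU X * toU Y - toU Y * toU X := by
  rw [toU, LieHom.map_lie, Ring.lie_def, TensorProduct.tmul_sub, toU, toU,
    Algebra.TensorProduct.tmul_mul_tmul, Algebra.TensorProduct.tmul_mul_tmul, one_mul]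

theorem toU_zero {m : ℕ} : toU (0 : nMinus m) = 0 := by
  rw [toU, map_zero, TensorProduct.tmul_zero]

theorem genU_comm {m : ℕ} (hm : 3 ≤ m) (i j : ℕ) : genU m i * genU m j = genU m j * genU m i := by
  rw [← sub_eq_zero, genU, genU, ← toU_lie]
  have h : ⁅(⟨lower m (coord i), lower_coord_mem m i⟩ : nMinus m),
      (⟨lower m (coord j), lower_coord_mem m j⟩ : nMinus m)⁆ = 0 :=
    Subtype.ext (lie_lower_lower hm (coord_ne_zero i) (coord_ne_three i) (coord_ne_zero j)
      (coord_ne_three j))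
  rw [h, toU_zero]

theorem genU_zero (m : ℕ) : genU m 0 = Q₁m m := by
  rw [genU, Q₁m]
  congr 2
  exact Subtype.ext (lowerMat_coord_zero m)

theorem genU_one (m : ℕ) : genU m 1 = Q₂m m := by
  rw [genU, Q₂m]
  congr 2
  exact Subtype.ext (lowerMat_coord_one m)

theorem genU_add_two (m j : ℕ) : genU m (j + 2) = Ym m j := by
  rw [genU, Ym]
  congr 2
  exact Subtype.ext (lowerMat_coord_add_two m j)

/-- Polynomials as elements of the commutative algebra `𝒰(𝔫^-)`. -/
def ofSymbol {m : ℕ} (hm : k + 4 ≤ m) : MvPolynomial (Option (Fin (k + 2))) ℂ →ₐ[ℂ] UnMinus m :=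
  commAeval (fun o => genU m (pos k o)) fun _ _ => genU_comm (by omega) _ _

theorem ofSymbol_X {m : ℕ} (hm : k + 4 ≤ m) (o : Option (Fin (k + 2))) :
    ofSymbol k hm (X o) = genU (m) (pos k o) :=
  commAeval_X _ _ _

/-- The enveloping algebra is generated by `L`: the universal property gives a map into the preimage
of `S`, and followed by the inclusion it is the identity, by uniqueness. -/
theorem tmul_mem_of_ι_mem {L A : Type*} [LieRing L] [LieAlgebra ℝ L] [Ring A] [Algebra ℝ A]
    (f : UniversalEnvelopingAlgebra ℝ L →ₐ[ℝ] A) (S : Subalgebra ℝ A)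
    (h : ∀ X, f (UniversalEnvelopingAlgebra.ι ℝ X) ∈ S) (x : UniversalEnvelopingAlgebra ℝ L) :
    f x ∈ S := by
  let S' := S.comap f
  let g : L →ₗ⁅ℝ⁆ S' :=
    { toFun := fun X => ⟨UniversalEnvelopingAlgebra.ι ℝ X, h X⟩
      map_add' := fun X Y => Subtype.ext (map_add _ X Y)
      map_smul' := fun c X => Subtype.ext (map_smul _ c X)
      map_lie' := fun {X Y} => Subtype.ext (LieHom.map_lie _ X Y) }
  have h1 : S'.val.comp (UniversalEnvelopingAlgebra.lift ℝ g) = AlgHom.id ℝ _ := by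
    refine UniversalEnvelopingAlgebra.hom_ext ℝ (LieHom.ext fun X => ?_)
    change ((UniversalEnvelopingAlgebra.lift ℝ g (UniversalEnvelopingAlgebra.ι ℝ X) : S') :
      UniversalEnvelopingAlgebra ℝ L) = UniversalEnvelopingAlgebra.ι ℝ X
    rw [UniversalEnvelopingAlgebra.lift_ι_apply]
    rfl
  have h2 := DFunLike.congr_fun h1 x
  have h3 : ((UniversalEnvelopingAlgebra.lift ℝ g x : S') : UniversalEnvelopingAlgebra ℝ L) = x := h2
  rw [← h3]
  exact (UniversalEnvelopingAlgebra.lift ℝ g x).2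

/-- Every element has a symbol. Injectivity is never needed, because symbols are compared through
their action on functions. -/
theorem ofSymbol_surjective {m : ℕ} (hm : k + 4 ≤ m) (hm' : m ≤ k + 4) :
    Function.Surjective (ofSymbol k hm) := by
  have hgen : ∀ i, genU (m) i ∈ (ofSymbol k hm).range := by
    intro i
    rcases lt_trichotomy i (k + 2) with h | h | h
    · exact ⟨X (some ⟨i, h⟩), ofSymbol_X k hm _⟩
    · exact ⟨X none, by rw [h]; exact ofSymbol_X k hm _⟩
    · obtain ⟨j, rfl⟩ := Nat.exists_eq_add_of_le' (show 2 ≤ i by omega)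
      -- Beyond the last coordinate the root vector is the zero matrix.
      have h0 : (⟨lower (m) (coord (j + 2)), lower_coord_mem _ _⟩ : nMinus (m)) = 0 :=
        Subtype.ext (Subtype.ext (by
          simp [lower, lowerMat, coord, E_eq_zero, show m < 4 + j by omega]))
      rw [genU, h0, toU_zero]
      exact zero_mem _
  have hX : ∀ X (hX : X ∈ nMinus (m)), toU ⟨X, hX⟩ ∈ (ofSymbol k hm).range := by
    intro X hX
    induction hX using LieSubalgebra.lieSpan_induction with
    | mem X h =>
      rcases h with h | h | ⟨j, h⟩
      · rw [← lowerMat_coord_zero] at h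
        obtain rfl : X = lower _ (coord 0) := Subtype.ext h
        exact hgen 0
      · rw [← lowerMat_coord_one] at h
        obtain rfl : X = lower _ (coord 1) := Subtype.ext h
        exact hgen 1
      · rw [← lowerMat_coord_add_two] at h
        obtain rfl : X = lower _ (coord (j + 2)) := Subtype.ext h
        exact hgen (j + 2)
    | zero =>
      rw [show (⟨0, (nMinus (m)).zero_mem⟩ : nMinus (m)) = 0 from rfl, toU_zero]
      exact zero_mem _
    | add X Y h1 h2 hX hY =>
      rw [show (⟨X + Y, add_mem h1 h2⟩ : nMinus (m)) = ⟨X, h1⟩ + ⟨Y, h2⟩ from rfl, toU_add]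
      exact add_mem hX hY
    | smul c X h1 hX =>
      rw [show (⟨c • X, (nMinus (m)).smul_mem c h1⟩ : nMinus (m)) =
        c • ⟨X, h1⟩ from rfl, toU_smul]
      exact Subalgebra.smul_mem _ hX _
    | lie X Y h1 h2 hX hY =>
      rw [show (⟨⁅X, Y⁆, (nMinus (m)).lie_mem h1 h2⟩ : nMinus (m)) =
        ⁅(⟨X, h1⟩ : nMinus (m)), (⟨Y, h2⟩ : nMinus (m))⁆ from rfl, toU_lie]
      exact sub_mem (mul_mem hX hY) (mul_mem hY hX)
  intro D
  change D ∈ (ofSymbol k hm).range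
  induction D using TensorProduct.induction_on with
  | zero => exact zero_mem _
  | add x y hx hy => exact add_mem hx hy
  | tmul z x =>
    have h : (1 : ℂ) ⊗ₜ[ℝ] x ∈ (ofSymbol k hm).range :=
      tmul_mem_of_ι_mem (Algebra.TensorProduct.includeRight (R := ℝ) (A := ℂ))
        ((ofSymbol k hm).range.restrictScalars ℝ) (fun X => hX X.1 X.2) x
    have e : z ⊗ₜ[ℝ] x = z • ((1 : ℂ) ⊗ₜ[ℝ] x) := by
      rw [TensorProduct.smul_tmul', smul_eq_mul, mul_one]
    rw [e]
    exact Subalgebra.smul_mem _ h z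

theorem ofSymbol_quadSome {n : ℕ} (hn : n = k + 3) (hm : k + 4 ≤ n + 1) :
    ofSymbol k hm (quadSome (signs k)) = Lap n := by
  have h : ∀ c : Fin (k + 2), ofSymbol k hm (C (signs k c) * X (some c) ^ 2) =
      (sgn (coord c) : ℂ) • genU (n + 1) c ^ 2 := by
    intro c
    rw [map_C_mul, map_pow, ofSymbol_X]
    rfl
  rw [quadSome, map_sum, Finset.sum_congr rfl fun c _ => h c,
    Fin.sum_univ_eq_sum_range (fun i => (sgn (coord i) : ℂ) • genU (n + 1) i ^ 2) (k + 2),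
    Finset.sum_range_succ', Finset.sum_range_succ', Lap, genU_zero, genU_one,
    show n - 3 = k by omega]
  simp only [Nat.zero_add, genU_add_two]
  have e1 : (sgn (coord 0) : ℂ) = -1 := by norm_num [coord, sgn]
  have e2 : (sgn (coord 1) : ℂ) = 1 := by norm_num [coord, sgn]
  have e3 : ∀ j, (sgn (coord (j + 2)) : ℂ) = 1 := fun j => by
    rw [coord, sgn_four_add, Complex.ofReal_one]
  simp only [e1, e2, e3, one_smul, neg_smul, add_assoc, Nat.add_sub_cancel]
  abel

theorem ofSymbol_X_none {n : ℕ} (hn : n = k + 3) (hm : k + 4 ≤ n + 1) :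
    ofSymbol k hm (X none) = Tn n := by
  rw [ofSymbol_X]
  rw [Tn, hn, Nat.add_sub_cancel]
  exact genU_add_two _ k

/-- The symbol of `𝒟_N^0(λ)`. -/
def symbolD0 (n k : ℕ) (lam : ℂ) (N : ℕ) : MvPolynomial (Option (Fin (k + 2))) ℂ :=
  if Even N then
    symbolSum (signs k) (fun j => evenCoeff n lam (N / 2) (N / 2 - j)) (N / 2) 0
  else symbolSum (signs k) (fun j => oddCoeff n lam (N / 2) (N / 2 - j)) (N / 2) 1

theorem ofSymbol_symbolD0 {n : ℕ} (hn : n = k + 3) (hm : k + 4 ≤ n + 1) (lam : ℂ) (N : ℕ) :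
    ofSymbol k hm (symbolD0 n k lam N) = D0 n lam N := by
  rw [symbolD0, D0]
  split_ifs
  · rw [symbolSum, Deven, map_sum]
    refine Finset.sum_congr rfl fun j _ => ?_
    rw [map_C_mul, map_mul, map_pow, map_pow, ofSymbol_quadSome k hn,
      ofSymbol_X_none k hn]
    exact congrArg (fun i => evenCoeff n lam (N / 2) (N / 2 - j) •
      (Lap n ^ j * Tn n ^ i)) (by omega)
  · rw [symbolSum, Dodd, map_sum]
    refine Finset.sum_congr rfl fun j _ => ?_
    rw [map_C_mul, map_mul, map_pow, map_pow, ofSymbol_quadSome k hn,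
      ofSymbol_X_none k hn]
    exact congrArg (fun i => oddCoeff n lam (N / 2) (N / 2 - j) •
      (Lap n ^ j * Tn n ^ i)) (by omega)

/-- The number of variables other than `T_n` is `k + 2 = n - 1`. With it, the condition of
`isSymbol_symbolSum` is twice the defining recursion; for odd `N` the additional `-2` in `-2N` turns
`n - 1` into `n - 3`. -/
theorem isSymbol_symbolD0 {n : ℕ} (hn : n = k + 3) (lam : ℂ) (N : ℕ) :
    IsSymbol (signs k) lam N (symbolD0 n k lam N) := by
  rw [symbolD0]
  split_ifs with h
  · refine isSymbol_symbolSum _ (signs_mul_self k) _ _ (by omega)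
      (by rw [Nat.even_iff] at h; omega) fun j hj => ?_
    have h1 := evenCoeff_recursion n lam (N / 2) (j + 1) (by omega) (by omega)
    have h2 : (N : ℂ) = 2 * ((N / 2 : ℕ) : ℂ) := by
      rw [Nat.even_iff] at h
      exact_mod_cast (by omega : N = 2 * (N / 2))
    rw [Nat.add_sub_cancel] at h1
    have h3 : (n : ℂ) = k + 3 := by exact_mod_cast hn
    rw [h3] at h1
    rw [h2, Fintype.card_fin]
    push_cast [Nat.cast_sub hj.le] at h1 ⊢
    linear_combination 2 * h1
  · refine isSymbol_symbolSum _ (signs_mul_self k) _ _ (by omega)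
      (by rw [Nat.not_even_iff] at h; omega) fun j hj => ?_
    have h1 := oddCoeff_recursion n lam (N / 2) (j + 1) (by omega) (by omega)
    have h2 : (N : ℂ) = 2 * ((N / 2 : ℕ) : ℂ) + 1 := by
      rw [Nat.not_even_iff] at h
      exact_mod_cast (by omega : N = 2 * (N / 2) + 1)
    rw [Nat.add_sub_cancel] at h1
    have h3 : (n : ℂ) = k + 3 := by exact_mod_cast hn
    rw [h3] at h1
    rw [h2, Fintype.card_fin]
    push_cast [Nat.cast_sub hj.le] at h1 ⊢
    linear_combination 2 * h1

theorem exists_eq_symbolD0 {n : ℕ} (hn : n = k + 3) {lam : ℂ} {N : ℕ}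
    {p : MvPolynomial (Option (Fin (k + 2))) ℂ}
    (hp : IsSymbol (signs k) lam N p) : ∃ c : ℂ, p = C c * symbolD0 n k lam N := by
  have hd := isSymbol_symbolD0 k hn lam N
  by_cases h : Even N
  · refine IsSymbol.exists_eq (k := N / 2) (r := 0) (signs_mul_self k) (by omega)
      (by rw [Nat.even_iff] at h; omega) hd ?_ hp
    rw [symbolD0, if_pos h]
    exact slice_symbolSum _ _ _ _ (by simp [evenCoeff])
  · refine IsSymbol.exists_eq (k := N / 2) (r := 1) (signs_mul_self k) (by omega)
      (by rw [Nat.not_even_iff] at h; omega) hd ?_ hp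
    rw [symbolD0, if_neg h]
    exact slice_symbolSum _ _ _ _ (by simp [oddCoeff])

end Symbols

/-! ### The action of `𝔤` on symbols -/

section SymbolAction

open MvPolynomial

theorem rightOp_mul_rightOp {m : ℕ} (X Y : soLie m) :
    rightOp X * rightOp Y = rightOp Y * rightOp X + rightOp ⁅X, Y⁆ := by
  have h : rightOp ⁅X, Y⁆ = rightOp X * rightOp Y - rightOp Y * rightOp X :=
    LieHom.map_lie (rightLie m) X Y
  rw [h]
  abel

theorem rightOp_smul {m : ℕ} (c : ℝ) (X : soLie m) : rightOp (c • X) = (c : ℂ) • rightOp X := by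
  have h : rightOp (c • X) = c • rightOp X := map_smul (rightLie m) c X
  rw [h]
  exact (algebraMap_smul ℂ c (rightOp X)).symm

theorem rightOp_add {m : ℕ} (X Y : soLie m) : rightOp (X + Y) = rightOp X + rightOp Y :=
  map_add (rightLie m) X Y

theorem rightOp_sub {m : ℕ} (X Y : soLie m) : rightOp (X - Y) = rightOp X - rightOp Y :=
  map_sub (rightLie m) X Y

theorem rightOp_neg {m : ℕ} (X : soLie m) : rightOp (-X) = -rightOp X :=
  map_neg (rightLie m) X

theorem rightOp_zero {m : ℕ} : rightOp (0 : soLie m) = 0 :=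
  map_zero (rightLie m)

/-- The infinitesimal form of the equivariance under `M_0 A N^+`. -/
structure IsInfInd {m : ℕ} (lam : ℂ) (u : Smooth m) : Prop where
  m_le : mLie m ≤ annih u
  n_le : nPlus m ≤ annih u
  H_eq : rightOp (HLie m) u = lam • u

variable (k : ℕ) {m : ℕ} (hm : k + 4 ≤ m)

/-- The differential operator with a given symbol. -/
def opSymbol : MvPolynomial (Option (Fin (k + 2))) ℂ →ₐ[ℂ] Module.End ℂ (Smooth m) :=
  (diffOp m).comp (ofSymbol k hm)

/-- The root vector `X_a^-` that belongs to a variable. -/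
def lowerVar (m : ℕ) (o : Option (Fin (k + 2))) : soLie m := lower m (coord (pos k o))

theorem opSymbol_X (o : Option (Fin (k + 2))) : opSymbol k hm (X o) = rightOp (lowerVar k m o) := by
  rw [opSymbol, AlgHom.comp_apply, ofSymbol_X, genU, diffOp_toU]
  rfl

variable {k}

theorem IsInfInd.rightOp_H {lam : ℂ} {u : Smooth m} (hu : IsInfInd lam u)
    (p : MvPolynomial (Option (Fin (k + 2))) ℂ) :
    rightOp (HLie m) (opSymbol k hm p u) =
      opSymbol k hm (C lam * p - euler (Option (Fin (k + 2))) p) u := by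
  rw [sub_eq_add_neg, ← Derivation.neg_apply]
  refine apply_derivation (opSymbol k hm) _ (-euler (Option (Fin (k + 2)))) (fun o => ?_) hu.H_eq p
  rw [opSymbol_X, rightOp_mul_rightOp, lowerVar,
    lie_H_lower (by omega) (coord_ne_zero _) (coord_ne_three _), Derivation.neg_apply, euler_X,
    map_neg, opSymbol_X, rightOp_neg, lowerVar]

theorem opSymbol_C_mul_X (c : ℝ) (o : Option (Fin (k + 2))) :
    opSymbol k hm (C (c : ℂ) * X o) = rightOp (c • lowerVar k m o) := by
  rw [map_C_mul, opSymbol_X, rightOp_smul]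

theorem opSymbol_rot_X (a b o : Option (Fin (k + 2))) :
    opSymbol k hm (rot (extSign (signs k)) a b (X o)) =
      rightOp ⁅rotLie m (coord (pos k a)) (coord (pos k b)), lowerVar k m o⁆ := by
  have h : ∀ (c d : Option (Fin (k + 2))) (q : MvPolynomial (Option (Fin (k + 2))) ℂ),
      q * pderiv c (X d) = if c = d then q else 0 := by
    intro c d q
    split_ifs with hcd
    · rw [hcd, pderiv_X_self, mul_one]
    · rw [pderiv_X_of_ne (Ne.symm hcd), mul_zero]
  rw [lowerVar, lie_rot_lower (coord_ne_zero _)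
      (coord_ne_three _) (coord_ne_zero _) (coord_ne_three _) (coord_ne_zero _) (coord_ne_three _)
      (coord_pos_le k hm a) (coord_pos_le k hm b), rot_apply, h, h, extSign_signs, extSign_signs,
    map_sub, rightOp_sub]
  simp only [coord_pos_eq_iff]
  congr 1
  · split_ifs
    · exact opSymbol_C_mul_X hm _ _
    · rw [map_zero, rightOp_zero]
  · split_ifs
    · exact opSymbol_C_mul_X hm _ _
    · rw [map_zero, rightOp_zero]

theorem IsInfInd.rightOp_rot {lam : ℂ} {u : Smooth m} (hu : IsInfInd lam u)
    (a b : Option (Fin (k + 2))) (p : MvPolynomial (Option (Fin (k + 2))) ℂ) :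
    rightOp (rotLie m (coord (pos k a)) (coord (pos k b))) (opSymbol k hm p u) =
      opSymbol k hm (rot (extSign (signs k)) a b p) u := by
  have h0 : rightOp (rotLie m (coord (pos k a)) (coord (pos k b))) u = (0 : ℂ) • u := by
    rw [zero_smul]
    exact hu.m_le (rotLie_coord_mem _ _ _)
  have h := apply_derivation (opSymbol k hm) _ (rot (extSign (signs k)) a b) (fun o => ?_) h0 p
  · rw [C_0, zero_mul, zero_add] at h
    exact h
  · rw [opSymbol_X, rightOp_mul_rightOp, opSymbol_rot_X]

theorem IsInfInd.rightOp_upper {lam : ℂ} {u : Smooth m} (hu : IsInfInd lam u)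
    (c : Option (Fin (k + 2))) (p : MvPolynomial (Option (Fin (k + 2))) ℂ) :
    rightOp (upper m (coord (pos k c))) (opSymbol k hm p u) =
      opSymbol k hm (conf (extSign (signs k)) lam c p) u := by
  refine apply_conf (opSymbol k hm) (extSign_mul_self k) (h := rightOp (HLie m))
    (l := fun a b => rightOp (rotLie m (coord (pos k a)) (coord (pos k b))))
    (y := fun c => rightOp (upper m (coord (pos k c))))
    (fun p => hu.rightOp_H hm p)
    (fun a b p => hu.rightOp_rot hm a b p) (fun c d => ?_) (fun c => hu.n_le (upper_coord_mem _ _)) c p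
  rw [opSymbol_X, rightOp_mul_rightOp, lowerVar, lie_upper_lower (by omega) (coord_ne_zero _)
    (coord_ne_three _) (coord_ne_zero _) (coord_ne_three _) (coord_pos_le k hm c), add_assoc,
    rightOp_add, rightOp_smul, extSign_signs]
  congr 2
  · simp only [coord_pos_eq_iff]
    split_ifs
    · rw [rightOp_smul]
      norm_num
    · exact rightOp_zero
  · push_cast
    rfl

end SymbolAction

/-! ### The inclusion `𝔤_m → 𝔤_{m+1}` -/

section Embedding

variable {m : ℕ}

/-- The inclusion `X ↦ diag(X, 0)` of matrices. -/
def embZero : Mat m →ₗ[ℝ] Mat (m + 1) where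
  toFun A := Matrix.reindex finSumFinEquiv finSumFinEquiv
    (Matrix.fromBlocks A 0 0 (0 : Matrix (Fin 1) (Fin 1) ℝ))
  map_add' A B := by
    ext i j
    obtain ⟨i, rfl⟩ := finSumFinEquiv.surjective i
    obtain ⟨j, rfl⟩ := finSumFinEquiv.surjective j
    rcases i with i | i <;> rcases j with j | j <;> simp
  map_smul' c A := by
    ext i j
    obtain ⟨i, rfl⟩ := finSumFinEquiv.surjective i
    obtain ⟨j, rfl⟩ := finSumFinEquiv.surjective j
    rcases i with i | i <;> rcases j with j | j <;> simp

theorem embZero_apply (A : Mat m) : embZero A = Matrix.reindex finSumFinEquiv finSumFinEquiv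
    (Matrix.fromBlocks A 0 0 (0 : Matrix (Fin 1) (Fin 1) ℝ)) := rfl

theorem embZero_mul (A B : Mat m) : embZero (A * B) = embZero A * embZero B := by
  simp only [embZero_apply, Matrix.reindex_apply, Matrix.submatrix_mul_equiv,
    Matrix.fromBlocks_multiply]
  simp

theorem embMat_mul_embZero (A B : Mat m) : embMat A * embZero B = embZero (A * B) := by
  simp only [embMat, embZero_apply, Matrix.reindex_apply, Matrix.submatrix_mul_equiv,
    Matrix.fromBlocks_multiply]
  simp

theorem embZero_mul_embMat (A B : Mat m) : embZero A * embMat B = embZero (A * B) := by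
  simp only [embMat, embZero_apply, Matrix.reindex_apply, Matrix.submatrix_mul_equiv,
    Matrix.fromBlocks_multiply]
  simp

theorem embMat_eq (A : Mat m) : embMat A = embZero A + (1 - embZero 1) := by
  ext i j
  obtain ⟨i, rfl⟩ := finSumFinEquiv.surjective i
  obtain ⟨j, rfl⟩ := finSumFinEquiv.surjective j
  rcases i with i | i <;> rcases j with j | j <;>
    simp [embMat, embZero_apply, Matrix.one_apply, Fin.ext_iff] <;> omega

theorem embZero_transpose (A : Mat m) : (embZero A)ᵀ = embZero Aᵀ := by
  simp only [embZero_apply, Matrix.reindex_apply, Matrix.transpose_submatrix,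
    Matrix.fromBlocks_transpose, Matrix.transpose_zero]

/-- The exponential series of `diag(A, 0)` is the image of that of `A` except for the term of order
zero, where `1 - embZero 1` supplies the missing last diagonal entry. -/
theorem exp_embZero (A : Mat m) : NormedSpace.exp (embZero A) = embMat (NormedSpace.exp A) := by
  have h1 := NormedSpace.exp_series_hasSum_exp' (𝕂 := ℝ) A
  have h2 := h1.mapL (LinearMap.toContinuousLinearMap (embZero (m := m)))
  have h3 : HasSum (fun n : ℕ => if n = 0 then (1 - embZero 1 : Mat (m + 1)) else 0)
      (1 - embZero 1) := hasSum_ite_eq 0 _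
  have h4 := h2.add h3
  have h5 := NormedSpace.exp_series_hasSum_exp' (𝕂 := ℝ) (embZero A)
  rw [embMat_eq]
  refine h5.unique ?_
  have e : (fun n : ℕ => ((n.factorial : ℝ)⁻¹) • embZero A ^ n) = fun n : ℕ =>
      LinearMap.toContinuousLinearMap (embZero (m := m)) (((n.factorial : ℝ)⁻¹) • A ^ n) +
        if n = 0 then 1 - embZero 1 else 0 := ?_
  · rw [e]
    exact h4
  funext n
  change _ = embZero (((n.factorial : ℝ)⁻¹) • A ^ n) + _
  rcases n with _ | n
  · simp
  · have h6 : ∀ n : ℕ, embZero (A ^ (n + 1)) = embZero A ^ (n + 1) := by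
      intro n
      induction n with
      | zero => simp
      | succ n ih => rw [pow_succ, embZero_mul, ih, ← pow_succ]
    rw [map_smul, h6, if_neg n.succ_ne_zero, add_zero]

theorem embZero_E {i j : ℕ} (hi : i ≤ m) (hj : j ≤ m) : embZero (E m i j) = E (m + 1) i j := by
  ext a b
  obtain ⟨a, rfl⟩ := finSumFinEquiv.surjective a
  obtain ⟨b, rfl⟩ := finSumFinEquiv.surjective b
  rcases a with a | a <;> rcases b with b | b <;> simp [embZero_apply, E] <;> omega

/-- The inclusion `𝔤_m → 𝔤_{m+1}`. -/
def embLie (hm : 1 ≤ m) : soLie m →ₗ⁅ℝ⁆ soLie (m + 1) where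
  toFun X := ⟨embZero (X : Mat m), by
    have h : (X : Mat m)ᵀ * eta m = eta m * (-(X : Mat m)) := mem_soLie.mp X.2
    rw [mem_soLie, ← embMat_eta hm, ← map_neg, embZero_transpose, embZero_mul_embMat,
      embMat_mul_embZero, h]⟩
  map_add' X Y := Subtype.ext (map_add embZero _ _)
  map_smul' c X := Subtype.ext (map_smul embZero _ _)
  map_lie' := by
    intro X Y
    refine Subtype.ext ?_
    change embZero ((X : Mat m) * (Y : Mat m) - (Y : Mat m) * (X : Mat m)) =
      embZero (X : Mat m) * embZero (Y : Mat m) - embZero (Y : Mat m) * embZero (X : Mat m)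
    rw [map_sub, embZero_mul, embZero_mul]

theorem emb_expG (hm : 1 ≤ m) (X : soLie m) : emb hm (expG X) = expG (embLie hm X) :=
  mat_injective (exp_embZero (X : Mat m)).symm

theorem embLie_HLie (hm : 3 ≤ m) : embLie (by omega) (HLie m) = HLie (m + 1) := by
  refine Subtype.ext ?_
  change embZero (H m) = H (m + 1)
  rw [H, H, map_add, embZero_E (by omega) (by omega), embZero_E (by omega) (by omega)]

theorem embLie_upper (hm : 3 ≤ m) {a : ℕ} (ha : a ≤ m) :
    embLie (by omega) (upper m a) = upper (m + 1) a := by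
  refine Subtype.ext ?_
  change embZero (upperMat m a) = upperMat (m + 1) a
  simp only [upperMat, map_add, map_sub, map_smul, embZero_E (Nat.zero_le m) ha,
    embZero_E ha (Nat.zero_le m), embZero_E ha hm, embZero_E hm ha]

theorem embLie_rotLie (hm : 3 ≤ m) {a b : ℕ} (ha : a ≤ m) (hb : b ≤ m) :
    embLie (by omega) (rotLie m a b) = rotLie (m + 1) a b := by
  refine Subtype.ext ?_
  change embZero (rotMat m a b) = rotMat (m + 1) a b
  simp only [rotMat, map_sub, map_smul, embZero_E ha hb, embZero_E hb ha]

end Embedding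

/-! ### Membership in the induced representations -/

section Membership

variable {m l : ℕ}

theorem mem_Ind_iff {ι : G m →* G l} {S : Subgroup (G m)} {σ : S →* ℂ} {lam : ℂ} {u : Smooth l} :
    u ∈ (Ind ι S σ lam).toSubmodule ↔
      (∀ (x : G l) (g : S), u.1 (x * ι g) = σ g * u.1 x) ∧
      (∀ (x : G l) (t : ℝ), u.1 (x * ι (expG (t • HLie m))) = Complex.exp (lam * t) * u.1 x) ∧
      (∀ (x : G l), ∀ ν ∈ Nplus m, u.1 (x * ι ν) = u.1 x) := by
  constructor
  · intro hu
    refine ⟨fun x g => ?_, fun x t => ?_, fun x ν hν => ?_⟩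
    · have h := hu x g 0 1
      rw [expG_zero_smul] at h
      simpa using h
    · have h := hu x 1 t 1
      simpa using h
    · have h := hu x 1 0 ⟨ν, hν⟩
      rw [expG_zero_smul] at h
      simpa using h
  · rintro ⟨h1, h2, h3⟩ x g t ν
    rw [map_mul, map_mul, ← mul_assoc, ← mul_assoc, h3 _ _ ν.2, h2, h1]
    ring

/-- The infinitesimal form of the equivariance under `M_0 A N^+`, through a homomorphism of Lie
algebras. -/
structure IsInfIndVia (f : soLie m →ₗ⁅ℝ⁆ soLie l) (lam : ℂ) (u : Smooth l) : Prop where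
  m_mem : ∀ X ∈ mLie m, f X ∈ annih u
  n_mem : ∀ X ∈ nPlus m, f X ∈ annih u
  H_eq : rightOp (f (HLie m)) u = lam • u

theorem IsInfIndVia.of_mem {ι : G m →* G l} {f : soLie m →ₗ⁅ℝ⁆ soLie l}
    (hf : ∀ X, ι (expG X) = expG (f X)) {S : Subgroup (G m)} {σ : S →* ℂ} (hS : M₀ m ≤ S)
    (hσ : ∀ g : S, (g : G m) ∈ M₀ m → σ g = 1) {lam : ℂ} {u : Smooth l}
    (hu : u ∈ (Ind ι S σ lam).toSubmodule) : IsInfIndVia f lam u := by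
  obtain ⟨h1, h2, h3⟩ := mem_Ind_iff.mp hu
  refine ⟨fun X hX => ?_, fun X hX => ?_, rightOp_eq_smul fun x t => ?_⟩
  · refine mem_annih_of_invariant hf (h := mLie m) (fun g hg x => ?_) hX
    rw [h1 x ⟨g, hS hg⟩, hσ ⟨g, hS hg⟩ hg, one_mul]
  · exact mem_annih_of_invariant hf (h := nPlus m) (fun g hg x => h3 x g hg) hX
  · rw [← h2, hf, map_smul]

/-- The infinitesimal conditions integrate over the connected groups `M_0`, `A`, `N^+`. The subgroup
`T`, which together with `M_0` generates `S`, carries the remaining components, where equivariance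
is assumed. -/
theorem IsInfIndVia.mem {ι : G m →* G l} {f : soLie m →ₗ⁅ℝ⁆ soLie l}
    (hf : ∀ X, ι (expG X) = expG (f X)) {lam : ℂ} {u : Smooth l} (hu : IsInfIndVia f lam u)
    {S T : Subgroup (G m)} {σ : S →* ℂ} (hS : S ≤ T ⊔ M₀ m)
    (hσ : ∀ g : S, (g : G m) ∈ M₀ m → σ g = 1) (hT : T ≤ S) (hM : M₀ m ≤ S)
    (hT' : ∀ g (hg : g ∈ T) (x : G l), u.1 (x * ι g) = σ ⟨g, hT hg⟩ * u.1 x) :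
    u ∈ (Ind ι S σ lam).toSubmodule := by
  refine mem_Ind_iff.mpr ⟨?_, fun x t => ?_, fun x ν hν => ?_⟩
  -- The elements of `S` under which `u` is equivariant form a subgroup, so generators suffice.
  · let R : Subgroup (G m) :=
      { carrier := {g | ∃ h : g ∈ S, ∀ x, u.1 (x * ι g) = σ ⟨g, h⟩ * u.1 x}
        one_mem' := ⟨one_mem S, fun x => by
          rw [map_one, mul_one, show (⟨1, one_mem S⟩ : S) = 1 from rfl, map_one, one_mul]⟩
        mul_mem' := by
          rintro a b ⟨ha, ha'⟩ ⟨hb, hb'⟩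
          refine ⟨mul_mem ha hb, fun x => ?_⟩
          rw [map_mul, ← mul_assoc, hb', ha', show (⟨a * b, mul_mem ha hb⟩ : S) = ⟨a, ha⟩ * ⟨b, hb⟩
            from rfl, map_mul]
          ring
        inv_mem' := by
          rintro a ⟨ha, ha'⟩
          refine ⟨inv_mem ha, fun x => ?_⟩
          have h := ha' (x * ι a⁻¹)
          have h1 : σ ⟨a⁻¹, inv_mem ha⟩ * σ ⟨a, ha⟩ = 1 := by
            rw [← map_mul, show (⟨a⁻¹, inv_mem ha⟩ : S) * ⟨a, ha⟩ = 1 from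
              Subtype.ext (inv_mul_cancel a), map_one]
          rw [map_inv, inv_mul_cancel_right] at h
          rw [h, map_inv, ← mul_assoc, h1, one_mul] }
    have hR : T ⊔ M₀ m ≤ R := by
      refine sup_le (fun g hg => ⟨hT hg, hT' g hg⟩) fun g hg => ⟨hM hg, fun x => ?_⟩
      rw [hσ _ hg, one_mul]
      exact apply_mul_of_mem_analyticSubgroup hf hu.m_mem hg x
    intro x g
    obtain ⟨h, h'⟩ := hR (hS g.2)
    exact h' x
  · rw [hf, map_smul]
    exact apply_mul_expG hu.H_eq x t
  · exact apply_mul_of_mem_analyticSubgroup hf hu.n_mem hν x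

theorem IsInfInd.of_mem {S : Subgroup (G m)} (hS : M₀ m ≤ S) {lam : ℂ} {u : Smooth m}
    (hu : u ∈ (Ind (MonoidHom.id (G m)) S 1 lam).toSubmodule) : IsInfInd lam u := by
  have h := IsInfIndVia.of_mem (f := LieHom.id) (fun X => rfl) hS (fun _ _ => rfl) hu
  exact ⟨h.m_mem, h.n_mem, h.H_eq⟩

theorem M₀_le_M (m : ℕ) : M₀ m ≤ M m := le_sup_right

theorem M₀_le_Mhat (m : ℕ) : M₀ m ≤ Mhat m := le_sup_right

end Membership

/-! ### Covariance in terms of symbols -/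

section Substitution

open MvPolynomial

theorem mul_map_eq {A ι : Type*} [Semiring A] [Algebra ℂ A] (Φ : MvPolynomial ι ℂ →ₐ[ℂ] A) {B : A}
    (θ : MvPolynomial ι ℂ →ₐ[ℂ] MvPolynomial ι ℂ) (h : ∀ i, B * Φ (X i) = Φ (θ (X i)) * B)
    (p : MvPolynomial ι ℂ) : B * Φ p = Φ (θ p) * B := by
  induction p using MvPolynomial.induction_on with
  | C a =>
    have e : (C a : MvPolynomial ι ℂ) = algebraMap ℂ _ a := rfl
    simp only [e, AlgHom.commutes]
    exact (Algebra.commutes a B).symm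
  | add p q hp hq => rw [map_add, map_add, map_add, mul_add, add_mul, hp, hq]
  | mul_X p i hp => rw [map_mul, map_mul, map_mul, ← mul_assoc, hp, mul_assoc, h, mul_assoc]

end Substitution

section Covariance

open MvPolynomial

variable {k n : ℕ}

/-- Seen in `𝔤_{n+1}`, the rotations and the `X_c^+` of `𝔤_n` are those attached to the variables
other than `none`, which are exactly the ones that occur in `IsSymbol`. -/
theorem isInfIndVia_of_isSymbol (hn : n = k + 3) (hm : k + 4 ≤ n + 1) (hn1 : 1 ≤ n) {lam : ℂ} {N : ℕ}
    {p : MvPolynomial (Option (Fin (k + 2))) ℂ} (hp : IsSymbol (signs k) lam N p)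
    {u : Smooth (n + 1)} (hu : IsInfInd lam u) :
    IsInfIndVia (embLie hn1) (lam - N) (opSymbol k hm p u) := by
  have hle : ∀ i, i + 2 ≤ n → coord i ≤ n := fun i hi => coord_le hi (by omega)
  refine ⟨fun X hX => ?_, fun X hX => ?_, ?_⟩
  · refine mLie_le (h := (annih (opSymbol k hm p u)).comap (embLie hn1)) (by omega)
      (fun i j hi hj => ?_) hX
    have h := hu.rightOp_rot hm (some ⟨i, by omega⟩) (some ⟨j, by omega⟩) p
    rw [hp.rot_eq, map_zero, LinearMap.zero_apply] at h
    change rightOp (embLie hn1 (rotLie n (coord i) (coord j))) _ = 0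
    rw [embLie_rotLie (by omega) (hle i hi) (hle j hj)]
    exact h
  · refine nPlus_le (h := (annih (opSymbol k hm p u)).comap (embLie hn1)) (by omega)
      (fun i hi => ?_) hX
    have h := hu.rightOp_upper hm (some ⟨i, by omega⟩) p
    rw [hp.conf_eq, map_zero, LinearMap.zero_apply] at h
    change rightOp (embLie hn1 (upper n (coord i))) _ = 0
    rw [embLie_upper (by omega) (hle i hi)]
    exact h
  · rw [embLie_HLie (by omega), hu.rightOp_H hm, hp.euler_eq, ← sub_mul, ← C_sub, map_C_mul,
      LinearMap.smul_apply]

/-- Each covariance condition says that the operator with a certain symbol kills `V`; by `hfaith`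
that symbol is zero. -/
theorem isSymbol_of_isInfIndVia (hn : n = k + 3) (hm : k + 4 ≤ n + 1) (hn1 : 1 ≤ n) {lam : ℂ} {N : ℕ}
    {p : MvPolynomial (Option (Fin (k + 2))) ℂ} {V : Set (Smooth (n + 1))}
    (hV : ∀ u ∈ V, IsInfInd lam u)
    (hfaith : ∀ r, (∀ u ∈ V, opSymbol k hm r u = 0) → r = 0)
    (h : ∀ u ∈ V, IsInfIndVia (embLie hn1) (lam - N) (opSymbol k hm p u)) :
    IsSymbol (signs k) lam N p := by
  have hle : ∀ i : Fin (k + 2), coord i ≤ n := fun i => coord_le (by omega) (by omega)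
  refine ⟨?_, fun a b => ?_, fun c => ?_⟩
  · have h0 := hfaith (C (N : ℂ) * p - euler _ p) fun u hu => ?_
    · exact (sub_eq_zero.mp h0).symm
    · have h1 := (hV u hu).rightOp_H hm p
      have h2 := (h u hu).H_eq
      rw [embLie_HLie (by omega), h1] at h2
      have e : C (N : ℂ) * p - euler _ p = (C lam * p - euler _ p) - C (lam - N) * p := by
        rw [C_sub]; ring
      rw [e, map_sub, LinearMap.sub_apply, h2, map_C_mul, LinearMap.smul_apply, sub_self]
  · refine hfaith _ fun u hu => ?_
    have h1 := (hV u hu).rightOp_rot hm (some a) (some b) p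
    rw [← h1]
    have h2 := (h u hu).m_mem _ (rotLie_coord_mem n a b)
    rw [embLie_rotLie (by omega) (hle a) (hle b)] at h2
    exact h2
  · refine hfaith _ fun u hu => ?_
    have h1 := (hV u hu).rightOp_upper hm (some c) p
    rw [← h1]
    have h2 := (h u hu).n_mem _ (upper_coord_mem n c)
    rw [embLie_upper (by omega) (hle c)] at h2
    exact h2

/-- `D` induces an equivariant map as soon as it maps `V` into `W`. -/
theorem induces_opSymbol_iff {m : ℕ} (hm : k + 4 ≤ m) (p : MvPolynomial (Option (Fin (k + 2))) ℂ)
    (V W : Subrepresentation (leftRep m)) :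
    Induces (ofSymbol k hm p) V W ↔
      ∀ u ∈ V.toSubmodule, opSymbol k hm p u ∈ W.toSubmodule := by
  constructor
  · rintro ⟨T, hT⟩ u hu
    have h := hT ⟨u, hu⟩
    have h' : opSymbol k hm p u = (T ⟨u, hu⟩ : Smooth m) := h.symm
    rw [h']
    exact (T ⟨u, hu⟩).2
  · intro h
    -- Left and right translations commute, so equivariance is automatic.
    have hcomm : ∀ g : G m, leftRep m g * opSymbol k hm p = opSymbol k hm p * leftRep m g := by
      intro g
      refine mul_map_eq (opSymbol k hm) (AlgHom.id ℂ _) (fun i => ?_) p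
      rw [AlgHom.id_apply, opSymbol_X, leftRep_mul_rightOp]
    refine ⟨⟨(opSymbol k hm p).restrict h, fun g => ?_⟩, fun u => rfl⟩
    ext1 u
    exact Subtype.ext (congrArg (fun T : Module.End ℂ (Smooth m) => T u.1) (hcomm g)).symm

end Covariance

/-! ### The action of `Z_K(𝔞)` -/

section ZKa

open MvPolynomial

variable {m : ℕ}

theorem mul_E_apply (A : Mat m) {i j : ℕ} (hi : i < m + 1) (x y : Fin (m + 1)) :
    (A * E m i j) x y = if y.val = j then A x ⟨i, hi⟩ else 0 := by
  rw [Matrix.mul_apply, Finset.sum_eq_single (⟨i, hi⟩ : Fin (m + 1))]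
  · simp [E]
  · intro z _ hz
    have : z.val ≠ i := fun h => hz (Fin.ext h)
    simp [E, this]
  · simp

theorem E_mul_apply (A : Mat m) {i j : ℕ} (hj : j < m + 1) (x y : Fin (m + 1)) :
    (E m i j * A) x y = if x.val = i then A ⟨j, hj⟩ y else 0 := by
  rw [Matrix.mul_apply, Finset.sum_eq_single (⟨j, hj⟩ : Fin (m + 1))]
  · simp [E]
  · intro z _ hz
    have : z.val ≠ j := fun h => hz (Fin.ext h)
    simp [E, this]
  · simp

/-- Both `e_0` and `e_3` split off as invariant lines, and since `H` exchanges the two vectors, `g`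
acts on both by the same scalar `g_{00}`. -/
theorem ZKa_entries (hm : 4 ≤ m) {g : G m} (hg : g ∈ ZKa m) (h3 : 3 < m + 1) (x : Fin (m + 1)) :
    (mat g x 0 = if x.val = 0 then mat g 0 0 else 0) ∧
    (mat g 0 x = if x.val = 0 then mat g 0 0 else 0) ∧
    (mat g x ⟨3, h3⟩ = if x.val = 3 then mat g 0 0 else 0) ∧
    (mat g ⟨3, h3⟩ x = if x.val = 3 then mat g 0 0 else 0) := by
  have hax := ZKa_le_axis hm hg
  have h0 : (⟨0, by omega⟩ : Fin (m + 1)) = 0 := rfl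
  have e : ∀ x y : Fin (m + 1), (mat g * H m) x y = (H m * mat g) x y := fun x y => by rw [hg.2]
  simp only [H, mul_add, add_mul, Matrix.add_apply, mul_E_apply _ (show 0 < m + 1 by omega),
    mul_E_apply _ h3, E_mul_apply _ (show 0 < m + 1 by omega), E_mul_apply _ h3, h0] at e
  have a1 : mat g x 0 = if x.val = 0 then mat g 0 0 else 0 := by
    split_ifs with h
    · rw [show x = 0 from Fin.ext h]
    · exact (hax x fun h' => h (congrArg Fin.val h')).1
  have a2 : mat g 0 x = if x.val = 0 then mat g 0 0 else 0 := by
    split_ifs with h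
    · rw [show x = 0 from Fin.ext h]
    · exact (hax x fun h' => h (congrArg Fin.val h')).2
  have h30 : mat g ⟨3, h3⟩ 0 = 0 := (hax ⟨3, h3⟩ fun h' => by simpa using congrArg Fin.val h').1
  have h03 : mat g 0 ⟨3, h3⟩ = 0 := (hax ⟨3, h3⟩ fun h' => by simpa using congrArg Fin.val h').2
  refine ⟨a1, a2, ?_, ?_⟩
  · have h := e x 0
    simp only [Fin.val_zero, h30] at h
    simpa using h
  · have h := e 0 x
    simp only [Fin.val_zero, h03] at h
    simpa using h.symm

theorem ZKa_sq (hm : 4 ≤ m) {g : G m} (hg : g ∈ ZKa m) : mat g 0 0 * mat g 0 0 = 1 := by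
  have h := congrFun (congrFun hg.1 0) 0
  rw [Matrix.mul_apply, Finset.sum_eq_single 0] at h
  · simpa using h
  · intro b _ hb
    rw [Matrix.transpose_apply, (ZKa_le_axis hm hg b hb).1, zero_mul]
  · simp

theorem ZKa_mul_eta_mul_transpose {g : G m} (hg : g ∈ ZKa m) :
    mat g * eta m * (mat g)ᵀ = eta m := by
  have h1 : mat g * (mat g)ᵀ = 1 := mul_eq_one_comm.mp hg.1
  calc mat g * eta m * (mat g)ᵀ = mat g * ((mat g)ᵀ * eta m * mat g) * (mat g)ᵀ := by rw [mat_gram]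
    _ = (mat g * (mat g)ᵀ) * eta m * (mat g * (mat g)ᵀ) := by simp only [mul_assoc]
    _ = eta m := by rw [h1, one_mul, mul_one]

/-- This is `Ad(g) X_a^- = g_{00} ∑_b g_{ba} X_b^-`. The columns `0` and `3` are handled by
`g_{00}^2 = 1`, the rows `0` and `3` by the Gram relation `hη`. The summands `b = 0, 3` are included
but vanish by `ZKa_entries`. -/
theorem ZKa_conj_lower (hm : 4 ≤ m) {g : G m} (hg : g ∈ ZKa m) {a : Fin (m + 1)} (ha : a.val ≠ 0)
    (ha' : a.val ≠ 3) :
    mat g * lowerMat m a =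
      (∑ b : Fin (m + 1), (mat g 0 0 * mat g b a) • lowerMat m b) * mat g := by
  have h3 : 3 < m + 1 := by omega
  have h0 : (⟨0, by omega⟩ : Fin (m + 1)) = 0 := rfl
  have hη : ∀ y, ∑ b : Fin (m + 1), mat g b a * (sgn b * mat g b y) =
      if y = a then sgn a else 0 := by
    intro y
    have h := congrFun (congrFun (mat_gram g) a) y
    rw [mul_assoc, Matrix.mul_apply] at h
    simp only [eta, Matrix.diagonal_mul, Matrix.transpose_apply, Matrix.diagonal_apply] at h
    rw [h]
    simp only [eq_comm]
  ext x y
  obtain ⟨x0, _, x3, _⟩ := ZKa_entries hm hg h3 x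
  obtain ⟨_, y0, _, y3⟩ := ZKa_entries hm hg h3 y
  have hsq := ZKa_sq hm hg
  rw [Finset.sum_mul, Matrix.sum_apply]
  have hterm : ∀ b : Fin (m + 1), ((mat g 0 0 * mat g b a) • lowerMat m b * mat g) x y =
      (if x = b then mat g 0 0 * mat g b a * (mat g 0 y + mat g ⟨3, h3⟩ y) else 0) +
      mat g 0 0 * ((if x.val = 0 then 1 else 0) - (if x.val = 3 then 1 else 0)) *
        (mat g b a * (sgn b * mat g b y)) := by
    intro b
    simp only [lowerMat, add_mul, sub_mul, smul_mul_assoc, Matrix.add_apply, Matrix.sub_apply,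
      Matrix.smul_apply, E_mul_apply _ (show 0 < m + 1 by omega), E_mul_apply _ h3,
      E_mul_apply _ b.2, h0, smul_eq_mul, Fin.ext_iff]
    split_ifs <;> ring
  rw [Finset.sum_congr rfl fun b _ => hterm b, Finset.sum_add_distrib, ← Finset.mul_sum, hη]
  simp only [lowerMat, mul_add, mul_sub, mul_smul_comm, Matrix.add_apply, Matrix.sub_apply,
    Matrix.smul_apply, mul_E_apply _ (show 0 < m + 1 by omega), mul_E_apply _ h3,
    mul_E_apply _ a.2, h0, smul_eq_mul, Finset.sum_ite_eq, Finset.mem_univ, if_true]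
  rw [x0, x3, y0, y3]
  have ea : (⟨a.val, a.2⟩ : Fin (m + 1)) = a := rfl
  simp only [ea, Fin.ext_iff]
  by_cases hy0 : y.val = 0
  · have hya : y.val ≠ a.val := fun h => ha (h ▸ hy0)
    simp only [hy0, if_true, if_neg (show ¬ (0 : ℕ) = 3 by omega), if_neg (Ne.symm ha)]
    linear_combination (-mat g x a) * hsq
  · by_cases hy3 : y.val = 3
    · simp only [hy3, if_true, if_neg (show ¬ (3 : ℕ) = 0 by omega), if_neg (Ne.symm ha')]
      linear_combination (-mat g x a) * hsq
    · simp only [if_neg hy0, if_neg hy3]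
      split_ifs <;> first | omega | ring

variable {k : ℕ}

theorem sum_fin_eq_sum_pos {A : Type*} [AddCommMonoid A] (hk : m = k + 4) (f : ℕ → A) (h0 : f 0 = 0)
    (h3 : f 3 = 0) : ∑ i : Fin (m + 1), f i = ∑ o, f (coord (pos k o)) := by
  rw [Fin.sum_univ_eq_sum_range f (m + 1), hk, Finset.sum_range_succ', Finset.sum_range_succ',
    Finset.sum_range_succ', Finset.sum_range_succ', Fintype.sum_option, Finset.sum_range_succ]
  have h : ∑ c : Fin (k + 2), f (coord (pos k (some c))) =
      ∑ i ∈ Finset.range k, f (i + 1 + 1 + 1 + 1) + f 2 + f 1 := by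
    refine (Fin.sum_univ_eq_sum_range (fun i => f (coord i)) (k + 2)).trans ?_
    rw [Finset.sum_range_succ', Finset.sum_range_succ']
    congr 2
    refine Finset.sum_congr rfl fun i _ => congrArg f ?_
    change 4 + i = _
    omega
  rw [h, h0, add_zero, show 0 + 1 + 1 + 1 = 3 from rfl, h3, add_zero,
    show coord (pos k none) = k + 1 + 1 + 1 + 1 from by change 4 + k = _; omega]
  abel

/-- The index of the coordinate that belongs to a variable. -/
def coordFin (hm : k + 4 ≤ m) (o : Option (Fin (k + 2))) : Fin (m + 1) :=
  ⟨coord (pos k o), Nat.lt_succ_of_le (coord_pos_le k hm o)⟩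

/-- The coefficients of the conjugation action of `g` on `𝔫^-`. -/
def conjCoeff (hm : k + 4 ≤ m) (g : G m) (b a : Option (Fin (k + 2))) : ℝ :=
  mat g 0 0 * mat g (coordFin hm b) (coordFin hm a)

/-- The conjugation action of `g` on symbols. -/
def conjSymbol (hm : k + 4 ≤ m) (g : G m) :
    MvPolynomial (Option (Fin (k + 2))) ℂ →ₐ[ℂ] MvPolynomial (Option (Fin (k + 2))) ℂ :=
  aeval fun a => ∑ b, C (conjCoeff hm g b a : ℂ) * X b

theorem sum_eq_sum_coordFin (hk : m = k + 4) (hm : k + 4 ≤ m) {A : Type*} [AddCommMonoid A]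
    (f : Fin (m + 1) → A) (hf0 : f 0 = 0) (hf3 : f ⟨3, by omega⟩ = 0) :
    ∑ i : Fin (m + 1), f i = ∑ o, f (coordFin hm o) := by
  have h := sum_fin_eq_sum_pos (k := k) hk (fun i => if h : i < m + 1 then f ⟨i, h⟩ else 0)
    (by simpa using hf0) (by rw [dif_pos (show 3 < m + 1 by omega)]; exact hf3)
  simp only [Fin.is_lt, dif_pos, Fin.eta] at h
  rw [h]
  exact Finset.sum_congr rfl fun o _ => dif_pos (coordFin hm o).2

theorem rightTrans_mul_opSymbol (hk : m = k + 4) (hm : k + 4 ≤ m) {g : G m} (hg : g ∈ ZKa m)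
    (p : MvPolynomial (Option (Fin (k + 2))) ℂ) :
    rightTrans g * opSymbol k hm p = opSymbol k hm (conjSymbol hm g p) * rightTrans g := by
  refine mul_map_eq (opSymbol k hm) (conjSymbol hm g) (fun a => ?_) p
  have h1 : opSymbol k hm (conjSymbol hm g (X a)) =
      rightOp (∑ b, conjCoeff hm g b a • lowerVar k m b) := by
    rw [conjSymbol, aeval_X, map_sum]
    have e : rightOp (∑ b, conjCoeff hm g b a • lowerVar k m b) =
      ∑ b, rightOp (conjCoeff hm g b a • lowerVar k m b) := map_sum (rightLie m) _ _
    rw [e]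
    exact Finset.sum_congr rfl fun b _ => opSymbol_C_mul_X hm _ _
  rw [h1, opSymbol_X]
  refine rightTrans_mul_rightOp ?_
  have h2 := ZKa_conj_lower (by omega) hg (a := coordFin hm a) (coord_ne_zero _) (coord_ne_three _)
  obtain ⟨_, z0, _, z3⟩ := ZKa_entries (by omega) hg (by omega) (coordFin hm a)
  replace z0 := z0.trans (if_neg (coord_ne_zero _))
  replace z3 := z3.trans (if_neg (coord_ne_three _))
  rw [sum_eq_sum_coordFin hk hm _ (by rw [z0, mul_zero, zero_smul])
    (by rw [z3, mul_zero, zero_smul])] at h2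
  refine h2.trans (congrArg (· * mat g) ?_)
  have e : ((∑ b, conjCoeff hm g b a • lowerVar k m b : soLie m) : Mat m) =
      ∑ b, conjCoeff hm g b a • lowerMat m (coord (pos k b)) := by
    rw [AddSubmonoidClass.coe_finsetSum]
    rfl
  rw [e]
  rfl

/-- The sign `g_{00}` enters twice and cancels, which leaves `g η gᵗ = η` restricted to the
coordinates other than `0` and `3`. -/
theorem conjCoeff_orthogonal (hk : m = k + 4) (hm : k + 4 ≤ m) {g : G m} (hg : g ∈ ZKa m)
    (b d : Option (Fin (k + 2))) :
    ∑ a, extSign (signs k) a * ((conjCoeff hm g b a : ℂ) * (conjCoeff hm g d a : ℂ)) =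
      if b = d then extSign (signs k) b else 0 := by
  have h := congrFun (congrFun (ZKa_mul_eta_mul_transpose hg) (coordFin hm b)) (coordFin hm d)
  rw [Matrix.mul_apply] at h
  simp only [eta, Matrix.mul_diagonal, Matrix.transpose_apply, Matrix.diagonal_apply] at h
  obtain ⟨z0, _, z3, _⟩ := ZKa_entries (by omega) hg (by omega) (coordFin hm b)
  replace z0 := z0.trans (if_neg (coord_ne_zero _))
  replace z3 := z3.trans (if_neg (coord_ne_three _))
  rw [sum_eq_sum_coordFin hk hm _ (by rw [z0, zero_mul, zero_mul])
    (by rw [z3, zero_mul, zero_mul])] at h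
  have hsq := ZKa_sq (by omega) hg
  have e : ∀ a, extSign (signs k) a * ((conjCoeff hm g b a : ℂ) * (conjCoeff hm g d a : ℂ)) =
      ((mat g (coordFin hm b) (coordFin hm a) * sgn (coordFin hm a).val *
        mat g (coordFin hm d) (coordFin hm a) : ℝ) : ℂ) := by
    intro a
    rw [extSign_signs, ← Complex.ofReal_mul, ← Complex.ofReal_mul]
    congr 1
    change sgn (coord (pos k a)) * (mat g 0 0 * mat g (coordFin hm b) (coordFin hm a) *
      (mat g 0 0 * mat g (coordFin hm d) (coordFin hm a))) =
      mat g (coordFin hm b) (coordFin hm a) * sgn (coord (pos k a)) *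
        mat g (coordFin hm d) (coordFin hm a)
    linear_combination (mat g (coordFin hm b) (coordFin hm a) * sgn (coord (pos k a)) *
        mat g (coordFin hm d) (coordFin hm a)) * hsq
  rw [Finset.sum_congr rfl fun a _ => e a, ← Complex.ofReal_sum, h, extSign_signs]
  have e2 : coordFin hm b = coordFin hm d ↔ b = d := by
    rw [Fin.ext_iff]
    exact coord_pos_eq_iff k
  simp only [e2]
  split_ifs
  · rfl
  · exact Complex.ofReal_zero

theorem conjSymbol_quad (hk : m = k + 4) (hm : k + 4 ≤ m) {g : G m} (hg : g ∈ ZKa m) :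
    conjSymbol hm g (quad (extSign (signs k))) = quad (extSign (signs k)) := by
  have h1 : ∀ a, conjSymbol hm g (C (extSign (signs k) a) * X a ^ 2) =
      ∑ b, ∑ d, C (extSign (signs k) a * ((conjCoeff hm g b a : ℂ) * (conjCoeff hm g d a : ℂ))) *
        (X b * X d) := by
    intro a
    rw [map_C_mul, map_pow, conjSymbol, aeval_X, pow_two, Finset.sum_mul_sum, smul_eq_C_mul,
      Finset.mul_sum]
    refine Finset.sum_congr rfl fun b _ => ?_
    rw [Finset.mul_sum]
    refine Finset.sum_congr rfl fun d _ => ?_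
    rw [C_mul, C_mul]
    ring
  rw [quad, map_sum, Finset.sum_congr rfl fun a _ => h1 a, Finset.sum_comm]
  refine Finset.sum_congr rfl fun b _ => ?_
  rw [Finset.sum_comm]
  have h2 : ∀ d, ∑ a, C (extSign (signs k) a * ((conjCoeff hm g b a : ℂ) *
      (conjCoeff hm g d a : ℂ))) * (X b * X d) =
      if b = d then C (extSign (signs k) b) * (X b * X d : MvPolynomial (Option (Fin (k + 2))) ℂ)
        else 0 := by
    intro d
    rw [← Finset.sum_mul, ← map_sum, conjCoeff_orthogonal hk hm hg]
    split_ifs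
    · rfl
    · rw [C_0, zero_mul]
  rw [Finset.sum_congr rfl fun d _ => h2 d, Finset.sum_ite_eq, if_pos (Finset.mem_univ _), pow_two]

theorem conjSymbol_X_none (hm : k + 4 ≤ m) {g : G m}
    (hlast : ∀ b, mat g b (coordFin hm none) = if b = coordFin hm none then 1 else 0) :
    conjSymbol hm g (X none) = C (mat g 0 0 : ℂ) * X none := by
  rw [conjSymbol, aeval_X, Finset.sum_eq_single none]
  · rw [conjCoeff, hlast, if_pos rfl, mul_one]
  · intro b _ hb
    rw [conjCoeff, hlast, if_neg, mul_zero, Complex.ofReal_zero, C_0, zero_mul]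
    rw [Fin.ext_iff]
    exact fun h => hb ((coord_pos_eq_iff k).mp h)
  · simp

theorem conjSymbol_symbolSum (hk : m = k + 4) (hm : k + 4 ≤ m) {g : G m} (hg : g ∈ ZKa m)
    (hlast : ∀ b, mat g b (coordFin hm none) = if b = coordFin hm none then 1 else 0)
    (a : ℕ → ℂ) (l r : ℕ) :
    conjSymbol hm g (symbolSum (signs k) a l r) =
      C ((mat g 0 0 : ℂ) ^ r) * symbolSum (signs k) a l r := by
  have hsq : (C (mat g 0 0 : ℂ) : MvPolynomial (Option (Fin (k + 2))) ℂ) ^ 2 = 1 := by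
    rw [← C_pow, pow_two, ← Complex.ofReal_mul, ZKa_sq (by omega) hg, Complex.ofReal_one, C_1]
  have hX := conjSymbol_X_none hm hlast
  -- The full quadratic form is invariant, and so is `T²` because `T` only changes by a sign. Hence
  -- the form in the other variables is invariant too, and only the parity of the power of `T`
  -- matters.
  have hq : quad (extSign (signs k)) = X none ^ 2 + quadSome (signs k) := by
    rw [quad, Fintype.sum_option, quadSome]
    simp [extSign]
  have hQ : conjSymbol hm g (quadSome (signs k)) = quadSome (signs k) := by
    have h := conjSymbol_quad hk hm hg
    rw [hq, map_add, map_pow, hX, mul_pow, hsq, one_mul] at h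
    exact add_left_cancel h
  rw [symbolSum, map_sum, Finset.mul_sum]
  refine Finset.sum_congr rfl fun j _ => ?_
  rw [map_C_mul, map_mul, map_pow, map_pow, hQ, hX, mul_pow, pow_add (C _), pow_mul (C _), hsq,
    one_pow, one_mul, smul_eq_C_mul, C_pow]
  ring

theorem conjSymbol_symbolD0 (hk : m = k + 4) (hm : k + 4 ≤ m) {g : G m} (hg : g ∈ ZKa m)
    (hlast : ∀ b, mat g b (coordFin hm none) = if b = coordFin hm none then 1 else 0)
    (n : ℕ) (lam : ℂ) (N : ℕ) :
    conjSymbol hm g (symbolD0 n k lam N) = C ((mat g 0 0 : ℂ) ^ N) * symbolD0 n k lam N := by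
  have hsq : (mat g 0 0 : ℂ) ^ 2 = 1 := by
    rw [pow_two, ← Complex.ofReal_mul, ZKa_sq (by omega) hg, Complex.ofReal_one]
  rw [symbolD0]
  split_ifs with h
  · obtain ⟨j, hj⟩ := h.two_dvd
    rw [conjSymbol_symbolSum hk hm hg hlast, pow_zero]
    conv_rhs => rw [show (mat g 0 0 : ℂ) ^ N = 1 by rw [hj, pow_mul, hsq, one_pow]]
  · obtain ⟨j, hj⟩ := Nat.not_even_iff_odd.mp h
    rw [conjSymbol_symbolSum hk hm hg hlast, pow_one]
    conv_rhs => rw [show (mat g 0 0 : ℂ) ^ N = mat g 0 0 by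
      rw [hj, pow_succ, pow_mul, hsq, one_pow, one_mul]]

end ZKa

/-! ### The images of `Z_K(𝔞)` under the inclusion -/

section EmbZKa

variable {n : ℕ}

theorem mat_emb (hn : 1 ≤ n) (g : G n) : mat (emb hn g) = embMat (mat g) := rfl

theorem emb_mem_ZKa (hn : 3 ≤ n) {g : G n} (hg : g ∈ ZKa n) :
    emb (by omega) g ∈ ZKa (n + 1) := by
  have hH : embZero (H n) = H (n + 1) := congrArg Subtype.val (embLie_HLie hn)
  refine ⟨?_, ?_⟩
  · rw [mat_emb, embMat_transpose, ← embMat_mul, hg.1, embMat_one]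
  · rw [mat_emb, ← hH, embMat_mul_embZero, hg.2, embZero_mul_embMat]

theorem embMat_castAdd (A : Mat n) (i j : Fin (n + 1)) :
    embMat A (Fin.castAdd 1 i) (Fin.castAdd 1 j) = A i j := by
  simp [embMat]

theorem embMat_zero_zero (A : Mat n) : embMat A 0 0 = A 0 0 := embMat_castAdd A 0 0

theorem embMat_last (A : Mat n) (b c : Fin (n + 1 + 1)) (hc : c.val = n + 1) :
    embMat A b c = if b = c then 1 else 0 := by
  obtain ⟨b, rfl⟩ := finSumFinEquiv.surjective b
  obtain ⟨c, rfl⟩ := finSumFinEquiv.surjective c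
  rcases b with b | b <;> rcases c with c | c
  · simp at hc; omega
  · simp [embMat, Fin.ext_iff]; omega
  · simp at hc; omega
  · simp [embMat, Matrix.one_apply]

theorem signElt_mem_ZKa (m : ℕ) (s : Set ℕ) [DecidablePred (· ∈ s)] (h : 0 ∈ s ↔ 3 ∈ s) :
    signElt m s ∈ ZKa m := by
  refine ⟨?_, ?_⟩
  · rw [signElt, mat_ofMat, Matrix.diagonal_transpose, Matrix.diagonal_mul_diagonal,
      ← Matrix.diagonal_one]
    congr 1
    ext i
    split_ifs <;> norm_num
  · rw [signElt, mat_ofMat]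
    ext i j
    rw [Matrix.diagonal_mul, Matrix.mul_diagonal]
    have hH : H m i j = (if i.val = 0 ∧ j.val = 3 then 1 else 0) +
        if i.val = 3 ∧ j.val = 0 then 1 else 0 := rfl
    have hc : ∀ a b, a = 0 ∧ b = 3 → ((if a ∈ s then -1 else 1 : ℝ) = if b ∈ s then -1 else 1) := by
      rintro a b ⟨rfl, rfl⟩
      by_cases h0 : 0 ∈ s
      · rw [if_pos h0, if_pos (h.mp h0)]
      · rw [if_neg h0, if_neg fun h' => h0 (h.mpr h')]
    by_cases h1 : i.val = 0 ∧ j.val = 3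
    · rw [hc _ _ h1, mul_comm]
    · by_cases h2 : i.val = 3 ∧ j.val = 0
      · rw [hc _ _ h2.symm, mul_comm]
      · rw [hH, if_neg h1, if_neg h2]
        simp

theorem emb_signElt (hn : 1 ≤ n) (s : Set ℕ) [DecidablePred (· ∈ s)] (h : n + 1 ∉ s) :
    emb hn (signElt n s) = signElt (n + 1) s := by
  refine mat_injective ?_
  rw [mat_emb, signElt, signElt, mat_ofMat, mat_ofMat]
  ext i j
  obtain ⟨i, rfl⟩ := finSumFinEquiv.surjective i
  obtain ⟨j, rfl⟩ := finSumFinEquiv.surjective j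
  rcases i with i | i <;> rcases j with j | j <;>
    simp [embMat, Matrix.diagonal_apply, Matrix.one_apply, Fin.ext_iff, h] <;> omega

end EmbZKa

/-! ### Functions on the light cone -/

section Cone

open MvPolynomial

variable {m : ℕ}

/-- The `i`-th coordinate of `Z (e_0 + e_3)`. -/
def coneLin (hm : 3 < m + 1) (i : Fin (m + 1)) : Mat m →L[ℝ] ℂ :=
  LinearMap.toContinuousLinearMap
    { toFun := fun Z => ((Z i 0 + Z i ⟨3, hm⟩ : ℝ) : ℂ)
      map_add' := fun Z W => by simp only [Matrix.add_apply]; push_cast; ring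
      map_smul' := fun c Z => by
        simp only [Matrix.smul_apply, smul_eq_mul, RingHom.id_apply, Complex.real_smul]
        push_cast
        ring }

/-- The `i`-th coordinate of `x (e_0 + e_3)`, as a function of `x`. -/
def cone (hm : 3 < m + 1) (i : Fin (m + 1)) : Smooth m :=
  ⟨fun x => coneLin hm i (mat x), fun _ => ⟨Set.univ, isOpen_univ, Set.mem_univ _, coneLin hm i,
    (coneLin hm i).contDiff.contDiffOn, fun _ _ => rfl⟩⟩

theorem cone_apply (hm : 3 < m + 1) (i : Fin (m + 1)) (x : G m) :
    (cone hm i).1 x = ((mat x i 0 + mat x i ⟨3, hm⟩ : ℝ) : ℂ) := rfl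

theorem rightOp_cone (hm : 3 < m + 1) (i : Fin (m + 1)) (X : soLie m) (x : G m) :
    (rightOp X (cone hm i)).1 x =
      (((mat x * (X : Mat m)) i 0 + (mat x * (X : Mat m)) i ⟨3, hm⟩ : ℝ) : ℂ) := by
  rw [rightOp_eq X (cone hm i) isOpen_univ (coneLin hm i).contDiff.contDiffOn (fun _ _ => rfl)
    (Set.mem_univ _)]
  exact DFunLike.congr_fun (ContinuousLinearMap.fderiv (coneLin hm i)) _

/-- The light vector `e_0 + e_3` is killed by `𝔪` and `𝔫^+` and is an eigenvector of `H` with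
eigenvalue `1`. Functions of `x (e_0 + e_3)` that are homogeneous of degree `λ` and even are
therefore candidates for elements of the induced space. -/
theorem mLie_le_annih_cone (hm : 3 < m + 1) (i : Fin (m + 1)) : mLie m ≤ annih (cone hm i) := by
  refine mLie_le (by omega) fun a b ha hb => ?_
  rw [mem_annih]
  ext x
  rw [rightOp_cone]
  have h1 := coord_le ha (by omega)
  have h2 := coord_le hb (by omega)
  simp [rotLie, rotMat, mul_sub, mul_E_apply _ (Nat.lt_succ_of_le h1),
    mul_E_apply _ (Nat.lt_succ_of_le h2), (coord_ne_zero _).symm, (coord_ne_three _).symm]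

theorem nPlus_le_annih_cone (hm : 3 < m + 1) (i : Fin (m + 1)) : nPlus m ≤ annih (cone hm i) := by
  refine nPlus_le (by omega) fun a ha => ?_
  rw [mem_annih]
  ext x
  rw [rightOp_cone]
  have h1 := coord_le ha (by omega)
  simp [upper, upperMat, mul_sub, mul_add, mul_E_apply _ (Nat.lt_succ_of_le h1),
    mul_E_apply _ hm, mul_E_apply _ (show 0 < m + 1 by omega),
    (coord_ne_zero _).symm, (coord_ne_three _).symm]

theorem rightOp_H_cone (hm : 3 < m + 1) (i : Fin (m + 1)) :
    rightOp (HLie m) (cone hm i) = (1 : ℂ) • cone hm i := by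
  ext x
  rw [rightOp_cone, one_smul, cone_apply]
  simp [HLie, H, mul_add, mul_E_apply _ hm, mul_E_apply _ (show 0 < m + 1 by omega)]
  ring

/-- Since `X_a^- (e_0 + e_3) = 2 e_a`, the cone coordinates serve as linear coordinates along `𝔫^-`
at the identity. -/
theorem rightOp_lower_cone (hm : 3 < m + 1) (i : Fin (m + 1)) {a : Fin (m + 1)} (ha : a.val ≠ 0)
    (ha' : a.val ≠ 3) : (rightOp (lower m a) (cone hm i)).1 1 = if i = a then 2 else 0 := by
  rw [rightOp_cone, mat_one, one_mul]
  have h1 : (lower m a : Mat m) i 0 + (lower m a : Mat m) i ⟨3, hm⟩ =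
      if i.val = a.val then 2 else 0 := by
    by_cases h : i.val = a.val <;>
      simp [lower, lowerMat, E, h, ha.symm, ha'.symm, -Fin.val_eq_zero_iff]
    norm_num
  rw [h1]
  simp only [Fin.ext_iff]
  split_ifs <;> norm_num

theorem cone_one (hm : 3 < m + 1) {i : Fin (m + 1)} (hi : i.val ≠ 0) (hi' : i.val ≠ 3) :
    (cone hm i).1 1 = 0 := by
  have h0 : i ≠ 0 := fun h => hi (by rw [h]; rfl)
  have h3 : i ≠ ⟨3, hm⟩ := fun h => hi' (by rw [h])
  rw [cone_apply, mat_one, Matrix.one_apply_ne h0, Matrix.one_apply_ne h3]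
  simp

theorem cone_mul_analytic (hm : 3 < m + 1) (i : Fin (m + 1)) {g : G m} (hg : g ∈ M₀ m ⊔ Nplus m)
    (x : G m) : (cone hm i).1 (x * g) = (cone hm i).1 x := by
  let R : Subgroup (G m) :=
    { carrier := {g | ∀ x, (cone hm i).1 (x * g) = (cone hm i).1 x}
      one_mem' := fun x => by rw [mul_one]
      mul_mem' := fun {a b} ha hb x => by rw [← mul_assoc, hb, ha]
      inv_mem' := fun {a} ha x => by rw [← ha (x * a⁻¹), inv_mul_cancel_right] }
  have hR : M₀ m ⊔ Nplus m ≤ R := sup_le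
    (fun g hg => apply_mul_of_mem_analyticSubgroup (ι := MonoidHom.id _) (f := LieHom.id)
      (fun _ => rfl) (fun X hX => mLie_le_annih_cone hm i hX) hg)
    (fun g hg => apply_mul_of_mem_analyticSubgroup (ι := MonoidHom.id _) (f := LieHom.id)
      (fun _ => rfl) (fun X hX => nPlus_le_annih_cone hm i hX) hg)
  exact hR hg x

theorem cone_mul_ZKa (hm : 4 ≤ m) (h3 : 3 < m + 1) (i : Fin (m + 1)) {g : G m} (hg : g ∈ ZKa m)
    (x : G m) : (cone h3 i).1 (x * g) = (mat g 0 0 : ℂ) * (cone h3 i).1 x := by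
  rw [cone_apply, cone_apply, mat_mul, Matrix.mul_apply, Matrix.mul_apply,
    Finset.sum_eq_single 0, Finset.sum_eq_single ⟨3, h3⟩]
  · rw [(ZKa_entries hm hg h3 ⟨3, h3⟩).2.2.1, if_pos rfl]
    push_cast
    ring
  · intro b _ hb
    rw [(ZKa_entries hm hg h3 b).2.2.1, if_neg (fun h => hb (Fin.ext h)), mul_zero]
  · simp
  · intro b _ hb
    rw [(ZKa_entries hm hg h3 b).1, if_neg (fun h => hb (Fin.ext (by simpa using h))), mul_zero]
  · simp

/-- An element of `M` acts on the cone by a sign. -/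
theorem cone_mul_M (hm : 4 ≤ m) (h3 : 3 < m + 1) {g : G m} (hg : g ∈ M m) :
    ∃ ε : ℝ, ε ^ 2 = 1 ∧ ∀ (i : Fin (m + 1)) (x : G m),
      (cone h3 i).1 (x * g) = (ε : ℂ) * (cone h3 i).1 x := by
  let R : Subgroup (G m) :=
    { carrier := {g | ∃ ε : ℝ, ε ^ 2 = 1 ∧ ∀ (i : Fin (m + 1)) (x : G m),
        (cone h3 i).1 (x * g) = (ε : ℂ) * (cone h3 i).1 x}
      one_mem' := ⟨1, by norm_num, fun i x => by rw [mul_one]; simp⟩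
      mul_mem' := by
        rintro a b ⟨ε, hε, ha⟩ ⟨δ, hδ, hb⟩
        refine ⟨ε * δ, by rw [mul_pow, hε, hδ, one_mul], fun i x => ?_⟩
        rw [← mul_assoc, hb, ha]
        push_cast
        ring
      inv_mem' := by
        rintro a ⟨ε, hε, ha⟩
        refine ⟨ε, hε, fun i x => ?_⟩
        have h := ha i (x * a⁻¹)
        rw [inv_mul_cancel_right] at h
        have h2 : (ε : ℂ) ^ 2 = 1 := by exact_mod_cast hε
        rw [h, ← mul_assoc, ← pow_two, h2, one_mul] }
  have hR : M m ≤ R := sup_le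
    (fun g hg => ⟨mat g 0 0, by rw [pow_two]; exact ZKa_sq hm hg,
      fun i x => cone_mul_ZKa hm h3 i hg x⟩)
    (fun g hg => ⟨1, by norm_num, fun i x => by
      rw [cone_mul_analytic h3 i (Subgroup.mem_sup_left hg)]; simp⟩)
  exact hR hg

/-- The squared Euclidean length of `Z (e_0 + e_3)`. -/
def coneNormSq (hm : 3 < m + 1) (Z : Mat m) : ℝ := ∑ i, (Z i 0 + Z i ⟨3, hm⟩) ^ 2

theorem contDiff_coneNormSq (hm : 3 < m + 1) : ContDiff ℝ ∞ (coneNormSq (m := m) hm) := by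
  refine ContDiff.sum fun i _ => ContDiff.pow ?_ 2
  exact (LinearMap.toContinuousLinearMap
    { toFun := fun Z : Mat m => Z i 0 + Z i ⟨3, hm⟩
      map_add' := fun Z W => by simp only [Matrix.add_apply]; ring
      map_smul' := fun c Z => by simp [mul_add] }).contDiff

theorem coneNormSq_pos (hm : 3 < m + 1) (x : G m) : 0 < coneNormSq hm (mat x) := by
  refine lt_of_le_of_ne (Finset.sum_nonneg fun i _ => sq_nonneg _) fun h => ?_
  have h1 : ∀ i, mat x i 0 + mat x i ⟨3, hm⟩ = 0 := fun i => by
    have := (Finset.sum_eq_zero_iff_of_nonneg fun i _ => sq_nonneg _).mp h.symm i (Finset.mem_univ i)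
    exact pow_eq_zero_iff two_ne_zero |>.mp this
  have h2 : mat x⁻¹ * mat x = 1 := by rw [← mat_mul, inv_mul_cancel, mat_one]
  have h3 := congrFun (congrFun h2 0) 0
  have h4 := congrFun (congrFun h2 0) ⟨3, hm⟩
  have h5 : (0 : Fin (m + 1)) ≠ ⟨3, hm⟩ := fun h => by simpa using congrArg Fin.val h
  rw [Matrix.mul_apply, Matrix.one_apply_eq] at h3
  rw [Matrix.mul_apply, Matrix.one_apply_ne h5] at h4
  -- The coordinate `0` of `x⁻¹ x (e_0 + e_3)` is `1`, so `x (e_0 + e_3)` cannot vanish.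
  have h6 : ∑ i, mat x⁻¹ 0 i * (mat x i 0 + mat x i ⟨3, hm⟩) = 1 := by
    simp only [mul_add, Finset.sum_add_distrib]
    rw [h3, h4, add_zero]
  simp [h1] at h6

/-- The function `|x (e_0 + e_3)|^{2α}`. -/
def conePow (hm : 3 < m + 1) (α : ℂ) : Smooth m :=
  ⟨fun x => Complex.exp (α * (Real.log (coneNormSq hm (mat x)) : ℝ)), fun x =>
    ⟨{Z | coneNormSq hm Z ≠ 0}, isOpen_ne_fun (contDiff_coneNormSq hm).continuous continuous_const,
      (coneNormSq_pos hm x).ne', fun Z => Complex.exp (α * (Real.log (coneNormSq hm Z) : ℝ)),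
      ((contDiffOn_const (c := α)).mul (Complex.ofRealCLM.contDiff.comp_contDiffOn
        ((contDiff_coneNormSq hm).contDiffOn.log fun _ h => h))).cexp, fun _ _ => rfl⟩⟩

theorem conePow_apply (hm : 3 < m + 1) (α : ℂ) (x : G m) :
    (conePow hm α).1 x = Complex.exp (α * (Real.log (coneNormSq hm (mat x)) : ℝ)) := rfl

theorem coneNormSq_of_mul (hm : 3 < m + 1) {x y : G m} {c : ℝ}
    (h : ∀ i, (cone hm i).1 y = (c : ℂ) * (cone hm i).1 x) :
    coneNormSq hm (mat y) = c ^ 2 * coneNormSq hm (mat x) := by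
  rw [coneNormSq, coneNormSq, Finset.mul_sum]
  refine Finset.sum_congr rfl fun i _ => ?_
  have h1 := h i
  rw [cone_apply, cone_apply, ← Complex.ofReal_mul] at h1
  rw [Complex.ofReal_injective h1, mul_pow]

variable {k : ℕ}

/-- A homogeneous test function on the cone: a power of a linear form times a power of the length
and a power of the first coordinate. -/
def testFun (h3 : 3 < m + 1) (lam : ℂ) (d : ℕ) : Smooth m :=
  powMul (cone h3 0) d (conePow h3 ((lam - 2 * d) / 2))

/-- The linear form `∑ ζ_o x_o`. -/
def coneForm (hm : k + 4 ≤ m) (h3 : 3 < m + 1) (ζ : Option (Fin (k + 2)) → ℂ) : Smooth m :=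
  ∑ o, ζ o • cone h3 (coordFin hm o)

theorem coneForm_apply (hm : k + 4 ≤ m) (h3 : 3 < m + 1) (ζ : Option (Fin (k + 2)) → ℂ) (x : G m) :
    (coneForm hm h3 ζ).1 x = ∑ o, ζ o * (cone h3 (coordFin hm o)).1 x := by
  rw [coneForm, AddSubmonoidClass.coe_finsetSum, Finset.sum_apply]
  rfl

/-- The linear form and the first coordinate contribute `c^d` each; the extra first coordinates make
the total power even, so that the sign by which `M` acts disappears. The exponent `(λ - 2d)/2` of
the squared length then restores the degree `λ`. -/
theorem powMul_testFun_apply_of_mul (hm : k + 4 ≤ m) (h3 : 3 < m + 1) (ζ : Option (Fin (k + 2)) → ℂ)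
    (lam : ℂ) (d : ℕ) {x y : G m} {c : ℝ} (h : ∀ i, (cone h3 i).1 y = (c : ℂ) * (cone h3 i).1 x) :
    (powMul (coneForm hm h3 ζ) d (testFun h3 lam d)).1 y =
      (c : ℂ) ^ (2 * d) * Complex.exp ((lam - 2 * d) / 2 * (Real.log (c ^ 2) : ℝ)) *
        (powMul (coneForm hm h3 ζ) d (testFun h3 lam d)).1 x := by
  have hf : (coneForm hm h3 ζ).1 y = c * (coneForm hm h3 ζ).1 x := by
    rw [coneForm_apply, coneForm_apply, Finset.mul_sum]
    refine Finset.sum_congr rfl fun o _ => ?_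
    rw [h]
    ring
  have hn := coneNormSq_of_mul h3 h
  have hy := (coneNormSq_pos h3 y).ne'
  have hx := (coneNormSq_pos h3 x).ne'
  have hc : c ^ 2 ≠ 0 := fun h0 => hy (by rw [hn, h0, zero_mul])
  rw [powMul_apply, powMul_apply, testFun, powMul_apply, powMul_apply, conePow_apply, conePow_apply,
    hf, h, hn, Real.log_mul hc hx, Complex.ofReal_add, mul_add, Complex.exp_add]
  ring

theorem powMul_testFun_mem (hm4 : 4 ≤ m) (hm : k + 4 ≤ m) (h3 : 3 < m + 1)
    (ζ : Option (Fin (k + 2)) → ℂ) (lam : ℂ) (d : ℕ) :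
    powMul (coneForm hm h3 ζ) d (testFun h3 lam d) ∈
      (Ind (MonoidHom.id (G m)) (M m) 1 lam).toSubmodule := by
  refine mem_Ind_iff.mpr ⟨fun x g => ?_, fun x t => ?_, fun x ν hν => ?_⟩
  · obtain ⟨ε, hε, h⟩ := cone_mul_M hm4 h3 g.2
    have h2 : (ε : ℂ) ^ 2 = 1 := by exact_mod_cast hε
    have h1 := powMul_testFun_apply_of_mul hm h3 ζ lam d (x := x) (y := x * g) (c := ε)
      fun i => h i x
    rw [pow_mul, h2, hε] at h1
    simpa using h1
  · have h1 := powMul_testFun_apply_of_mul hm h3 ζ lam d (x := x) (y := x * expG (t • HLie m))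
      (c := Real.exp t) fun i => by
        rw [apply_mul_expG (rightOp_H_cone h3 i), one_mul, Complex.ofReal_exp]
    refine h1.trans (congrArg (· * _) ?_)
    rw [← Real.exp_nat_mul, Real.log_exp, Complex.ofReal_exp, ← Complex.exp_nat_mul,
      ← Complex.exp_add]
    congr 1
    push_cast
    ring
  · have h1 := powMul_testFun_apply_of_mul hm h3 ζ lam d (x := x) (y := x * ν) (c := 1) fun i => by
      rw [cone_mul_analytic h3 i (Subgroup.mem_sup_right hν)]; simp
    simpa using h1

/-- The value at the identity of a differential operator applied to `f^d u`, where `f` vanishes at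
the identity, only involves the part of degree `d` of its symbol. -/
theorem opSymbol_monomial_powMul (hm : k + 4 ≤ m) {f : Smooth m} (hf : f.1 1 = 0) (e : ℕ) :
    ∀ (β : Option (Fin (k + 2)) →₀ ℕ) (c : ℂ) (d : ℕ) (u : Smooth m), β.degree = e → e ≤ d →
      (opSymbol k hm (monomial β c) (powMul f d u)).1 1 =
        if e = d then (d.factorial : ℂ) * u.1 1 *
          eval (fun o => (rightOp (lowerVar k m o) f).1 1) (monomial β c) else 0 := by
  induction e with
  | zero =>
    intro β c d u hβ _
    have hβ0 : β = 0 := by simpa [Finsupp.degree_eq_zero_iff] using hβ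
    have h1 : opSymbol k hm (monomial β c) = c • 1 := by
      rw [hβ0, ← C_apply, ← mul_one (C c), map_C_mul, map_one]
    rw [h1, hβ0, ← C_apply, eval_C]
    change c * (f.1 1 ^ d * u.1 1) = _
    rcases d with _ | d
    · simp
      ring
    · rw [hf, if_neg (by omega)]
      simp
  | succ e ih =>
    intro β c d u hβ hd
    obtain ⟨d, rfl⟩ := Nat.exists_eq_add_of_le' (show 1 ≤ d by omega)
    obtain ⟨o, ho⟩ : ∃ o, β o ≠ 0 := by
      by_contra! h
      rw [show β = 0 from Finsupp.ext h] at hβ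
      simp at hβ
    obtain ⟨β', rfl⟩ : ∃ β', β = β' + Finsupp.single o 1 :=
      ⟨β - Finsupp.single o 1, (tsub_add_cancel_of_le (by
        rw [Finsupp.single_le_iff]; omega)).symm⟩
    have hβ' : β'.degree = e := by
      rw [map_add] at hβ
      simpa using hβ
    have hmon : monomial (β' + Finsupp.single o 1) c = monomial β' c * X o := by
      rw [monomial_add_single, pow_one]
    rw [hmon, map_mul, Module.End.mul_apply, opSymbol_X, rightOp_powMul, map_add, map_smul]
    -- If the derivative falls on `u`, there remain `d + 1` factors `f`, more than the other `e`
    -- derivatives can remove, so this term vanishes at the identity.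
    have h1 := ih β' c (d + 1) (rightOp (lowerVar k m o) u) hβ' (by omega)
    have h2 := ih β' c d (powMul (rightOp (lowerVar k m o) f) 1 u) hβ' (by omega)
    rw [if_neg (by omega)] at h1
    change (opSymbol k hm (monomial β' c) _).1 1 + ((d : ℂ) + 1) *
      (opSymbol k hm (monomial β' c) _).1 1 = _
    rw [h1, h2, zero_add]
    by_cases hed : e = d
    · rw [if_pos hed, if_pos (by omega), powMul_apply, map_mul, eval_X, Nat.factorial_succ]
      push_cast
      ring
    · rw [if_neg hed, if_neg (by omega), mul_zero]

theorem opSymbol_powMul (hm : k + 4 ≤ m) {f : Smooth m} (hf : f.1 1 = 0)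
    (p : MvPolynomial (Option (Fin (k + 2))) ℂ) (u : Smooth m) :
    (opSymbol k hm p (powMul f p.totalDegree u)).1 1 = (p.totalDegree.factorial : ℂ) * u.1 1 *
      eval (fun o => (rightOp (lowerVar k m o) f).1 1) (homogeneousComponent p.totalDegree p) := by
  classical
  have h0 : opSymbol k hm p = ∑ β ∈ p.support, opSymbol k hm (monomial β (coeff β p)) := by
    rw [← map_sum, ← as_sum]
  rw [h0, LinearMap.sum_apply, AddSubmonoidClass.coe_finsetSum, Finset.sum_apply,
    homogeneousComponent_apply, map_sum, Finset.mul_sum, Finset.sum_filter]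
  refine Finset.sum_congr rfl fun β hβ => ?_
  exact opSymbol_monomial_powMul hm hf β.degree β _ _ u rfl (by
    have := le_totalDegree hβ
    exact this)

/-- A symbol whose operator vanishes on the induced representation is zero. -/
theorem eq_zero_of_opSymbol_eq_zero (hm : k + 4 ≤ m) {lam : ℂ}
    {p : MvPolynomial (Option (Fin (k + 2))) ℂ}
    (h : ∀ u ∈ (Ind (MonoidHom.id (G m)) (M m) 1 lam).toSubmodule, (opSymbol k hm p u).1 1 = 0) :
    p = 0 := by
  have h3 : 3 < m + 1 := by omega
  have hhom : homogeneousComponent p.totalDegree p = 0 := by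
    refine MvPolynomial.funext fun z => ?_
    -- The division by `2` compensates the factor in `rightOp_lower_cone`, so that the top component
    -- is evaluated exactly at `z`.
    let ζ : Option (Fin (k + 2)) → ℂ := fun o => z o / 2
    have hf : (coneForm hm h3 ζ).1 1 = 0 := by
      rw [coneForm_apply]
      refine Finset.sum_eq_zero fun o _ => ?_
      rw [cone_one h3 (coord_ne_zero _) (coord_ne_three _), mul_zero]
    have h1 := h _ (powMul_testFun_mem (by omega) hm h3 ζ lam p.totalDegree)
    rw [opSymbol_powMul hm hf] at h1
    have hz : (fun o => (rightOp (lowerVar k m o) (coneForm hm h3 ζ)).1 1) = z := by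
      funext o
      have e1 : rightOp (lowerVar k m o) (coneForm hm h3 ζ) =
          ∑ b, ζ b • rightOp (lowerVar k m o) (cone h3 (coordFin hm b)) := by
        rw [coneForm, map_sum]
        exact Finset.sum_congr rfl fun b _ => map_smul _ _ _
      have e2 : ∀ b, (rightOp (lowerVar k m o) (cone h3 (coordFin hm b))).1 1 =
          if b = o then 2 else 0 := by
        intro b
        have := rightOp_lower_cone h3 (coordFin hm b) (a := coordFin hm o) (coord_ne_zero _)
          (coord_ne_three _)
        have e3 : coordFin hm b = coordFin hm o ↔ b = o := by
          rw [Fin.ext_iff]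
          exact coord_pos_eq_iff k
        simp only [e3] at this
        exact this
      rw [e1, AddSubmonoidClass.coe_finsetSum, Finset.sum_apply]
      change ∑ b, ζ b * (rightOp (lowerVar k m o) (cone h3 (coordFin hm b))).1 1 = _
      simp only [e2]
      simp [ζ]
    have hu : (testFun h3 lam p.totalDegree).1 1 ≠ 0 := by
      have h5 : (0 : Fin (m + 1)) ≠ ⟨3, h3⟩ := fun h => by simpa using congrArg Fin.val h
      rw [testFun, powMul_apply, conePow_apply, cone_apply, mat_one, Matrix.one_apply_eq,
        Matrix.one_apply_ne h5]
      simp [Complex.exp_ne_zero]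
    rw [hz] at h1
    rw [map_zero]
    refine (mul_eq_zero.mp h1).resolve_left (mul_ne_zero ?_ hu)
    exact_mod_cast Nat.factorial_ne_zero _
  by_contra hp
  -- A monomial of maximal degree survives in the top homogeneous component, so a nonzero `p` would
  -- contradict `hhom`.
  obtain ⟨β, hβ, hd⟩ := Finset.exists_mem_eq_sup p.support (support_nonempty.mpr hp)
    fun s => s.sum fun _ e => e
  have hc := congrArg (coeff β) hhom
  rw [coeff_homogeneousComponent, if_pos (by exact hd.symm), coeff_zero] at hc
  exact mem_support_iff.mp hβ hc

end Cone

/-! ### Proof of the main theorem -/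

section Main

open MvPolynomial

variable {k n : ℕ}

theorem mat_emb_coordFin (hn : n = k + 3) (hm : k + 4 ≤ n + 1) (hn1 : 1 ≤ n) (g : G n)
    (b : Fin (n + 1 + 1)) :
    mat (emb hn1 g) b (coordFin hm none) = if b = coordFin hm none then 1 else 0 := by
  rw [mat_emb]
  refine embMat_last _ _ _ ?_
  change coord (k + 2) = n + 1
  simp only [coord]
  omega

/-- Elements of `Z_K(𝔞)` act on the image of an invariant function by the sign `g_{00}^N`. -/
theorem opSymbol_symbolD0_apply_mul (hn : n = k + 3) (hm : k + 4 ≤ n + 1) (hn1 : 1 ≤ n)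
    {lam c : ℂ} {N : ℕ} {g : G n} (hg : g ∈ ZKa n) {u : Smooth (n + 1)}
    (hu : ∀ x, u.1 (x * emb hn1 g) = u.1 x) (hn3 : 3 ≤ n) (x : G (n + 1)) :
    (opSymbol k hm (C c * symbolD0 n k lam N) u).1 (x * emb hn1 g) =
      (mat g 0 0 : ℂ) ^ N * (opSymbol k hm (C c * symbolD0 n k lam N) u).1 x := by
  have hg' : emb hn1 g ∈ ZKa (n + 1) := emb_mem_ZKa hn3 hg
  have h1 := rightTrans_mul_opSymbol (by omega) hm hg' (C c * symbolD0 n k lam N)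
  have h2 : conjSymbol hm (emb hn1 g) (C c * symbolD0 n k lam N) =
      C ((mat g 0 0 : ℂ) ^ N) * (C c * symbolD0 n k lam N) := by
    have e : conjSymbol hm (emb hn1 g) (C c) = C c := AlgHom.commutes _ c
    rw [map_mul, e, conjSymbol_symbolD0 (by omega) hm hg' (mat_emb_coordFin hn hm hn1 g), mat_emb,
      embMat_zero_zero]
    ring
  have hu' : rightTrans (emb hn1 g) u = u := by
    ext y
    exact hu y
  rw [h2] at h1
  clear h2
  generalize C c * symbolD0 n k lam N = q at h1 ⊢
  rw [map_C_mul] at h1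
  have h3 := congrArg (fun T : Module.End ℂ (Smooth (n + 1)) => (T u).1 x) h1
  rw [← rightTrans_apply]
  refine h3.trans ?_
  change (mat g 0 0 : ℂ) ^ N * (opSymbol k hm q (rightTrans (emb hn1 g) u)).1 x = _
  rw [hu']

/-- Only equivariance under `M_0 A N^+` enters the uniqueness, hence `S` may be `M` or `M̂`. -/
theorem exists_eq_of_maps (hn : n = k + 3) (hm : k + 4 ≤ n + 1) (hn1 : 1 ≤ n) {lam : ℂ} {N : ℕ}
    {S : Subgroup (G n)} {σ : S →* ℂ} (hS : M₀ n ≤ S) (hσ : ∀ g : S, (g : G n) ∈ M₀ n → σ g = 1)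
    {p : MvPolynomial (Option (Fin (k + 2))) ℂ}
    (h : ∀ u ∈ (IndTop n lam).toSubmodule,
      opSymbol k hm p u ∈ (Ind (emb hn1) S σ (lam - N)).toSubmodule) :
    ∃ c : ℂ, p = C c * symbolD0 n k lam N :=
  exists_eq_symbolD0 k hn <| isSymbol_of_isInfIndVia hn hm hn1
    (V := ((IndTop n lam).toSubmodule : Set (Smooth (n + 1))))
    (fun _ hu => IsInfInd.of_mem (M₀_le_M _) hu)
    (fun _ hr => eq_zero_of_opSymbol_eq_zero hm fun u hu => by rw [hr u hu]; rfl)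
    fun u hu => IsInfIndVia.of_mem (emb_expG hn1) hS hσ (h u hu)

theorem maps_of_isInfInd (hn : n = k + 3) (hm : k + 4 ≤ n + 1) (hn1 : 1 ≤ n) (hn3 : 3 ≤ n)
    {lam c : ℂ} {N : ℕ} {S T : Subgroup (G n)} {σ : S →* ℂ} (hM : M₀ n ≤ S)
    (hσ : ∀ g : S, (g : G n) ∈ M₀ n → σ g = 1) (hS : S ≤ T ⊔ M₀ n) (hT : T ≤ S) (hTZ : T ≤ ZKa n)
    (hσ' : ∀ g (hg : g ∈ T), σ ⟨g, hT hg⟩ = (mat g 0 0 : ℂ) ^ N) {u : Smooth (n + 1)}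
    (hu : IsInfInd lam u) (huT : ∀ g ∈ T, ∀ x, u.1 (x * emb hn1 g) = u.1 x) :
    opSymbol k hm (C c * symbolD0 n k lam N) u ∈ (Ind (emb hn1) S σ (lam - N)).toSubmodule :=
  (isInfIndVia_of_isSymbol hn hm hn1 ((isSymbol_symbolD0 k hn lam N).C_mul c) hu).mem
    (emb_expG hn1) hS hσ hT hM fun g hg x => by
      rw [opSymbol_symbolD0_apply_mul hn hm hn1 (hTZ hg) (huT g hg) hn3, hσ' g hg]

theorem closure_w_le_ZKa (m : ℕ) : Subgroup.closure {w₁ m, w₂ m} ≤ ZKa m := by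
  refine (Subgroup.closure_le _).mpr ?_
  rintro g (rfl | rfl)
  · exact signElt_mem_ZKa m {1} (by simp)
  · exact signElt_mem_ZKa m {2} (by simp)

theorem Mhat_le_M (m : ℕ) : Mhat m ≤ M m := sup_le_sup_right (closure_w_le_ZKa m) _

theorem map_emb_closure (hn1 : 1 ≤ n) (hn2 : 2 ≤ n) :
    Subgroup.closure {w₁ n, w₂ n} ≤ (Mhat (n + 1)).comap (emb hn1) := by
  refine (Subgroup.closure_le _).mpr ?_
  rintro g (rfl | rfl)
  · change emb hn1 (signElt n {1}) ∈ Mhat (n + 1)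
    rw [emb_signElt hn1 _ (by simp; omega)]
    exact Subgroup.mem_sup_left (Subgroup.subset_closure (Or.inl rfl))
  · change emb hn1 (signElt n {2}) ∈ Mhat (n + 1)
    rw [emb_signElt hn1 _ (by simp; omega)]
    exact Subgroup.mem_sup_left (Subgroup.subset_closure (Or.inr rfl))

/-- The test functions of the smaller space thus also serve for `P̂`. -/
theorem IndTop_le_IndHatTop (n : ℕ) (lam : ℂ) {u : Smooth (n + 1)}
    (hu : u ∈ (IndTop n lam).toSubmodule) : u ∈ (IndHatTop n lam).toSubmodule := by
  obtain ⟨h1, h2, h3⟩ := mem_Ind_iff.mp hu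
  exact mem_Ind_iff.mpr ⟨fun x g => h1 x ⟨g, Mhat_le_M _ g.2⟩, h2, h3⟩

theorem apply_mul_of_mem_Ind {m : ℕ} {S : Subgroup (G m)} {lam : ℂ} {u : Smooth m}
    (hu : u ∈ (Ind (MonoidHom.id (G m)) S 1 lam).toSubmodule) {g : G m} (hg : g ∈ S) (x : G m) :
    u.1 (x * g) = u.1 x :=
  ((mem_Ind_iff.mp hu).1 x ⟨g, hg⟩).trans (one_mul _)

theorem J_mem_ZKa (m : ℕ) : J m ∈ ZKa m := signElt_mem_ZKa m Set.univ (by simp)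

theorem mat_J_zero_zero (m : ℕ) : mat (J m) 0 0 = -1 := by
  rw [J, signElt, mat_ofMat, Matrix.diagonal_apply_eq, if_pos (Set.mem_univ _)]

theorem mat_w_zero_zero {m : ℕ} (hm : 4 ≤ m) {g : G m} (hg : g ∈ Subgroup.closure {w₁ m, w₂ m}) :
    mat g 0 0 = 1 := by
  have h := sigmaMinus_Mhat hm ⟨g, Mhat_le_M m (Subgroup.mem_sup_left hg)⟩
    (Subgroup.mem_sup_left hg)
  rw [sigmaMinus_apply] at h
  exact_mod_cast h

/-- The operator vanishes if `J` acts on its values by a sign different from `(-1)^N`. -/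
theorem eq_zero_of_sign_ne (hn : n = k + 3) (hm : k + 4 ≤ n + 1) (hn1 : 1 ≤ n) (hn3 : 3 ≤ n)
    {lam c : ℂ} {N : ℕ} {σ : M n →* ℂ}
    (hσ : σ ⟨J n, Subgroup.mem_sup_left (J_mem_ZKa n)⟩ ≠ (-1) ^ N)
    (h : ∀ u ∈ (IndTop n lam).toSubmodule, opSymbol k hm (C c * symbolD0 n k lam N) u ∈
      (Ind (emb hn1) (M n) σ (lam - N)).toSubmodule) :
    C c * symbolD0 n k lam N = 0 := by
  refine eq_zero_of_opSymbol_eq_zero hm (lam := lam) fun u hu => ?_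
  have hJ : emb hn1 (J n) ∈ M (n + 1) := Subgroup.mem_sup_left (emb_mem_ZKa hn3 (J_mem_ZKa n))
  -- Translation by `J` multiplies the value at the identity both by `(-1)^N` and by `σ(J)`, which
  -- forces it to be zero.
  have h1 := opSymbol_symbolD0_apply_mul hn hm hn1 (lam := lam) (c := c) (N := N) (J_mem_ZKa n)
    (fun x => apply_mul_of_mem_Ind hu hJ x) hn3 1
  have h2 := (mem_Ind_iff.mp (h u hu)).1 1 ⟨J n, Subgroup.mem_sup_left (J_mem_ZKa n)⟩
  have h3 := h2.symm.trans h1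
  rw [mat_J_zero_zero, Complex.ofReal_neg, Complex.ofReal_one, ← sub_eq_zero, ← sub_mul] at h3
  exact (mul_eq_zero.mp h3).resolve_left (sub_ne_zero.mpr hσ)

theorem opSymbol_eq_of_eq_smul (hn : n = k + 3) (hm : k + 4 ≤ n + 1) {lam c : ℂ} {N : ℕ}
    {p : MvPolynomial (Option (Fin (k + 2))) ℂ} (hc : ofSymbol k hm p = c • D0 n lam N) :
    opSymbol k hm p = opSymbol k hm (C c * symbolD0 n k lam N) := by
  have h : ofSymbol k hm p = ofSymbol k hm (C c * symbolD0 n k lam N) := by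
    rw [hc, map_C_mul, ofSymbol_symbolD0 k hn]
  exact congrArg (diffOp (n + 1)) h

/-- The proposition `P` is the parity condition: if it holds, `σ` agrees with `g_{00}^N` on all of
`Z_K(𝔞)`; if it fails, `J` alone detects the difference. -/
theorem induces_IndSub_iff (hn4 : 4 ≤ n) (hn : n = k + 3) (hm : k + 4 ≤ n + 1) {lam : ℂ} {N : ℕ}
    {σ : M n →* ℂ} (hσ : ∀ g : M n, (g : G n) ∈ M₀ n → σ g = 1) (P : Prop)
    (hP : P → ∀ g (hg : g ∈ ZKa n), σ ⟨g, Subgroup.mem_sup_left hg⟩ = (mat g 0 0 : ℂ) ^ N)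
    (hP' : ¬P → σ ⟨J n, Subgroup.mem_sup_left (J_mem_ZKa n)⟩ ≠ (-1) ^ N)
    (D : UnMinus (n + 1)) :
    Induces D (IndTop n lam) (IndSub hn4 σ (lam - N)) ↔
      (∃ c : ℂ, D = c • D0 n lam N) ∧ (P ∨ D = 0) := by
  have hn1 : 1 ≤ n := by omega
  obtain ⟨p, rfl⟩ := ofSymbol_surjective k hm (by omega) D
  rw [induces_opSymbol_iff]
  constructor
  · intro h
    obtain ⟨c, rfl⟩ := exists_eq_of_maps hn hm hn1 (M₀_le_M n) hσ h
    refine ⟨⟨c, by rw [map_C_mul, ofSymbol_symbolD0 k hn]⟩, or_iff_not_imp_left.mpr fun hN => ?_⟩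
    rw [eq_zero_of_sign_ne hn hm hn1 (by omega) (hP' hN) h, map_zero]
  · rintro ⟨⟨c, hc⟩, h⟩ u hu
    rcases h with h | h
    · rw [opSymbol_eq_of_eq_smul hn hm hc]
      exact maps_of_isInfInd hn hm hn1 (by omega) (M₀_le_M n) hσ le_rfl le_sup_left le_rfl (hP h)
        (IsInfInd.of_mem (M₀_le_M _) hu) fun g hg x =>
          apply_mul_of_mem_Ind hu (Subgroup.mem_sup_left (emb_mem_ZKa (by omega) hg)) x
    · have e : opSymbol k hm p = 0 := by
        change diffOp (n + 1) (ofSymbol k hm p) = 0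
        rw [h, map_zero]
      rw [e]
      exact zero_mem _

/-- The group `⟨w₁, w₂⟩` has `g_{00} = 1`, so no parity condition appears. Necessity is tested on
the subspace induced from `P^{n+1}`; sufficiency uses that `w₁` and `w₂` of `G^n` are mapped to
those of `G^{n+1}`. -/
theorem induces_IndHatSub_iff (hn4 : 4 ≤ n) (hn : n = k + 3) (hm : k + 4 ≤ n + 1) {lam : ℂ} {N : ℕ}
    (D : UnMinus (n + 1)) :
    Induces D (IndHatTop n lam) (IndHatSub hn4 (lam - N)) ↔ ∃ c : ℂ, D = c • D0 n lam N := by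
  have hn1 : 1 ≤ n := by omega
  obtain ⟨p, rfl⟩ := ofSymbol_surjective k hm (by omega) D
  rw [induces_opSymbol_iff]
  constructor
  · intro h
    obtain ⟨c, rfl⟩ := exists_eq_of_maps hn hm hn1 (M₀_le_Mhat n) (fun _ _ => rfl)
      fun u hu => h u (IndTop_le_IndHatTop n lam hu)
    exact ⟨c, by rw [map_C_mul, ofSymbol_symbolD0 k hn]⟩
  · rintro ⟨c, hc⟩ u hu
    rw [opSymbol_eq_of_eq_smul hn hm hc]
    refine maps_of_isInfInd hn hm hn1 (by omega) (M₀_le_Mhat n) (fun _ _ => rfl) le_rfl le_sup_left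
      (closure_w_le_ZKa n) (fun g hg => ?_) (IsInfInd.of_mem (M₀_le_Mhat _) hu) fun g hg x =>
        apply_mul_of_mem_Ind hu (map_emb_closure hn1 (by omega) hg) x
    rw [mat_w_zero_zero hn4 hg, Complex.ofReal_one, one_pow]
    rfl

theorem ofReal_mat_sq {n : ℕ} (hn : 4 ≤ n) {g : G n} (hg : g ∈ ZKa n) : (mat g 0 0 : ℂ) ^ 2 = 1 := by
  rw [pow_two, ← Complex.ofReal_mul, ZKa_sq hn hg, Complex.ofReal_one]

end Main

end AdS

end

/-! ### The three equivalences -/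

theorem mainTheorem7 (n : ℕ) (hn : 4 ≤ n) (lam : ℂ) (N : ℕ) (D : AdS.UnMinus (n + 1)) :
    (AdS.Induces D (AdS.IndTop n lam) (AdS.IndSub hn 1 (lam - N)) ↔
      (∃ c : ℂ, D = c • AdS.D0 n lam N) ∧ (Even N ∨ D = 0)) ∧
    (AdS.Induces D (AdS.IndTop n lam) (AdS.IndSub hn (AdS.sigmaMinus hn) (lam - N)) ↔
      (∃ c : ℂ, D = c • AdS.D0 n lam N) ∧ (Odd N ∨ D = 0)) ∧
    (AdS.Induces D (AdS.IndHatTop n lam) (AdS.IndHatSub hn (lam - N)) ↔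
      ∃ c : ℂ, D = c • AdS.D0 n lam N) := by
  -- Here `k` is the number of the `Y_j^-` in `𝔫_n^-`.
  obtain ⟨k, hk⟩ : ∃ k, n = k + 3 := ⟨n - 3, by omega⟩
  have hm : k + 4 ≤ n + 1 := by omega
  refine ⟨AdS.induces_IndSub_iff hn hk hm (fun _ _ => rfl) _ (fun hN g hg => ?_) (fun hN => ?_) D,
    AdS.induces_IndSub_iff hn hk hm
      (fun g hg => AdS.sigmaMinus_Mhat hn g (AdS.M₀_le_Mhat n hg)) _ (fun hN g hg => ?_)
      (fun hN => ?_) D,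
    AdS.induces_IndHatSub_iff hn hk hm D⟩
  · obtain ⟨j, rfl⟩ := hN.two_dvd
    rw [pow_mul, AdS.ofReal_mat_sq hn hg, one_pow]
    rfl
  · rw [(Nat.not_even_iff_odd.mp hN).neg_one_pow]
    change (1 : ℂ) ≠ -1
    norm_num
  · obtain ⟨j, rfl⟩ := hN
    rw [pow_succ, pow_mul, AdS.ofReal_mat_sq hn hg, one_pow, one_mul, AdS.sigmaMinus_apply]
  · rw [AdS.sigmaMinus_J hn _ rfl, (Nat.not_odd_iff_even.mp hN).neg_one_pow]
    norm_num
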